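/- Let $n\ge 0$, let $X$ be a closed orientable smooth manifold of dimension $2n+2$, and let $Z\subset X$ be a nonempty connected closed embedded hypersurface. The scattering tangent bundle ${}^{\mathrm{sc}}TX$ is the vector bundle whose sections are the vector fields locally spanned by $x^2\partial_x,\,x\partial_{y_1},\dots,x\partial_{y_{2n+1}}$, where $(x,y_1,\dots,y_{2n+1})$ are coordinates with $Z=\{x=0\}$. Let $\omega$ be a scattering symplectic form on $(X,Z)$, i.e. a smooth nondegenerate section of $\Lambda^2({}^{\mathrm{sc}}T^*X)$ which is closed as a differential form on $X\setminus Z$. It induces a cooriented contact structure on $Z$: locally $\omega=\alpha_x\wedge\frac{dx}{x^3}+\frac{\beta_x}{x^2}$, and the structure is the kernel of $\alpha_x|_{TZ}$ at $x=0$, which is well defined up to a positive factor. Let $\alpha$ be a contact form on $Z$ defining this cooriented contact structure and put $\xi=\ker\alpha$. Let $\tau:\mathbb R\times Z\to X$ be a tubular neighbourhood embedding, i.e. a diffeomorphism onto an open set with $\tau(0,z)=z$ for $z\in Z$ (the normal bundle of $Z$ is trivial here); let $\varepsilon>0$ and $U=\tau((-\varepsilon,\varepsilon)\times Z)$. Let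 $W$ be a connected component of $X\setminus U$ contained in the connected component of $X$ that contains $Z$ (automatic if $X$ is connected). Then $W$ is a compact connected domain with smooth boundary $\partial W=\tau(\{s\}\times Z)$ for some $s\in\{\varepsilon,-\varepsilon\}$, and there is a symplectic form $\tilde\omega$ on $W$ such that, under the identification $\varphi:Z\to\partial W$, $\varphi(z)=\tau(s,z)$, $(W,\tilde\omega)$ is a weak symplectic filling of $(Z,\xi)$. That is: * the boundary orientation of $\partial W$ (outward normal first, $W$ being oriented by $\tilde\omega^{n+1}$) corresponds to the orientation of $Z$ given by $\alpha\wedge(d\alpha)^n$; * $(\varphi^*\tilde\omega)|_\xi$ is nondegenerate; * $(\varphi^*\tilde\omega)|_\xi+f\,d\alpha|_\xi$ is nondegenerate for every smooth function $f:Z\to(0,\infty)$. -/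

import Mathlib

open scoped Manifold ContDiff Topology

noncomputable section

namespace ScatteringFilling

/-- The model space `ℝ^d` with its Euclidean norm. -/
abbrev Euc (d : ℕ) : Type := EuclideanSpace ℝ (Fin d)

section Forms

variable {d k : ℕ} {M : Type*} [TopologicalSpace M] [ChartedSpace (Euc d) M]

/-- (Not necessarily continuous) differential `k`-forms on a `d`-dimensional manifold `M`. -/
abbrev DForm (d : ℕ) (M : Type*) [TopologicalSpace M] [ChartedSpace (Euc d) M] (k : ℕ) :
    Type _ :=
  ∀ p : M, TangentSpace (𝓡 d) p [⋀^Fin k]→L[ℝ] ℝ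

/-- The coordinate expression `(e⁻¹)^* Ω` of a form in a chart `e`; meaningful on `e.target`. -/
def inChart (e : OpenPartialHomeomorph M (Euc d)) (Ω : DForm d M k) :
    Euc d → Euc d [⋀^Fin k]→L[ℝ] ℝ :=
  fun u => (Ω (e.symm u)).compContinuousLinearMap (mfderiv (𝓡 d) (𝓡 d) e.symm u)

/-- `Ω` is a smooth form on the (open) set `S`: its coordinate expressions are smooth. -/
def SmoothFormOn (Ω : DForm d M k) (S : Set M) : Prop :=
  ∀ e ∈ atlas (Euc d) M, ContDiffOn ℝ ∞ (inChart e Ω) (e.target ∩ e.symm ⁻¹' S)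

/-- The exterior derivative `dΩ`, computed at `p` in the preferred chart at `p` (for forms that are
smooth near `p`, any other chart gives the same result). -/
def extD (Ω : DForm d M k) : DForm d M (k + 1) := fun p =>
  (extDeriv (inChart (chartAt (Euc d) p) Ω) (chartAt (Euc d) p p)).compContinuousLinearMap
    (mfderiv (𝓡 d) (𝓡 d) (chartAt (Euc d) p) p)

/-- The manifold carries a smooth nowhere vanishing form of top degree. -/
def Orientable (d : ℕ) (M : Type*) [TopologicalSpace M] [ChartedSpace (Euc d) M] : Prop :=
  ∃ μ : DForm d M d, SmoothFormOn μ Set.univ ∧ ∀ p, μ p ≠ 0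

/-- A bilinear form `B` is nondegenerate on the subspace `ξ`. -/
def NondegOn {V : Type*} [Zero V] (ξ : Set V) (B : V → V → ℝ) : Prop :=
  ∀ v ∈ ξ, (∀ w ∈ ξ, B v w = 0) → v = 0

/-- `Ω` is a symplectic form on (a neighbourhood in `M` of the points of) the set `W`:
it is smooth on an open neighbourhood of `W`, and closed and nondegenerate at every point of `W`.
For `W` open this is a symplectic form on the open submanifold `W`. For `W` a domain with smooth
boundary this is a symplectic form on the manifold with boundary `W`, smoothness up to the boundary
being the existence of a smooth extension across the boundary. -/
structure IsSymplecticOn (Ω : DForm d M 2) (W : Set M) : Prop where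
  smooth : ∃ V : Set M, IsOpen V ∧ W ⊆ V ∧ SmoothFormOn Ω V
  closed : ∀ p ∈ W, extD Ω p = 0
  nondeg : ∀ p ∈ W, NondegOn Set.univ (fun v w => Ω p ![v, w])

/-- `f` is a defining function, near the boundary point `p`, of the domain `W`. -/
def IsLocalDefFun (W : Set M) (p : M) (f : M → ℝ) : Prop :=
  ∃ V : Set M, IsOpen V ∧ p ∈ V ∧ ContMDiffOn (𝓡 d) 𝓘(ℝ, ℝ) ∞ f V ∧ f p = 0 ∧
    mfderiv (𝓡 d) 𝓘(ℝ, ℝ) f p ≠ 0 ∧ ∀ q ∈ V, q ∈ W ↔ 0 ≤ f q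

/-- `W` is a closed domain (codimension `0`) with smooth boundary `frontier W`. -/
def IsSmoothDomain (W : Set M) : Prop :=
  IsClosed W ∧ ∀ p ∈ frontier W, ∃ f : M → ℝ, IsLocalDefFun (d := d) W p f

/-- The tangent vector `ν` at the boundary point `p` of the domain `W` points out of `W`. -/
def PointsOutward (W : Set M) (p : M) (ν : TangentSpace (𝓡 d) p) : Prop :=
  ∃ f : M → ℝ, IsLocalDefFun (d := d) W p f ∧ LT.lt (α := ℝ) (mfderiv (𝓡 d) 𝓘(ℝ, ℝ) f p ν) 0

end Forms

/-- The value of the top power `B^(n+1)` of a 2-form on `2n+2` vectors, up to a positive factor. -/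
def symplVol (n : ℕ) {V : Type*} (B : V → V → ℝ) (v : Fin (2 * n + 2) → V) : ℝ :=
  ∑ σ : Equiv.Perm (Fin (2 * n + 2)), ((Equiv.Perm.sign σ : ℤ) : ℝ) *
    ∏ i : Fin (n + 1), B (v (σ ⟨2 * i, by omega⟩)) (v (σ ⟨2 * i + 1, by omega⟩))

/-- The value of `a ∧ B^n`, for a 1-form `a` and a 2-form `B`, on `2n+1` vectors, up to a positive
factor. -/
def contactVol (n : ℕ) {V : Type*} (a : V → ℝ) (B : V → V → ℝ) (v : Fin (2 * n + 1) → V) : ℝ :=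
  ∑ σ : Equiv.Perm (Fin (2 * n + 1)), ((Equiv.Perm.sign σ : ℤ) : ℝ) *
    (a (v (σ 0)) *
      ∏ i : Fin n, B (v (σ ⟨2 * i + 1, by omega⟩)) (v (σ ⟨2 * i + 2, by omega⟩)))

section Main

variable {n : ℕ}
  {Z : Type*} [TopologicalSpace Z] [ChartedSpace (Euc (2 * n + 1)) Z]
  {X : Type*} [TopologicalSpace X] [ChartedSpace (Euc (2 * n + 2)) X]

/-- The volume form `α ∧ (dα)^n` at `z`, up to a positive factor. -/
def contactVolAt (α : DForm (2 * n + 1) Z 1) (z : Z)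
    (v : Fin (2 * n + 1) → TangentSpace (𝓡 (2 * n + 1)) z) : ℝ :=
  contactVol n (fun a => α z ![a]) (fun a b => extD α z ![a, b]) v

/-- `α` is a contact form on the `(2n+1)`-dimensional manifold `Z`: `α ∧ (dα)^n` vanishes nowhere. -/
structure IsContactForm (α : DForm (2 * n + 1) Z 1) : Prop where
  smooth : SmoothFormOn α Set.univ
  contact : ∀ z, ∃ v, contactVolAt α z v ≠ 0

/-- `e = (x, y₁, …, y_{2n+1})` is a smooth chart of `X` adapted to the hypersurface `S`, i.e.
`S = {x = 0}` on the domain of `e`. -/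
def IsAdaptedChart (S : Set X) (e : OpenPartialHomeomorph X (Euc (2 * n + 2))) : Prop :=
  e ∈ IsManifold.maximalAtlas (𝓡 (2 * n + 2)) ∞ X ∧ ∀ q ∈ e.source, q ∈ S ↔ e q 0 = 0

/-- The value at the point `u = (x, y)` of the section `v₀ · x²∂_x + ∑ᵢ vᵢ · x∂_{yᵢ}` of the
scattering tangent bundle. -/
def scFrame (u v : Euc (2 * n + 2)) : Euc (2 * n + 2) :=
  WithLp.toLp 2 fun i => if i = 0 then u 0 ^ 2 * v 0 else u 0 * v i

/-- In the adapted chart `e`, the 2-form `Ω` (given off the hypersurface `x = 0`) is a smooth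
nondegenerate section of `Λ²` of the scattering cotangent bundle: its coefficients with respect to
the frame `x²∂_x, x∂_{y₁}, …, x∂_{y_{2n+1}}` extend smoothly to `x = 0`, where they form the
nondegenerate skew form `a`. -/
structure IsScRepr (Ω : DForm (2 * n + 2) X 2) (e : OpenPartialHomeomorph X (Euc (2 * n + 2)))
    (a : Euc (2 * n + 2) → Euc (2 * n + 2) [⋀^Fin 2]→L[ℝ] ℝ) : Prop where
  smooth : ContDiffOn ℝ ∞ a e.target
  eq_frame : ∀ u ∈ e.target, u 0 ≠ 0 → ∀ v w,
    inChart e Ω u ![scFrame u v, scFrame u w] = a u ![v, w]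
  nondeg : ∀ u ∈ e.target, NondegOn Set.univ (fun v w => a u ![v, w])

/-- `(X, S, Ω)` is a scattering symplectic manifold: `Ω` is a closed nondegenerate section of `Λ²` of
the scattering cotangent bundle of `(X, S)`. The section is recorded by its restriction to
`X ∖ S`, an ordinary symplectic form; the values of `Ω` on `S` play no role. -/
structure IsScatteringSymplectic (S : Set X) (Ω : DForm (2 * n + 2) X 2) : Prop where
  symplectic : IsSymplecticOn Ω Sᶜ
  scattering : ∀ p ∈ S, ∃ e, p ∈ e.source ∧ IsAdaptedChart S e ∧ ∃ a, IsScRepr Ω e a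

/-- Writing `Ω = α₀ ∧ dx/x³ + β/x²` near the singular locus `ι(Z)`, the restriction of `α₀` to `ι(Z)`
(which is well defined up to a positive factor, and is read off from the coefficients of `Ω` on the
pairs `x∂_{yᵢ}, x²∂_x` at `x = 0`) pulls back under `ι` to a positive multiple of `α`. That is, `ι` is
a coorientation preserving contactomorphism from `(Z, ker α)` onto the singular locus of `Ω` with its
induced contact structure. -/
def InducesContact (ι : Z → X) (Ω : DForm (2 * n + 2) X 2) (α : DForm (2 * n + 1) Z 1) : Prop :=
  ∀ z, ∃ e a, ι z ∈ e.source ∧ IsAdaptedChart (Set.range ι) e ∧ IsScRepr Ω e a ∧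
    ∃ c : ℝ, 0 < c ∧ ∀ v : TangentSpace (𝓡 (2 * n + 1)) z,
      a (e (ι z)) ![(mfderiv (𝓡 (2 * n + 1)) (𝓡 (2 * n + 2)) (fun z' => e (ι z')) z v :
        Euc (2 * n + 2)), EuclideanSpace.single 0 1] = c * α z ![v]

/-- `(X, ι(Z), Ω)` is a scattering filling of the cooriented contact manifold `(Z, ker α)`. -/
structure IsScatteringFilling (ι : Z → X) (Ω : DForm (2 * n + 2) X 2)
    (α : DForm (2 * n + 1) Z 1) : Prop where
  embedding : Manifold.IsSmoothEmbedding (𝓡 (2 * n + 1)) (𝓡 (2 * n + 2)) ∞ ι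
  isClosed_range : IsClosed (Set.range ι)
  scattering : IsScatteringSymplectic (Set.range ι) Ω
  induces : InducesContact ι Ω α

variable (n) in
/-- `τ : ℝ × Z → X` is a tubular neighbourhood embedding for the hypersurface `ι : Z → X` (the
coorientable normal bundle being identified with `ℝ × Z`): a diffeomorphism onto an open set that
restricts to `ι` on `{0} × Z`. -/
structure IsTubularMap (ι : Z → X) (τ : ℝ × Z → X) : Prop where
  injective : Function.Injective τ
  isLocalDiffeomorph :
    IsLocalDiffeomorph (𝓘(ℝ, ℝ).prod (𝓡 (2 * n + 1))) (𝓡 (2 * n + 2)) ∞ τ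
  zero_section : ∀ z, τ (0, z) = ι z

/-- The compact domain with smooth boundary `W`, with the symplectic form `Ω` and the
identification `φ : Z → ∂W` of its boundary, is a weak symplectic filling of `(Z, ξ = ker α)`:
`W` is connected, the boundary orientation of `∂W` (outward normal first) agrees under `φ` with the
contact orientation, `Ω|_ξ` is symplectic, and `Ω|_ξ + η` is symplectic for all
`η = f · dα|_ξ`, `f > 0`, in the conformal symplectic structure of `ξ`. -/
structure IsWeakFilling (W : Set X) (Ω : DForm (2 * n + 2) X 2) (φ : Z → X)
    (α : DForm (2 * n + 1) Z 1) : Prop where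
  isCompact : IsCompact W
  isConnected : IsConnected W
  isSmoothDomain : IsSmoothDomain (d := 2 * n + 2) W
  symplectic : IsSymplecticOn Ω W
  embedding : Manifold.IsSmoothEmbedding (𝓡 (2 * n + 1)) (𝓡 (2 * n + 2)) ∞ φ
  range_eq : Set.range φ = frontier W
  orientation : ∀ (z : Z) (ν : TangentSpace (𝓡 (2 * n + 2)) (φ z))
    (v : Fin (2 * n + 1) → TangentSpace (𝓡 (2 * n + 1)) z),
    PointsOutward W (φ z) ν → 0 < contactVolAt α z v →
      0 < symplVol n (fun a b => Ω (φ z) ![a, b])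
        (Fin.cons ν fun i => mfderiv (𝓡 (2 * n + 1)) (𝓡 (2 * n + 2)) φ z (v i))
  symplectic_on_contact : ∀ z : Z, NondegOn {v | α z ![v] = 0} fun v w =>
    Ω (φ z) ![mfderiv (𝓡 (2 * n + 1)) (𝓡 (2 * n + 2)) φ z v,
      mfderiv (𝓡 (2 * n + 1)) (𝓡 (2 * n + 2)) φ z w]
  weak : ∀ f : Z → ℝ, ContMDiff (𝓡 (2 * n + 1)) 𝓘(ℝ, ℝ) ∞ f → (∀ z, 0 < f z) →
    ∀ z : Z, NondegOn {v | α z ![v] = 0} fun v w =>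
      Ω (φ z) ![mfderiv (𝓡 (2 * n + 1)) (𝓡 (2 * n + 2)) φ z v,
        mfderiv (𝓡 (2 * n + 1)) (𝓡 (2 * n + 2)) φ z w] + f z * extD α z ![v, w]

end Main

end ScatteringFilling

end

/-!
# Scattering fillings give weak fillings

Let `Ω` be a scattering symplectic form on `X`, singular along the hypersurface `ι(Z)`, and write it
near the hypersurface as `α₀ ∧ dx/x³ + β/x²`. The `dx`-component of `dΩ = 0` reads
`dα₀ = 2β - x ∂ₓβ`, hence `dα₀ = 2β` along `x = 0` (`fderiv_sub_fderiv_of_closed`). In terms of a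
collar `τ` with coordinate `t` this gives, as `t → 0`: the 1-forms `t³ Ω(·, ∂_t)` on `{t} × Z` tend to
a positive multiple of the contact form `α`, and the 2-forms `t² Ω` on `{t} × Z`, restricted to
`ker α`, tend to a positive multiple of `dα` (`collarLimit_form_eq`). Since a convex combination of
`dα` with a positive multiple of itself is nondegenerate on `ker α`, all slices `{t} × Z` with `t ≠ 0`
small satisfy the two nondegeneracy conditions on the boundary of a weak filling. They also satisfy
the orientation condition, for the side of the slice that does not contain the hypersurface: the sign
of `Ω^(n+1)` on `∂_t` followed by a positive frame of `Z` is opposite to the sign of `t`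
(`eventually_isWeakSlice`).

The same sign shows that the orientation `Ω^(n+1)` changes across the hypersurface
(`exists_agreeSet_flip`). As `X` is orientable, no component of the complement of the hypersurface can
lie on both of its sides (`not_both_sides`). Therefore the domain `W` contains one end of the collar
and no point of the other (`isCollarDomain_connectedComponentIn`); it contains at least one end
because otherwise it would be open and closed in `X`, hence meet the hypersurface
(`exists_collar_mem`). Exchanging the two sides of the collar (`IsTubularMap.reverse`), that end may
be taken to be the positive one.

The boundary slice `{ε} × Z` of `W` need not be close to the hypersurface. So `Ω` is pulled back by a
self-map of `X` that moves the collar in the `t`-direction only, takes the slice `{ε} × Z` to a slice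
`{δ} × Z` with `δ > 0` small, and restricts to a diffeomorphism of `W` onto the larger domain bounded
by that slice (`pushFun`, `pushMap`). The pulled back form is symplectic on `W`, and on its boundary
it has the properties of the slice `{δ} × Z` (`IsCollarDomain.isWeakFilling`).
-/

open scoped Manifold ContDiff Topology

noncomputable section

namespace ScatteringFilling

/-! ### Top powers of bilinear forms -/

section LinearAlgebra

variable {V : Type*} [AddCommGroup V] [Module ℝ V]

theorem sum_perm_eq_sum_fixing_zero {m : ℕ} (F : Equiv.Perm (Fin (m + 1)) → ℝ) :
    ∑ σ, (if σ 0 = 0 then F σ else 0) =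
      ∑ e : Equiv.Perm (Fin m), F (Equiv.Perm.decomposeFin.symm (0, e)) := by
  rw [← Equiv.Perm.decomposeFin.symm.sum_comp, Fintype.sum_prod_type, Fin.sum_univ_succ]
  simp [Fin.succ_ne_zero]

/-- On a vector `f` followed by vectors in the kernel of `a`, only the summands that feed `f` to `a`
survive in `a ∧ Bⁿ⁺¹`. -/
theorem contactVol_cons (n : ℕ) (a : V →ₗ[ℝ] ℝ) (B : V → V → ℝ) (f : V)
    (w : Fin (2 * n + 2) → V) (hw : ∀ i, a (w i) = 0) :
    contactVol (n + 1) a B (Fin.cons f w : Fin (2 * n + 2 + 1) → V) = a f * symplVol n B w := by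
  have key : ∀ σ : Equiv.Perm (Fin (2 * n + 2 + 1)),
      (((Equiv.Perm.sign σ : ℤ) : ℝ) * (a ((Fin.cons f w : Fin (2 * n + 2 + 1) → V) (σ 0)) *
      ∏ i : Fin (n + 1), B ((Fin.cons f w : Fin (2 * n + 2 + 1) → V) (σ ⟨2 * i + 1, by omega⟩))
        ((Fin.cons f w : Fin (2 * n + 2 + 1) → V) (σ ⟨2 * i + 2, by omega⟩)))) =
      if σ 0 = 0 then (((Equiv.Perm.sign σ : ℤ) : ℝ) *
        (a ((Fin.cons f w : Fin (2 * n + 2 + 1) → V) (σ 0)) *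
      ∏ i : Fin (n + 1), B ((Fin.cons f w : Fin (2 * n + 2 + 1) → V) (σ ⟨2 * i + 1, by omega⟩))
        ((Fin.cons f w : Fin (2 * n + 2 + 1) → V) (σ ⟨2 * i + 2, by omega⟩)))) else 0 := by
    intro σ
    split_ifs with h
    · rfl
    · obtain ⟨k, hk⟩ := Fin.exists_succ_eq.2 h
      rw [← hk, Fin.cons_succ, hw]
      simp
  have h1 : contactVol (n + 1) a B (Fin.cons f w : Fin (2 * n + 2 + 1) → V) = _ :=
    (Finset.sum_congr rfl fun σ _ => key σ).trans (sum_perm_eq_sum_fixing_zero _)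
  rw [h1, symplVol, Finset.mul_sum]
  refine Finset.sum_congr rfl fun e _ => ?_
  have hs : ∀ (j : ℕ) (hj : j < 2 * n + 2), Equiv.Perm.decomposeFin.symm (0, e)
      ⟨j + 1, by omega⟩ = (e ⟨j, hj⟩).succ := by
    intro j hj
    have := Equiv.Perm.decomposeFin_symm_apply_succ e 0 ⟨j, hj⟩
    simpa using this
  rw [Equiv.Perm.decomposeFin_symm_apply_zero, Equiv.Perm.decomposeFin.symm_sign]
  have : ∀ i : Fin (n + 1), B ((Fin.cons f w : Fin (2 * n + 2 + 1) → V)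
      (Equiv.Perm.decomposeFin.symm (0, e) ⟨2 * i + 1, by omega⟩))
        ((Fin.cons f w : Fin (2 * n + 2 + 1) → V)
        (Equiv.Perm.decomposeFin.symm (0, e) ⟨2 * i + 2, by omega⟩)) =
      B (w (e ⟨2 * i, by omega⟩)) (w (e ⟨2 * i + 1, by omega⟩)) := by
    intro i
    rw [hs (2 * i) (by omega), hs (2 * i + 1) (by omega), Fin.cons_succ, Fin.cons_succ]
  rw [Finset.prod_congr rfl fun i _ => this i]
  simp
  ring

omit [AddCommGroup V] [Module ℝ V] in
theorem contactVol_zero (a : V → ℝ) (B : V → V → ℝ) (v : Fin 1 → V) :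
    contactVol 0 a B v = a (v 0) := by
  have : Subsingleton (Equiv.Perm (Fin (2 * 0 + 1))) :=
    inferInstanceAs (Subsingleton (Equiv.Perm (Fin 1)))
  rw [contactVol, Fintype.sum_subsingleton _ 1]
  simp

/-- The summand of `symplVol`. -/
def symplTerm (n : ℕ) (B : V → V → ℝ) (u : Fin (2 * n + 2) → V)
    (σ : Equiv.Perm (Fin (2 * n + 2))) : ℝ :=
  ((Equiv.Perm.sign σ : ℤ) : ℝ) *
    ∏ i : Fin (n + 1), B (u (σ ⟨2 * i, by omega⟩)) (u (σ ⟨2 * i + 1, by omega⟩))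

omit [AddCommGroup V] [Module ℝ V] in
/-- Exchanging the two arguments of the first factor does not change the summand: the signs of the
permutation and of the factor cancel. -/
theorem symplTerm_mul_swap (n : ℕ) {B : V → V → ℝ} (hB : ∀ v w, B v w = -B w v)
    (u : Fin (2 * n + 2) → V) (σ : Equiv.Perm (Fin (2 * n + 2))) :
    symplTerm n B u (σ * Equiv.swap ⟨0, by omega⟩ ⟨1, by omega⟩) = symplTerm n B u σ := by
  unfold symplTerm
  rw [Fin.prod_univ_succ, Fin.prod_univ_succ]
  have h0 : ∀ i : Fin n, ∀ h, Equiv.swap (⟨0, by omega⟩ : Fin (2 * n + 2)) ⟨1, by omega⟩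
      ⟨2 * (i + 1), h⟩ = ⟨2 * (i + 1), h⟩ := fun i h =>
    Equiv.swap_apply_of_ne_of_ne (by rw [ne_eq, Fin.mk.injEq]; omega)
      (by rw [ne_eq, Fin.mk.injEq]; omega)
  have h1 : ∀ i : Fin n, ∀ h, Equiv.swap (⟨0, by omega⟩ : Fin (2 * n + 2)) ⟨1, by omega⟩
      ⟨2 * (i + 1) + 1, h⟩ = ⟨2 * (i + 1) + 1, h⟩ := fun i h =>
    Equiv.swap_apply_of_ne_of_ne (by rw [ne_eq, Fin.mk.injEq]; omega)
      (by rw [ne_eq, Fin.mk.injEq]; omega)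
  simp only [Equiv.Perm.mul_apply, Fin.val_succ, Fin.val_zero, mul_zero, zero_add, h0, h1]
  rw [Equiv.swap_apply_left, Equiv.swap_apply_right, hB (u (σ ⟨1, _⟩)) (u (σ ⟨0, _⟩)),
    Equiv.Perm.sign_mul, Equiv.Perm.sign_swap (by rw [ne_eq, Fin.mk.injEq]; omega)]
  push_cast
  ring

omit [AddCommGroup V] [Module ℝ V] in
/-- Exchanging the first factor with the `i`-th one does not change the summand, the permutation of
the arguments being even. -/
theorem symplTerm_mul_block_swap (n : ℕ) (B : V → V → ℝ) (u : Fin (2 * n + 2) → V)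
    (σ : Equiv.Perm (Fin (2 * n + 2))) (i : Fin (n + 1)) (hi : (i : ℕ) ≠ 0) :
    symplTerm n B u (σ * (Equiv.swap ⟨0, by omega⟩ ⟨2 * i, by omega⟩ *
      Equiv.swap ⟨1, by omega⟩ ⟨2 * i + 1, by omega⟩)) = symplTerm n B u σ := by
  unfold symplTerm
  have hs : ∀ k : Fin (n + 1), (Equiv.swap (⟨0, by omega⟩ : Fin (2 * n + 2)) ⟨2 * i, by omega⟩ *
      Equiv.swap ⟨1, by omega⟩ ⟨2 * i + 1, by omega⟩ : Equiv.Perm _) ⟨2 * k, by omega⟩ =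
        ⟨2 * (Equiv.swap 0 i k), by omega⟩ := by
    intro k
    rw [Equiv.Perm.mul_apply, Equiv.swap_apply_of_ne_of_ne (a := (⟨1, _⟩ : Fin (2 * n + 2)))
      (by rw [ne_eq, Fin.mk.injEq]; omega) (by rw [ne_eq, Fin.mk.injEq]; omega)]
    simp only [Equiv.swap_apply_def, Fin.ext_iff]
    split_ifs <;> simp_all
  have hs' : ∀ k : Fin (n + 1), (Equiv.swap (⟨0, by omega⟩ : Fin (2 * n + 2)) ⟨2 * i, by omega⟩ *
      Equiv.swap ⟨1, by omega⟩ ⟨2 * i + 1, by omega⟩ : Equiv.Perm _) ⟨2 * k + 1, by omega⟩ =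
        ⟨2 * (Equiv.swap 0 i k) + 1, by omega⟩ := by
    intro k
    have h1 : Equiv.swap (⟨1, by omega⟩ : Fin (2 * n + 2)) ⟨2 * i + 1, by omega⟩
        ⟨2 * k + 1, by omega⟩ = ⟨2 * (Equiv.swap 0 i k) + 1, by omega⟩ := by
      simp only [Equiv.swap_apply_def, Fin.ext_iff]
      split_ifs <;> simp_all
    rw [Equiv.Perm.mul_apply, h1, Equiv.swap_apply_of_ne_of_ne
      (by rw [ne_eq, Fin.mk.injEq]; omega) (by rw [ne_eq, Fin.mk.injEq]; omega)]
  simp only [Equiv.Perm.mul_apply σ, hs, hs']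
  rw [Equiv.prod_comp (Equiv.swap 0 i) (fun k : Fin (n + 1) => B (u (σ ⟨2 * k, by omega⟩))
    (u (σ ⟨2 * k + 1, by omega⟩))), Equiv.Perm.sign_mul, Equiv.Perm.sign_mul,
    Equiv.Perm.sign_swap (by rw [ne_eq, Fin.mk.injEq]; omega),
    Equiv.Perm.sign_swap (by rw [ne_eq, Fin.mk.injEq]; omega)]
  simp

omit [AddCommGroup V] [Module ℝ V] in
/-- Expansion of the top power of a 2-form with respect to its first argument: by antisymmetry
each of the `2n+2` positions of that argument contributes the same amount. -/
theorem symplVol_cons (n : ℕ) {B : V → V → ℝ} (hB : ∀ v w, B v w = -B w v)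
    (ν : V) (v : Fin (2 * n + 1) → V) :
    symplVol n B (Fin.cons ν v : Fin (2 * n + 2) → V) = (2 * n + 2) * contactVol n (B ν) B v := by
  set u : Fin (2 * n + 2) → V := Fin.cons ν v with hu
  -- symmetries of the summands that move a given position `j` to position `0`
  have inv : ∀ j : Fin (2 * n + 2), ∃ π : Equiv.Perm (Fin (2 * n + 2)), π 0 = j ∧
      ∀ σ, symplTerm n B u (σ * π) = symplTerm n B u σ := by
    have even : ∀ i : Fin (n + 1), ∃ π : Equiv.Perm (Fin (2 * n + 2)),
        π ⟨0, by omega⟩ = ⟨2 * i, by omega⟩ ∧ π ⟨1, by omega⟩ = ⟨2 * i + 1, by omega⟩ ∧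
        ∀ σ, symplTerm n B u (σ * π) = symplTerm n B u σ := by
      intro i
      by_cases hi : (i : ℕ) = 0
      · refine ⟨1, ?_, ?_, fun σ => by rw [mul_one]⟩ <;> simp [hi]
      · refine ⟨_, ?_, ?_, fun σ => symplTerm_mul_block_swap n B u σ i hi⟩
        · rw [Equiv.Perm.mul_apply, Equiv.swap_apply_of_ne_of_ne (a := (⟨1, _⟩ : Fin (2 * n + 2)))
            (by rw [ne_eq, Fin.mk.injEq]; omega) (by rw [ne_eq, Fin.mk.injEq]; omega),
            Equiv.swap_apply_left]
        · rw [Equiv.Perm.mul_apply, Equiv.swap_apply_left, Equiv.swap_apply_of_ne_of_ne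
            (by rw [ne_eq, Fin.mk.injEq]; omega) (by rw [ne_eq, Fin.mk.injEq]; omega)]
    intro j
    obtain ⟨π, h0, h1, hπ⟩ := even ⟨j / 2, by omega⟩
    rcases Nat.mod_two_eq_zero_or_one j with hj | hj
    · refine ⟨π, h0.trans ?_, hπ⟩
      rw [Fin.ext_iff]
      dsimp only
      omega
    · refine ⟨π * Equiv.swap ⟨0, by omega⟩ ⟨1, by omega⟩, ?_, fun σ => ?_⟩
      · rw [Equiv.Perm.mul_apply]
        refine (congrArg π (Equiv.swap_apply_left _ _)).trans (h1.trans ?_)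
        rw [Fin.ext_iff]
        dsimp only
        omega
      · rw [← mul_assoc, symplTerm_mul_swap n hB, hπ]
  have h1 : symplVol n B u = ∑ σ, symplTerm n B u σ := rfl
  -- sort the permutations by the position of the argument `ν`
  have h2 : ∀ σ, symplTerm n B u σ =
      ∑ j : Fin (2 * n + 2), if σ j = 0 then symplTerm n B u σ else 0 := by
    intro σ
    rw [Finset.sum_eq_single (σ⁻¹ 0)]
    · simp
    · intro j _ hj
      rw [if_neg]
      rintro h
      exact hj (by rw [← h]; simp)
    · simp
  have h3 : ∀ j : Fin (2 * n + 2), ∑ σ, (if σ j = 0 then symplTerm n B u σ else 0) =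
      ∑ σ, if σ 0 = 0 then symplTerm n B u σ else 0 := by
    intro j
    obtain ⟨π, hπ, hF⟩ := inv j
    rw [← Equiv.sum_comp (Equiv.mulRight π) (fun σ : Equiv.Perm (Fin (2 * n + 2)) =>
      if σ 0 = 0 then symplTerm n B u σ else 0)]
    refine Finset.sum_congr rfl fun σ _ => ?_
    simp [hπ, hF]
  have h4 : ∑ σ, (if σ 0 = 0 then symplTerm n B u σ else 0) = contactVol n (B ν) B v := by
    rw [sum_perm_eq_sum_fixing_zero (m := 2 * n + 1)]
    refine Finset.sum_congr rfl fun e _ => ?_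
    have hs : ∀ (j : ℕ) (hj : j < 2 * n + 1), Equiv.Perm.decomposeFin.symm (0, e)
        ⟨j + 1, by omega⟩ = (e ⟨j, hj⟩).succ := by
      intro j hj
      have := Equiv.Perm.decomposeFin_symm_apply_succ e 0 ⟨j, hj⟩
      simpa using this
    unfold symplTerm
    rw [Equiv.Perm.decomposeFin.symm_sign, Fin.prod_univ_succ]
    have e0 : (⟨2 * (0 : Fin (n + 1)), by simp⟩ : Fin (2 * n + 2)) = 0 := rfl
    have : ∀ i : Fin n, B (u (Equiv.Perm.decomposeFin.symm (0, e) ⟨2 * i.succ, by omega⟩))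
          (u (Equiv.Perm.decomposeFin.symm (0, e) ⟨2 * i.succ + 1, by omega⟩)) =
        B (v (e ⟨2 * i + 1, by omega⟩)) (v (e ⟨2 * i + 2, by omega⟩)) := by
      intro i
      have a1 := hs (2 * i + 1) (by omega)
      have a2 := hs (2 * i + 2) (by omega)
      have b1 : (⟨2 * i.succ, by omega⟩ : Fin (2 * n + 2)) = ⟨2 * i + 1 + 1, by omega⟩ := by
        simp [Fin.ext_iff]; ring
      have b2 : (⟨2 * i.succ + 1, by omega⟩ : Fin (2 * n + 2)) = ⟨2 * i + 2 + 1, by omega⟩ := by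
        simp [Fin.ext_iff]; ring
      rw [b1, b2, a1, a2, hu, Fin.cons_succ, Fin.cons_succ]
    rw [Finset.prod_congr rfl fun i _ => this i, e0, Equiv.Perm.decomposeFin_symm_apply_zero]
    have c := hs 0 (by omega)
    simp only [Fin.val_zero, mul_zero] at c ⊢
    rw [c, hu, Fin.cons_succ, Fin.cons_zero]
    simp
  rw [h1, Finset.sum_congr rfl fun σ _ => h2 σ, Finset.sum_comm, Finset.sum_congr rfl fun j _ => h3 j,
    h4]
  simp

/-- The product in `symplVol` is linear in each argument, as each argument occurs in one factor. -/
theorem exists_linear_prod_update (n : ℕ) (B : V →ₗ[ℝ] V →ₗ[ℝ] ℝ)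
    [DecidableEq (Fin (2 * n + 2))] (v : Fin (2 * n + 2) → V) (j : Fin (2 * n + 2)) :
    ∃ L : V →ₗ[ℝ] ℝ, ∀ x, ∏ i : Fin (n + 1), B (Function.update v j x ⟨2 * i, by omega⟩)
      (Function.update v j x ⟨2 * i + 1, by omega⟩) = L x := by
  obtain ⟨k, hk⟩ : ∃ k : Fin (n + 1), (k : ℕ) = j / 2 := ⟨⟨j / 2, by omega⟩, rfl⟩
  set R := ∏ i ∈ {k}ᶜ, B (v ⟨2 * i, by omega⟩) (v ⟨2 * i + 1, by omega⟩) with hR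
  have hprod : ∀ x, ∏ i : Fin (n + 1), B (Function.update v j x ⟨2 * i, by omega⟩)
      (Function.update v j x ⟨2 * i + 1, by omega⟩) =
      B (Function.update v j x ⟨2 * k, by omega⟩) (Function.update v j x ⟨2 * k + 1, by omega⟩)
        * R := by
    intro x
    rw [Fintype.prod_eq_mul_prod_compl k]
    congr 1
    refine Finset.prod_congr rfl fun i hi => ?_
    have hi' : (i : ℕ) ≠ k := by
      simpa [Fin.ext_iff] using hi
    rw [Function.update_of_ne, Function.update_of_ne] <;> rw [ne_eq, Fin.ext_iff] <;>
      dsimp only <;> omega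
  simp only [hprod]
  rcases Nat.mod_two_eq_zero_or_one j with hj | hj
  · refine ⟨R • B.flip (v ⟨2 * k + 1, by omega⟩), fun x => ?_⟩
    have hjk : (⟨2 * k, by omega⟩ : Fin (2 * n + 2)) = j := by
      rw [Fin.ext_iff]
      dsimp only
      omega
    rw [hjk, Function.update_self, Function.update_of_ne (by rw [ne_eq, Fin.ext_iff]; dsimp only; omega)]
    exact mul_comm _ _
  · refine ⟨R • B (v ⟨2 * k, by omega⟩), fun x => ?_⟩
    have hjk : (⟨2 * k + 1, by omega⟩ : Fin (2 * n + 2)) = j := by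
      rw [Fin.ext_iff]
      dsimp only
      omega
    rw [hjk, Function.update_self, Function.update_of_ne (by rw [ne_eq, Fin.ext_iff]; dsimp only; omega)]
    exact mul_comm _ _

/-- `symplVol` of a bilinear form as an alternating map. -/
def symplVolAlt (n : ℕ) (B : V →ₗ[ℝ] V →ₗ[ℝ] ℝ) : V [⋀^Fin (2 * n + 2)]→ₗ[ℝ] ℝ :=
  MultilinearMap.alternatization
    { toFun := fun v => ∏ i : Fin (n + 1), B (v ⟨2 * i, by omega⟩) (v ⟨2 * i + 1, by omega⟩)
      map_update_add' := fun v j x y => by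
        obtain ⟨L, hL⟩ := exists_linear_prod_update n B v j
        simp only [hL, map_add]
      map_update_smul' := fun v j c x => by
        obtain ⟨L, hL⟩ := exists_linear_prod_update n B v j
        simp only [hL, map_smul] }

theorem symplVolAlt_apply (n : ℕ) (B : V →ₗ[ℝ] V →ₗ[ℝ] ℝ) (v : Fin (2 * n + 2) → V) :
    symplVolAlt n B v = symplVol n (fun a b => B a b) v := by
  rw [symplVolAlt, MultilinearMap.alternatization_apply]
  refine Finset.sum_congr rfl fun σ _ => ?_
  rw [Units.smul_def, zsmul_eq_mul]
  rfl

/-- The bilinear form `B + ds ∧ a` on `V × ℝ`, where `s` is the coordinate of `ℝ`. -/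
def suspend (a : V →ₗ[ℝ] ℝ) (B : V →ₗ[ℝ] V →ₗ[ℝ] ℝ) : V × ℝ →ₗ[ℝ] V × ℝ →ₗ[ℝ] ℝ :=
  LinearMap.mk₂ ℝ (fun p q => B p.1 q.1 + p.2 * a q.1 - q.2 * a p.1)
    (fun p p' q => by simp; ring) (fun c p q => by simp; ring)
    (fun p q q' => by simp; ring) (fun c p q => by simp; ring)

/-- `contactVol` of a linear and a skew bilinear form as an alternating map: up to a factor, it is
the contraction of the top power of the suspended form with `∂_s`. -/
def contactVolAlt (n : ℕ) (a : V →ₗ[ℝ] ℝ) (B : V →ₗ[ℝ] V →ₗ[ℝ] ℝ) :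
    V [⋀^Fin (2 * n + 1)]→ₗ[ℝ] ℝ :=
  ((2 * n + 2 : ℝ)⁻¹) •
    ((symplVolAlt n (suspend a B)).curryLeft (0, 1)).compLinearMap (LinearMap.inl ℝ V ℝ)

theorem contactVolAlt_apply (n : ℕ) (a : V →ₗ[ℝ] ℝ) (B : V →ₗ[ℝ] V →ₗ[ℝ] ℝ)
    (hB : ∀ v w, B v w = -B w v) (v : Fin (2 * n + 1) → V) :
    contactVolAlt n a B v = contactVol n a (fun a b => B a b) v := by
  have h1 : contactVolAlt n a B v = ((2 * n + 2 : ℝ)⁻¹) * symplVolAlt n (suspend a B)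
    (Fin.cons (0, 1) fun i => (v i, 0) : Fin (2 * n + 2) → V × ℝ) := rfl
  rw [h1, symplVolAlt_apply, symplVol_cons n (B := fun a' b => suspend a B a' b)
    (fun p q => by simp [suspend, hB p.1 q.1]; ring), inv_mul_cancel_left₀ (by positivity)]
  simp [contactVol, suspend]

section TopForms

variable [FiniteDimensional ℝ V]

/-- Top degree forms on an oriented space agree in sign on all bases if they do on one. -/
theorem mul_pos_of_mul_pos_of_top {m : ℕ} (hV : Module.finrank ℝ V = m)
    (T₁ T₂ : V [⋀^Fin m]→ₗ[ℝ] ℝ) {b u : Fin m → V} (hb : 0 < T₁ b * T₂ b) (hu : T₂ u ≠ 0) :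
    0 < T₁ u * T₂ u := by
  have hli : LinearIndependent ℝ b := by
    by_contra h
    rw [T₁.map_linearDependent b h] at hb
    simp at hb
  have hE : Nonempty (Module.Basis (Fin m) ℝ V) := ⟨Module.finBasisOfFinrankEq ℝ V hV⟩
  set e := basisOfLinearIndependentOfCardEqFinrank' b hli (by simp [hV]) with he
  have heb : (e : Fin m → V) = b := by simp [he]
  have h1 := congrArg (fun T => T u) (T₁.eq_smul_basis_det e)
  have h2 := congrArg (fun T => T u) (T₂.eq_smul_basis_det e)
  simp only [AlternatingMap.smul_apply, smul_eq_mul, heb] at h1 h2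
  have hd : e.det u ≠ 0 := fun h => hu (by rw [h2, h, mul_zero])
  rw [h1, h2]
  have : T₁ b * e.det u * (T₂ b * e.det u) = T₁ b * T₂ b * (e.det u) ^ 2 := by ring
  rw [this]
  positivity

omit [FiniteDimensional ℝ V] in
/-- The contraction of a nonzero top degree form with a nonzero vector is nonzero. -/
theorem exists_top_cons_ne_zero {m : ℕ} (hV : Module.finrank ℝ V = m + 1)
    (T : V [⋀^Fin (m + 1)]→ₗ[ℝ] ℝ) (hT : T ≠ 0) {ν : V} (hν : ν ≠ 0) :
    ∃ v : Fin m → V, T (Fin.cons ν v : Fin (m + 1) → V) ≠ 0 := by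
  obtain ⟨b, hb⟩ : ∃ b, T b ≠ 0 := by
    by_contra! h
    exact hT (AlternatingMap.ext h)
  have hli : LinearIndependent ℝ b := by
    by_contra h
    exact hb (T.map_linearDependent b h)
  set e := basisOfLinearIndependentOfCardEqFinrank hli (by simp [hV]) with he
  have heb : (e : Fin (m + 1) → V) = b := by simp [he]
  obtain ⟨j, hj⟩ : ∃ j, e.repr ν j ≠ 0 := by
    by_contra! h
    exact hν (e.repr.map_eq_zero_iff.1 (Finsupp.ext h))
  have hup : T (Function.update b j ν) ≠ 0 := by
    have hsum : ν = ∑ i, e.repr ν i • b i := by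
      rw [← heb]
      exact (e.sum_repr ν).symm
    have : T (Function.update b j ν) = e.repr ν j * T b := by
      conv_lhs => rw [hsum]
      rw [T.map_update_sum, Finset.sum_eq_single j]
      · rw [T.map_update_smul, Function.update_eq_self, smul_eq_mul]
      · intro i _ hij
        rw [T.map_update_smul, T.map_update_self b hij.symm, smul_zero]
      · simp
    rw [this]
    exact mul_ne_zero hj hb
  set c := Function.update b j ν ∘ Equiv.swap 0 j with hc
  have hc0 : c 0 = ν := by simp [hc]
  refine ⟨Fin.tail c, ?_⟩
  rw [← hc0, Fin.cons_self_tail, hc, T.map_perm]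
  rcases Int.units_eq_one_or (Equiv.Perm.sign (Equiv.swap 0 j)) with h | h <;> rw [h] <;>
    simpa using hup

omit [FiniteDimensional ℝ V] in
/-- A 2-form whose kernel contains a nonzero vector `ν` has vanishing top power: by `symplVol_cons`,
the contraction of the top power with `ν` is zero. -/
theorem symplVol_eq_zero_of_degenerate (n : ℕ) (hV : Module.finrank ℝ V = 2 * n + 2)
    (B : V →ₗ[ℝ] V →ₗ[ℝ] ℝ) (hB : ∀ v w, B v w = -B w v) {ν : V} (hν : ν ≠ 0)
    (h : ∀ w, B ν w = 0) (v : Fin (2 * n + 2) → V) : symplVol n (fun a b => B a b) v = 0 := by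
  by_contra hv
  rw [← symplVolAlt_apply] at hv
  obtain ⟨w, hw⟩ := exists_top_cons_ne_zero (m := 2 * n + 1) hV (symplVolAlt n B)
    (fun h0 => hv (by rw [h0]; rfl)) hν
  refine hw ?_
  rw [symplVolAlt_apply, symplVol_cons n (B := fun a b => B a b) hB]
  simp [contactVol, h]

/-- A nondegenerate 2-form has nonvanishing top power. By induction on the dimension: split off a
plane on which the form is nondegenerate. -/
theorem exists_symplVol_ne_zero (n : ℕ) : ∀ {V : Type _} [AddCommGroup V] [Module ℝ V]
    [FiniteDimensional ℝ V], Module.finrank ℝ V = 2 * n + 2 → ∀ (B : V →ₗ[ℝ] V →ₗ[ℝ] ℝ),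
    (∀ v w, B v w = -B w v) → (∀ v, (∀ w, B v w = 0) → v = 0) →
    ∃ v : Fin (2 * n + 2) → V, symplVol n (fun a b => B a b) v ≠ 0 := by
  induction n with
  | zero =>
    intro V _ _ _ hV B hB hnd
    have : Nontrivial V := Module.nontrivial_of_finrank_pos (R := ℝ) (by omega)
    obtain ⟨ν, hν⟩ := exists_ne (0 : V)
    obtain ⟨f, hf⟩ : ∃ f, B ν f ≠ 0 := by
      by_contra! h
      exact hν (hnd ν h)
    refine ⟨Fin.cons ν (fun _ => f), ?_⟩
    rw [symplVol_cons 0 (B := fun a b => B a b) hB, contactVol_zero]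
    simpa using hf
  | succ k ih =>
    intro V _ _ _ hV B hB hnd
    have : Nontrivial V := Module.nontrivial_of_finrank_pos (R := ℝ) (by omega)
    obtain ⟨ν, hν⟩ := exists_ne (0 : V)
    obtain ⟨f, hf⟩ : ∃ f, B ν f ≠ 0 := by
      by_contra! h
      exact hν (hnd ν h)
    have hself : ∀ v, B v v = 0 := fun v => by linarith [hB v v]
    -- the complement of the plane spanned by `ν` and `f` is its annihilator
    set W : Submodule ℝ V := LinearMap.ker ((B ν).prod (B f)) with hW
    have hmem : ∀ w, w ∈ W ↔ B ν w = 0 ∧ B f w = 0 := fun w => by simp [hW]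
    have hfν : B f ν ≠ 0 := by rw [hB]; simpa using hf
    have hsurj : LinearMap.range ((B ν).prod (B f)) = ⊤ := by
      rw [LinearMap.range_eq_top]
      rintro ⟨s, t⟩
      refine ⟨(s / B ν f) • f + (t / B f ν) • ν, ?_⟩
      simp [hself, hf, hfν]
    have hdim : Module.finrank ℝ W = 2 * k + 2 := by
      have := LinearMap.finrank_range_add_finrank_ker ((B ν).prod (B f))
      rw [hsurj, finrank_top, Module.finrank_prod, Module.finrank_self, hV] at this
      change 1 + 1 + Module.finrank ℝ W = _ at this
      omega
    obtain ⟨w, hw⟩ := ih hdim (B.domRestrict₁₂ W W) (fun v w => hB v w) (by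
      intro v hv
      refine Subtype.ext (hnd v fun u => ?_)
      set u' := u - ((B ν u / B ν f) • f + (B f u / B f ν) • ν) with hu'
      have hmu : u' ∈ W := by
        rw [hmem]
        constructor <;> simp [hu', hself, hf, hfν]
      have h0 : B v u' = 0 := hv ⟨u', hmu⟩
      have hv2 := (hmem v).1 v.2
      have e1 : B v f = 0 := by rw [hB, hv2.2, neg_zero]
      have e2 : B v ν = 0 := by rw [hB, hv2.1, neg_zero]
      simpa [hu', e1, e2] using h0)
    refine ⟨Fin.cons ν (Fin.cons f fun i => w i), ?_⟩
    rw [symplVol_cons (k + 1) (B := fun a b => B a b) hB]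
    have h2 := contactVol_cons k (B ν) (fun a b => B a b) f (fun i => w i)
      (fun i => ((hmem _).1 (w i).2).1)
    have h3 : symplVol k (fun a b => B a b) (fun i => (w i : V)) ≠ 0 := hw
    have h4 : contactVol (k + 1) (B ν) (fun a b => B a b)
        (Fin.cons f fun i => w i : Fin (2 * k + 2 + 1) → V) ≠ 0 := by
      rw [h2]
      exact mul_ne_zero hf h3
    exact mul_ne_zero (by positivity) h4

theorem finrank_ker_of_ne_zero {m : ℕ} (hV : Module.finrank ℝ V = m + 1) (a : V →ₗ[ℝ] ℝ)
    (ha : a ≠ 0) : Module.finrank ℝ (LinearMap.ker a) = m := by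
  have h := LinearMap.finrank_range_add_finrank_ker a
  rw [LinearMap.range_eq_top.2 (LinearMap.surjective ha), finrank_top, Module.finrank_self, hV] at h
  omega

omit [FiniteDimensional ℝ V] in
theorem contactVol_zero_left (n : ℕ) (B : V → V → ℝ) (v : Fin (2 * n + 1) → V) :
    contactVol n (0 : V →ₗ[ℝ] ℝ) B v = 0 := by
  simp [contactVol]

/-- A basis adapted to a hyperplane: one vector on which the linear form is `1`, then a basis of
its kernel. -/
theorem exists_basis_cons_ker {m : ℕ} (hV : Module.finrank ℝ V = m + 1) (a : V →ₗ[ℝ] ℝ)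
    (ha : a ≠ 0) : ∃ (f : V) (w : Fin m → LinearMap.ker a) (e : Module.Basis (Fin (m + 1)) ℝ V),
      a f = 1 ∧ (e : Fin (m + 1) → V) = Fin.cons f fun i => (w i : V) := by
  obtain ⟨f, hf⟩ := LinearMap.surjective ha 1
  have b := Module.finBasisOfFinrankEq ℝ (LinearMap.ker a) (finrank_ker_of_ne_zero hV a ha)
  refine ⟨f, b, Module.Basis.mkFinCons f b ?_ ?_, hf, ?_⟩
  · intro c x hx hcx
    have := congrArg a hcx
    rw [map_add, map_smul, hf, LinearMap.mem_ker.1 hx] at this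
    simpa using this
  · intro z
    refine ⟨-a z, ?_⟩
    simp [hf]
  · rw [Module.Basis.coe_mkFinCons]
    rfl

/-- The contact condition: if `a ∧ Bⁿ ≠ 0` then `B` is nondegenerate on the kernel of `a`. -/
theorem nondegOn_ker_of_contactVol_ne_zero (n : ℕ) (hV : Module.finrank ℝ V = 2 * n + 1)
    (a : V →ₗ[ℝ] ℝ) (B : V →ₗ[ℝ] V →ₗ[ℝ] ℝ) (hB : ∀ v w, B v w = -B w v)
    {v : Fin (2 * n + 1) → V} (hv : contactVol n a (fun a b => B a b) v ≠ 0) :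
    NondegOn {v | a v = 0} fun v w => B v w := by
  intro ν hν h
  by_contra hne
  have ha : a ≠ 0 := by
    rintro rfl
    exact hv (contactVol_zero_left n _ v)
  have hker := finrank_ker_of_ne_zero hV a ha
  obtain ⟨f, w, e, hf, he⟩ := exists_basis_cons_ker hV a ha
  rw [← contactVolAlt_apply n a B hB] at hv
  refine hv ?_
  rw [(contactVolAlt n a B).eq_smul_basis_det e, he, contactVolAlt_apply n a B hB]
  have h0 : contactVol n a (fun a b => B a b) (Fin.cons f fun i => (w i : V)) = 0 := by
    cases n with
    | zero =>
      have : Subsingleton (LinearMap.ker a) := Module.finrank_zero_iff.1 hker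
      exact (hne (congrArg Subtype.val (Subsingleton.elim (⟨ν, hν⟩ : LinearMap.ker a) 0))).elim
    | succ k =>
      have h1 := contactVol_cons k a (fun a b => B a b) f (fun i => (w i : V)) (fun i => (w i).2)
      have h2 := symplVol_eq_zero_of_degenerate k hker
        (B.domRestrict₁₂ (LinearMap.ker a) (LinearMap.ker a)) (fun v w => hB v w)
        (ν := ⟨ν, hν⟩) (fun h => hne (congrArg Subtype.val h)) (fun u => h u u.2) w
      exact h1.trans (by rw [show symplVol k (fun a b => B a b) (fun i => (w i : V)) = 0 from h2,
        mul_zero])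
  rw [h0, zero_smul]
  rfl

/-- `a ∧ Bⁿ` depends only on the restriction of `B` to the kernel of `a`. -/
theorem contactVol_eq_of_ker (n : ℕ) (hV : Module.finrank ℝ V = 2 * n + 1)
    (a : V →ₗ[ℝ] ℝ) (B₁ B₂ : V →ₗ[ℝ] V →ₗ[ℝ] ℝ) (hB₁ : ∀ v w, B₁ v w = -B₁ w v)
    (hB₂ : ∀ v w, B₂ v w = -B₂ w v) (k : ℝ)
    (h : ∀ v w, a v = 0 → a w = 0 → B₂ v w = k * B₁ v w) (v : Fin (2 * n + 1) → V) :
    contactVol n a (fun a b => B₂ a b) v = k ^ n * contactVol n a (fun a b => B₁ a b) v := by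
  by_cases ha : a = 0
  · rw [ha, contactVol_zero_left, contactVol_zero_left, mul_zero]
  obtain ⟨f, w, e, hf, he⟩ := exists_basis_cons_ker hV a ha
  rw [← contactVolAlt_apply n a B₁ hB₁, ← contactVolAlt_apply n a B₂ hB₂,
    (contactVolAlt n a B₁).eq_smul_basis_det e, (contactVolAlt n a B₂).eq_smul_basis_det e, he,
    contactVolAlt_apply n a B₁ hB₁, contactVolAlt_apply n a B₂ hB₂]
  have h0 : contactVol n a (fun a b => B₂ a b) (Fin.cons f fun i => (w i : V)) =
      k ^ n * contactVol n a (fun a b => B₁ a b) (Fin.cons f fun i => (w i : V)) := by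
    cases n with
    | zero => simp [contactVol_zero]
    | succ m =>
      have h1 := contactVol_cons m a (fun a b => B₁ a b) f (fun i => (w i : V)) (fun i => (w i).2)
      have h2 := contactVol_cons m a (fun a b => B₂ a b) f (fun i => (w i : V)) (fun i => (w i).2)
      refine h2.trans (Eq.trans ?_ (congrArg (fun t => k ^ (m + 1) * t) h1.symm))
      have h3 : symplVol m (fun a b => B₂ a b) (fun i => (w i : V)) =
          k ^ (m + 1) * symplVol m (fun a b => B₁ a b) (fun i => (w i : V)) := by
        rw [symplVol, symplVol, Finset.mul_sum]
        refine Finset.sum_congr rfl fun σ _ => ?_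
        rw [Finset.prod_congr rfl fun i _ => h _ _ (w _).2 (w _).2, Finset.prod_mul_distrib]
        simp
        ring
      simp only [h3]
      ring
  rw [h0]
  simp [mul_assoc]

end TopForms

end LinearAlgebra

/-! ### Pullbacks of differential forms -/

section PullbackSmooth

variable {F G : Type*} [NormedAddCommGroup F] [NormedSpace ℝ F] [NormedAddCommGroup G]
  [NormedSpace ℝ G]

/-- The continuous linear retraction of multilinear onto alternating forms. -/
def alternatize (F : Type*) [NormedAddCommGroup F] [NormedSpace ℝ F] (k : ℕ) :
    ContinuousMultilinearMap ℝ (fun _ : Fin k => F) ℝ →L[ℝ] F [⋀^Fin k]→L[ℝ] ℝ :=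
  LinearMap.mkContinuous
    { toFun := fun f => ((k.factorial : ℝ)⁻¹) • ContinuousMultilinearMap.alternatization f
      map_add' := fun f g => by rw [map_add, smul_add]
      map_smul' := fun c f => by
        ext v
        simp only [ContinuousAlternatingMap.smul_apply,
          ContinuousMultilinearMap.alternatization_apply_apply, smul_apply,
          RingHom.id_apply, Finset.mul_sum, smul_eq_mul, Units.smul_def, zsmul_eq_mul]
        refine Finset.sum_congr rfl fun σ _ => by ring }
    1 (fun f => by
      refine ContinuousAlternatingMap.opNorm_le_bound _ (by positivity) fun v => ?_
      have h : ‖ContinuousMultilinearMap.alternatization f v‖ ≤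
          ∑ σ : Equiv.Perm (Fin k), ‖f‖ * ∏ i, ‖v i‖ := by
        rw [ContinuousMultilinearMap.alternatization_apply_apply]
        refine norm_sum_le_of_le _ fun σ _ => ?_
        have h1 : ‖Equiv.Perm.sign σ • f (v ∘ σ)‖ = ‖f (v ∘ σ)‖ := by
          rcases Int.units_eq_one_or (Equiv.Perm.sign σ) with h | h <;> simp [h]
        rw [h1]
        refine (f.le_opNorm _).trans (le_of_eq ?_)
        rw [← Equiv.prod_comp σ (fun i => ‖v i‖)]
        rfl
      have hk : (0 : ℝ) < k.factorial := by positivity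
      rw [LinearMap.coe_mk, AddHom.coe_mk, ContinuousAlternatingMap.smul_apply, norm_smul,
        norm_inv, Real.norm_of_nonneg hk.le, inv_mul_le_iff₀ hk]
      refine h.trans (le_of_eq ?_)
      rw [Finset.sum_const, Finset.card_univ, Fintype.card_perm, Fintype.card_fin, nsmul_eq_mul]
      ring)

theorem alternatize_coe {k : ℕ} (w : F [⋀^Fin k]→L[ℝ] ℝ) :
    alternatize F k w.toContinuousMultilinearMap = w := by
  ext v
  have hk : (k.factorial : ℝ) ≠ 0 := by positivity
  change ((k.factorial : ℝ)⁻¹) • ContinuousMultilinearMap.alternatization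
    w.toContinuousMultilinearMap v = w v
  rw [ContinuousMultilinearMap.alternatization_apply_apply]
  have : ∀ σ : Equiv.Perm (Fin k), Equiv.Perm.sign σ • w.toContinuousMultilinearMap (v ∘ σ) =
      w v := by
    intro σ
    have h := w.toAlternatingMap.map_perm v σ
    change Equiv.Perm.sign σ • w.toAlternatingMap (v ∘ σ) = w v
    rw [h, smul_smul, Int.units_mul_self, one_smul]
    rfl
  simp only [this, Finset.sum_const, Finset.card_univ, Fintype.card_perm, Fintype.card_fin]
  rw [nsmul_eq_mul, smul_eq_mul, inv_mul_cancel_left₀ hk]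

/-- The pullback of an alternating form by a linear map depends smoothly on both. -/
theorem contDiff_compContinuousLinearMap (k : ℕ) {n : WithTop ℕ∞} :
    ContDiff ℝ n (fun p : (G [⋀^Fin k]→L[ℝ] ℝ) × (F →L[ℝ] G) =>
      p.1.compContinuousLinearMap p.2) := by
  have h : (fun p : (G [⋀^Fin k]→L[ℝ] ℝ) × (F →L[ℝ] G) => p.1.compContinuousLinearMap p.2) =
      fun p => alternatize F k
        ((ContinuousMultilinearMap.compContinuousLinearMapContinuousMultilinear ℝ
          (fun _ : Fin k => F) (fun _ : Fin k => G) ℝ (fun _ => p.2))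
          (ContinuousAlternatingMap.toContinuousMultilinearMapCLM ℝ p.1)) := by
    funext p
    exact (alternatize_coe _).symm
  rw [h]
  refine (alternatize F k).contDiff.comp ?_
  refine ContDiff.clm_apply ?_ ?_
  · exact (ContinuousMultilinearMap.contDiff _).comp (contDiff_pi.2 fun _ => contDiff_snd)
  · exact (ContinuousLinearMap.contDiff _).comp contDiff_fst

end PullbackSmooth

section Pullback

variable {d k : ℕ} {M : Type*} [TopologicalSpace M] [ChartedSpace (Euc d) M]
  {E : Type*} [NormedAddCommGroup E] [NormedSpace ℝ E]

/-- The pullback of a form on a manifold by a map from a normed space. -/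
def pullForm (f : E → M) (Ω : DForm d M k) (q : E) : E [⋀^Fin k]→L[ℝ] ℝ :=
  (Ω (f q)).compContinuousLinearMap (mfderiv 𝓘(ℝ, E) (𝓡 d) f q)

theorem inChart_eq_pullForm (e : OpenPartialHomeomorph M (Euc d)) (Ω : DForm d M k) :
    inChart e Ω = pullForm e.symm Ω := rfl

variable [IsManifold (𝓡 d) ∞ M]

omit [IsManifold (𝓡 d) ∞ M] in
theorem mdifferentiable_of_mem_maximalAtlas {e : OpenPartialHomeomorph M (Euc d)}
    (he : e ∈ IsManifold.maximalAtlas (𝓡 d) ∞ M) : e.MDifferentiable (𝓡 d) (𝓡 d) :=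
  ⟨(contMDiffOn_of_mem_maximalAtlas he).mdifferentiableOn (by simp),
    (contMDiffOn_symm_of_mem_maximalAtlas he).mdifferentiableOn (by simp)⟩

omit [IsManifold (𝓡 d) ∞ M] in
theorem pullForm_eq_inChart {e : OpenPartialHomeomorph M (Euc d)}
    (he : e ∈ IsManifold.maximalAtlas (𝓡 d) ∞ M) {f : E → M} {q : E} (hq : f q ∈ e.source)
    (hf : MDifferentiableAt 𝓘(ℝ, E) (𝓡 d) f q) (Ω : DForm d M k) :
    pullForm f Ω q =
      (inChart e Ω (e (f q))).compContinuousLinearMap (fderiv ℝ (fun q => e (f q)) q) := by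
  have hd := mdifferentiable_of_mem_maximalAtlas he
  have h1 : mfderiv 𝓘(ℝ, E) (𝓡 d) (fun q => e (f q)) q =
      (mfderiv (𝓡 d) (𝓡 d) e (f q)).comp (mfderiv 𝓘(ℝ, E) (𝓡 d) f q) :=
    mfderiv_comp q (hd.mdifferentiableAt hq) hf
  have h2 := hd.symm_comp_deriv hq
  have h3 : fderiv ℝ (fun q => e (f q)) q =
      (mfderiv (𝓡 d) (𝓡 d) e (f q)).comp (mfderiv 𝓘(ℝ, E) (𝓡 d) f q) := by
    rw [← mfderiv_eq_fderiv]
    exact h1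
  rw [h3]
  ext v
  change Ω (f q) (fun i => mfderiv 𝓘(ℝ, E) (𝓡 d) f q (v i)) =
    Ω (e.symm (e (f q))) (fun i => mfderiv (𝓡 d) (𝓡 d) e.symm (e (f q))
      (mfderiv (𝓡 d) (𝓡 d) e (f q) (mfderiv 𝓘(ℝ, E) (𝓡 d) f q (v i))))
  have h4 : ∀ w : TangentSpace (𝓡 d) (f q), mfderiv (𝓡 d) (𝓡 d) e.symm (e (f q))
      (mfderiv (𝓡 d) (𝓡 d) e (f q) w) = w := fun w => congrArg (fun L => L w) h2
  have h5 : ∀ p, p = f q → Ω (f q) (fun i => mfderiv 𝓘(ℝ, E) (𝓡 d) f q (v i)) =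
      Ω p (fun i => (mfderiv 𝓘(ℝ, E) (𝓡 d) f q (v i) : Euc d)) := by
    rintro p rfl
    rfl
  rw [h5 _ (e.left_inv hq)]
  congr 1
  funext i
  exact (h4 _).symm

omit [IsManifold (𝓡 d) ∞ M] in
theorem contDiffAt_chart_comp {e : OpenPartialHomeomorph M (Euc d)}
    (he : e ∈ IsManifold.maximalAtlas (𝓡 d) ∞ M) {f : E → M} {q : E} (hq : f q ∈ e.source)
    (hf : ContMDiffAt 𝓘(ℝ, E) (𝓡 d) ∞ f q) : ContDiffAt ℝ ∞ (fun q => e (f q)) q :=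
  contMDiffAt_iff_contDiffAt.1 ((contMDiffAt_of_mem_maximalAtlas he hq).comp q hf)

theorem eventually_pullForm_eq_inChart {e : OpenPartialHomeomorph M (Euc d)}
    (he : e ∈ IsManifold.maximalAtlas (𝓡 d) ∞ M) {f : E → M} {q : E} (hq : f q ∈ e.source)
    (hf : ContMDiffAt 𝓘(ℝ, E) (𝓡 d) ∞ f q) (Ω : DForm d M k) :
    pullForm f Ω =ᶠ[𝓝 q] fun q => (inChart e Ω (e (f q))).compContinuousLinearMap
      (fderiv ℝ (fun q => e (f q)) q) := by
  have h1 : ∀ᶠ q' in 𝓝 q, ContMDiffAt 𝓘(ℝ, E) (𝓡 d) 1 f q' :=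
    (contMDiffAt_iff_contMDiffAt_nhds (by simp)).1 (hf.of_le (by simp))
  filter_upwards [h1, hf.continuousAt.eventually (e.open_source.mem_nhds hq)] with q' h h'
  exact pullForm_eq_inChart he h' (h.mdifferentiableAt (by simp)) Ω

omit [IsManifold (𝓡 d) ∞ M] in
theorem contDiffAt_fderiv_chart_comp {e : OpenPartialHomeomorph M (Euc d)}
    (he : e ∈ IsManifold.maximalAtlas (𝓡 d) ∞ M) {f : E → M} {q : E} (hq : f q ∈ e.source)
    (hf : ContMDiffAt 𝓘(ℝ, E) (𝓡 d) ∞ f q) :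
    ContDiffAt ℝ ∞ (fderiv ℝ (fun q => e (f q))) q :=
  (contDiffAt_chart_comp he hq hf).fderiv_right (by simp)

omit [IsManifold (𝓡 d) ∞ M] in
/-- A form which is smooth near a point has smooth coordinate expressions there. -/
theorem contDiffAt_inChart {Ω : DForm d M k} {S : Set M} (hΩ : SmoothFormOn Ω S) {p : M}
    (hS : S ∈ 𝓝 p) : ContDiffAt ℝ ∞ (inChart (chartAt (Euc d) p) Ω) (chartAt (Euc d) p p) := by
  refine (hΩ _ (chart_mem_atlas _ p)).contDiffAt ?_
  refine Filter.inter_mem ((chartAt (Euc d) p).open_target.mem_nhds (mem_chart_target _ p)) ?_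
  refine (chartAt (Euc d) p).continuousAt_symm (mem_chart_target _ p) ?_
  rwa [(chartAt (Euc d) p).left_inv (mem_chart_source _ p)]

theorem contDiffAt_pullForm {Ω : DForm d M k} {S : Set M} (hΩ : SmoothFormOn Ω S) {f : E → M}
    {q : E} (hS : S ∈ 𝓝 (f q)) (hf : ContMDiffAt 𝓘(ℝ, E) (𝓡 d) ∞ f q) :
    ContDiffAt ℝ ∞ (pullForm f Ω) q := by
  have he := IsManifold.chart_mem_maximalAtlas (I := 𝓡 d) (n := ∞) (f q)
  have hq := mem_chart_source (Euc d) (f q)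
  refine ContDiffAt.congr_of_eventuallyEq ?_ (eventually_pullForm_eq_inChart he hq hf Ω)
  have h1 : ContDiffAt ℝ ∞ (fun q' => inChart (chartAt (Euc d) (f q)) Ω
      (chartAt (Euc d) (f q) (f q'))) q :=
    ContDiffAt.comp q (g := inChart (chartAt (Euc d) (f q)) Ω) (contDiffAt_inChart hΩ hS)
      (contDiffAt_chart_comp he hq hf)
  exact ContDiffAt.comp q (contDiff_compContinuousLinearMap k).contDiffAt
    (h1.prodMk (contDiffAt_fderiv_chart_comp he hq hf))

/-- The exterior derivative commutes with pullback. -/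
theorem extDeriv_pullForm {Ω : DForm d M k} {S : Set M} (hΩ : SmoothFormOn Ω S) {f : E → M}
    {q : E} (hS : S ∈ 𝓝 (f q)) (hf : ContMDiffAt 𝓘(ℝ, E) (𝓡 d) ∞ f q) :
    extDeriv (pullForm f Ω) q = pullForm f (extD Ω) q := by
  have he := IsManifold.chart_mem_maximalAtlas (I := 𝓡 d) (n := ∞) (f q)
  have hq := mem_chart_source (Euc d) (f q)
  have hd := mdifferentiable_of_mem_maximalAtlas he
  have h1 : DifferentiableAt ℝ (inChart (chartAt (Euc d) (f q)) Ω)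
      ((fun q' => chartAt (Euc d) (f q) (f q')) q) :=
    (contDiffAt_inChart hΩ hS).differentiableAt (by simp)
  have h2 : ContDiffAt ℝ ∞ (fun q' => chartAt (Euc d) (f q) (f q')) q :=
    contDiffAt_chart_comp he hq hf
  rw [(eventually_pullForm_eq_inChart he hq hf Ω).extDeriv_eq,
    extDeriv_pullback (f := fun q' => chartAt (Euc d) (f q) (f q')) h1 h2
      (by rw [minSmoothness_of_isRCLikeNormedField]
          exact WithTop.coe_le_coe.2 (le_top : (2 : ℕ∞) ≤ ⊤))]
  have h3 : fderiv ℝ (fun q' => chartAt (Euc d) (f q) (f q')) q =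
      (mfderiv (𝓡 d) (𝓡 d) (chartAt (Euc d) (f q)) (f q)).comp (mfderiv 𝓘(ℝ, E) (𝓡 d) f q) := by
    rw [← mfderiv_eq_fderiv]
    exact mfderiv_comp q (hd.mdifferentiableAt hq) (hf.mdifferentiableAt (by simp))
  rw [h3]
  rfl

end Pullback

/-! ### Forms of low degree and the scattering frame -/

section Forms

variable {V : Type*} [AddCommGroup V] [Module ℝ V] [TopologicalSpace V]

omit [AddCommGroup V] [Module ℝ V] [TopologicalSpace V] in
theorem update_pair_zero (v w x : V) : Function.update ![v, w] 0 x = ![x, w] := by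
  funext i
  fin_cases i <;> rfl

omit [AddCommGroup V] [Module ℝ V] [TopologicalSpace V] in
theorem update_pair_one (v w x : V) : Function.update ![v, w] 1 x = ![v, x] := by
  funext i
  fin_cases i <;> rfl

omit [AddCommGroup V] [Module ℝ V] [TopologicalSpace V] in
theorem update_single (v x : V) : Function.update ![v] 0 x = ![x] := by
  funext i
  fin_cases i
  rfl

/-- A 2-form as a bilinear map. -/
def formBilin (B : V [⋀^Fin 2]→L[ℝ] ℝ) : V →ₗ[ℝ] V →ₗ[ℝ] ℝ :=
  LinearMap.mk₂ ℝ (fun v w => B ![v, w])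
    (fun v v' w => by
      have h := B.map_update_add ![v, w] 0 v v'
      rwa [update_pair_zero, update_pair_zero, update_pair_zero] at h)
    (fun c v w => by
      have h := B.map_update_smul ![v, w] 0 c v
      rwa [update_pair_zero, update_pair_zero] at h)
    (fun v w w' => by
      have h := B.map_update_add ![v, w] 1 w w'
      rwa [update_pair_one, update_pair_one, update_pair_one] at h)
    (fun c v w => by
      have h := B.map_update_smul ![v, w] 1 c w
      rwa [update_pair_one, update_pair_one] at h)

@[simp] theorem formBilin_apply (B : V [⋀^Fin 2]→L[ℝ] ℝ) (v w : V) :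
    formBilin B v w = B ![v, w] := rfl

theorem form_self (B : V [⋀^Fin 2]→L[ℝ] ℝ) (v : V) : B ![v, v] = 0 :=
  B.map_eq_zero_of_eq ![v, v] (i := 0) (j := 1) rfl (by simp)

theorem form_skew (B : V [⋀^Fin 2]→L[ℝ] ℝ) (v w : V) : B ![v, w] = -B ![w, v] := by
  have h : formBilin B (v + w) (v + w) = 0 := form_self B _
  simp only [map_add, LinearMap.add_apply, formBilin_apply, form_self] at h
  linarith

theorem form_smul_smul (B : V [⋀^Fin 2]→L[ℝ] ℝ) (c d : ℝ) (v w : V) :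
    B ![c • v, d • w] = c * d * B ![v, w] := by
  change formBilin B (c • v) (d • w) = c * d * formBilin B v w
  rw [LinearMap.map_smul₂, map_smul, smul_eq_mul, smul_eq_mul, mul_assoc]

/-- A 1-form as a linear map. -/
def formLin (a : V [⋀^Fin 1]→L[ℝ] ℝ) : V →ₗ[ℝ] ℝ where
  toFun v := a ![v]
  map_add' v w := by
    have h := a.map_update_add ![v] 0 v w
    rwa [update_single, update_single, update_single] at h
  map_smul' c v := by
    have h := a.map_update_smul ![v] 0 c v
    rwa [update_single, update_single] at h

end Forms

section Scattering

variable {n : ℕ}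

/-- The inverse of the scattering frame map: the coefficients of a tangent vector `p` at `u` with
respect to the scattering frame. Division by zero is irrelevant as `u 0 ≠ 0` where it is used. -/
def scLift (u p : Euc (2 * n + 2)) : Euc (2 * n + 2) :=
  WithLp.toLp 2 fun i => if i = 0 then p 0 / u 0 ^ 2 else p i / u 0

theorem scFrame_scLift {u : Euc (2 * n + 2)} (hu : u 0 ≠ 0) (p : Euc (2 * n + 2)) :
    scFrame u (scLift u p) = p := by
  ext i
  by_cases hi : i = 0
  · subst hi
    simp [scFrame, scLift]
    field_simp
  · simp [scFrame, scLift, hi]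
    field_simp

theorem scLift_of_apply_zero {u p : Euc (2 * n + 2)} (hp : p 0 = 0) :
    scLift u p = (u 0)⁻¹ • p := by
  ext i
  by_cases hi : i = 0
  · subst hi
    simp [scLift, hp]
  · simp [scLift, hi]
    ring

theorem scLift_single (u : Euc (2 * n + 2)) :
    scLift u (EuclideanSpace.single 0 1) = (u 0 ^ 2)⁻¹ • EuclideanSpace.single 0 1 := by
  ext i
  by_cases hi : i = 0
  · subst hi
    simp [scLift]
  · simp [scLift, hi]

/-- Closedness of a scattering 2-form, restricted to the hypersurface `x = 0`: writing the form as
`α ∧ dx/x³ + β/x²`, it says `dα = 2β` there. It is obtained from `dα = 2β - x ∂ₓβ` for `x ≠ 0`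
by continuity. -/
theorem fderiv_sub_fderiv_of_closed {T : Set (Euc (2 * n + 2))} (hT : IsOpen T)
    {w a : Euc (2 * n + 2) → Euc (2 * n + 2) [⋀^Fin 2]→L[ℝ] ℝ}
    (ha : ContDiffOn ℝ ∞ a T)
    (heq : ∀ u ∈ T, u 0 ≠ 0 → ∀ p q, w u ![scFrame u p, scFrame u q] = a u ![p, q])
    (hw : ∀ u ∈ T, u 0 ≠ 0 → DifferentiableAt ℝ w u)
    (hclosed : ∀ u ∈ T, u 0 ≠ 0 → extDeriv w u = 0)
    {u p q : Euc (2 * n + 2)} (hu : u ∈ T) (hu0 : u 0 = 0) (hp : p 0 = 0) (hq : q 0 = 0) :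
    fderiv ℝ (fun u => a u ![EuclideanSpace.single 0 1, q]) u p -
      fderiv ℝ (fun u => a u ![EuclideanSpace.single 0 1, p]) u q = -2 * a u ![p, q] := by
  set e₀ : Euc (2 * n + 2) := EuclideanSpace.single 0 1 with he₀
  have hsm : ∀ c : Fin 2 → Euc (2 * n + 2), ContDiffOn ℝ ∞ (fun u => a u c) T := by
    intro c
    exact (ContinuousAlternatingMap.apply ℝ (Euc (2 * n + 2)) ℝ c).contDiff.comp_contDiffOn ha
  have hev : ∀ u ∈ T, u 0 ≠ 0 → ∀ᶠ u' in 𝓝 u, u' ∈ T ∧ u' 0 ≠ 0 := by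
    intro u hu hu0
    have hc : ContinuousAt (fun u' : Euc (2 * n + 2) => u' 0) u := by fun_prop
    exact Filter.Eventually.and (hT.mem_nhds hu) (hc.eventually_ne hu0)
  have hval : ∀ u ∈ T, u 0 ≠ 0 → ∀ p q, w u ![p, q] = a u ![scLift u p, scLift u q] := by
    intro u hu hu0 p q
    rw [← heq u hu hu0, scFrame_scLift hu0, scFrame_scLift hu0]
  -- for `x ≠ 0` this is the closedness of the form, multiplied by `x³`
  have hoff : ∀ u ∈ T, u 0 ≠ 0 → u 0 * fderiv ℝ (fun u => a u ![p, q]) u e₀ -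
      2 * a u ![p, q] - fderiv ℝ (fun u => a u ![e₀, q]) u p +
      fderiv ℝ (fun u => a u ![e₀, p]) u q = 0 := by
    intro u hu hu0
    have h : extDeriv w u ![e₀, p, q] = 0 := by rw [hclosed u hu hu0]; rfl
    rw [extDeriv_apply (hw u hu hu0), Fin.sum_univ_three] at h
    have e1 : (fun u => w u ((0 : Fin 3).removeNth ![e₀, p, q])) =ᶠ[𝓝 u]
        fun u => (u 0 ^ 2)⁻¹ * a u ![p, q] := by
      filter_upwards [hev u hu hu0] with u' hu'
      have : (0 : Fin 3).removeNth ![e₀, p, q] = ![p, q] := by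
        ext i; fin_cases i <;> rfl
      rw [this, hval u' hu'.1 hu'.2, scLift_of_apply_zero hp, scLift_of_apply_zero hq,
        form_smul_smul]
      ring
    have e2 : ∀ r : Euc (2 * n + 2), r 0 = 0 → (fun u => w u ![e₀, r]) =ᶠ[𝓝 u]
        fun u => (u 0 ^ 3)⁻¹ * a u ![e₀, r] := by
      intro r hr
      filter_upwards [hev u hu hu0] with u' hu'
      rw [hval u' hu'.1 hu'.2, scLift_of_apply_zero hr, scLift_single, form_smul_smul]
      ring
    have r1 : (1 : Fin 3).removeNth ![e₀, p, q] = ![e₀, q] := by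
      ext i; fin_cases i <;> rfl
    have r2 : (2 : Fin 3).removeNth ![e₀, p, q] = ![e₀, p] := by
      ext i; fin_cases i <;> rfl
    have hd : ∀ c, DifferentiableAt ℝ (fun u => a u c) u := fun c =>
      ((hsm c).contDiffAt (hT.mem_nhds hu)).differentiableAt (by simp)
    have hpow : ∀ k : ℕ, HasFDerivAt (fun u : Euc (2 * n + 2) => (u 0 ^ k)⁻¹)
        ((-(k * u 0 ^ (k - 1)) / (u 0 ^ k) ^ 2) •
          (EuclideanSpace.proj 0 : Euc (2 * n + 2) →L[ℝ] ℝ)) u := by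
      intro k
      exact HasDerivAt.comp_hasFDerivAt (h₂ := fun x : ℝ => (x ^ k)⁻¹)
        (f := fun u : Euc (2 * n + 2) => u 0) u
        ((hasDerivAt_pow k (u 0)).fun_inv (pow_ne_zero k hu0))
        (EuclideanSpace.proj (𝕜 := ℝ) (0 : Fin (2 * n + 2))).hasFDerivAt
    simp only [r1, r2, e1.fderiv_eq, (e2 p hp).fderiv_eq, (e2 q hq).fderiv_eq,
      fderiv_fun_mul (hpow _).differentiableAt (hd _), (hpow _).fderiv] at h
    simp [hp, hq, he₀] at h
    rw [he₀]
    field_simp at h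
    linear_combination h
  -- approach `u` along the normal direction
  set L : Euc (2 * n + 2) → ℝ := fun u => u 0 * fderiv ℝ (fun u => a u ![p, q]) u e₀ -
      2 * a u ![p, q] - fderiv ℝ (fun u => a u ![e₀, q]) u p +
      fderiv ℝ (fun u => a u ![e₀, p]) u q with hL
  have hLc : ContinuousAt L u := by
    have hc : ∀ c r, ContinuousAt (fun u => fderiv ℝ (fun u => a u c) u r) u := by
      intro c r
      have h1 : ContDiffAt ℝ 0 (fderiv ℝ (fun u => a u c)) u :=
        ((hsm c).contDiffAt (hT.mem_nhds hu)).fderiv_right (by simp)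
      exact h1.continuousAt.clm_apply continuousAt_const
    have hc' : ContinuousAt (fun u => a u ![p, q]) u :=
      ((hsm _).contDiffAt (hT.mem_nhds hu)).continuousAt
    have hc0 : ContinuousAt (fun u : Euc (2 * n + 2) => u 0) u := by fun_prop
    exact (((hc0.mul (hc _ _)).sub (continuousAt_const.mul hc')).sub (hc _ _)).add (hc _ _)
  have hlim : Filter.Tendsto (fun t : ℝ => u + t • e₀) (𝓝[≠] 0) (𝓝 u) := by
    have : ContinuousAt (fun t : ℝ => u + t • e₀) 0 := by fun_prop
    have h := this.tendsto
    rw [zero_smul, add_zero] at h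
    exact h.mono_left nhdsWithin_le_nhds
  have hL0 : L u = 0 := by
    refine tendsto_nhds_unique (hLc.tendsto.comp hlim) ?_
    refine (tendsto_const_nhds (x := (0 : ℝ))).congr' ?_
    have hne : ∀ᶠ t : ℝ in 𝓝[≠] 0, t ≠ 0 := eventually_mem_nhdsWithin
    filter_upwards [hlim.eventually (hT.mem_nhds hu), hne] with t ht ht0
    exact (hoff _ ht (by simpa [he₀, hu0] using ht0)).symm
  simp only [hL, hu0] at hL0
  linear_combination -hL0

end Scattering

/-! ### Limits of the scattering coefficients along a collar -/

section Limits

variable {E : Type*} [NormedAddCommGroup E] [NormedSpace ℝ E]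

/-- A `C¹` function vanishing on `{t = 0}` is asymptotic to `t` times its normal derivative,
uniformly near a point of `{t = 0}`. -/
theorem tendsto_div_of_eventually_zero {f : ℝ × E → ℝ} {y : E} (hf : ContDiffAt ℝ 1 f (0, y))
    (h0 : ∀ᶠ y' in 𝓝 y, f (0, y') = 0) :
    Filter.Tendsto (fun q : ℝ × E => f q / q.1) (𝓝[{q | q.1 ≠ 0}] (0, y))
      (𝓝 (fderiv ℝ f (0, y) (1, 0))) := by
  have hs := hasStrictFDerivAt_iff_isLittleO.1 (hf.hasStrictFDerivAt (by simp))
  set L := fderiv ℝ f (0, y) with hL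
  set l := 𝓝[{q : ℝ × E | q.1 ≠ 0}] ((0 : ℝ), y) with hl
  have hproj : Filter.Tendsto (fun q : ℝ × E => (q, ((0 : ℝ), q.2))) l (𝓝 ((0, y), (0, y))) := by
    have : Continuous (fun q : ℝ × E => (q, ((0 : ℝ), q.2))) := by fun_prop
    exact (this.tendsto (0, y)).mono_left nhdsWithin_le_nhds
  have h1 := hs.comp_tendsto hproj
  have h2 : ∀ᶠ q : ℝ × E in l, f (0, q.2) = 0 :=
    ((continuous_snd.tendsto ((0 : ℝ), y)).mono_left nhdsWithin_le_nhds).eventually h0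
  have h3 : ∀ᶠ q : ℝ × E in l, q.1 ≠ 0 := eventually_mem_nhdsWithin
  have h4 : (fun q : ℝ × E => f q - q.1 * L (1, 0)) =o[l] fun q : ℝ × E => q.1 := by
    have h5 : ((fun p : (ℝ × E) × ℝ × E => p.1 - p.2) ∘ fun q : ℝ × E => (q, ((0 : ℝ), q.2))) =O[l]
        fun q : ℝ × E => q.1 := by
      refine Asymptotics.IsBigO.of_bound 1 (Filter.Eventually.of_forall fun q => ?_)
      simp [Prod.norm_def]
    refine (h1.trans_isBigO h5).congr' ?_ Filter.EventuallyEq.rfl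
    filter_upwards [h2] with q hq
    have : q - (0, q.2) = q.1 • ((1 : ℝ), (0 : E)) := by ext <;> simp
    simp only [Function.comp_apply, hq, this, map_smul, smul_eq_mul]
    ring
  have h6 := h4.tendsto_div_nhds_zero
  have h7 := h6.add_const (L (1, 0))
  rw [zero_add] at h7
  refine h7.congr' ?_
  filter_upwards [h3] with q hq
  field_simp
  ring

end Limits

section ScLimits

variable {n : ℕ} {E : Type*} [NormedAddCommGroup E] [NormedSpace ℝ E]

theorem contDiffAt_fderiv_apply_coord {F : ℝ × E → Euc (2 * n + 2)} {q : ℝ × E}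
    (hF : ContDiffAt ℝ ∞ F q) (p : ℝ × E) (i : Fin (2 * n + 2)) :
    ContDiffAt ℝ ∞ (fun q => fderiv ℝ F q p i) q := by
  have h1 : ContDiffAt ℝ ∞ (fderiv ℝ F) q := hF.fderiv_right (by simp)
  exact (EuclideanSpace.proj (𝕜 := ℝ) i).contDiff.contDiffAt.comp q
    (h1.clm_apply contDiffAt_const)

theorem fderiv_coord {F : ℝ × E → Euc (2 * n + 2)} {q : ℝ × E} (hF : DifferentiableAt ℝ F q)
    (i : Fin (2 * n + 2)) (p : ℝ × E) : fderiv ℝ (fun q => F q i) q p = fderiv ℝ F q p i := by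
  have h := ((EuclideanSpace.proj (𝕜 := ℝ) i).hasFDerivAt (x := F q)).comp q hF.hasFDerivAt
  have h2 : fderiv ℝ (fun q => F q i) q = (EuclideanSpace.proj (𝕜 := ℝ) i).comp (fderiv ℝ F q) :=
    h.fderiv
  rw [h2]
  rfl

/-- The map `F : ℝ × E → ℝ^{2n+2}` is smooth near `(0, y)`, takes `{t = 0}` to the hypersurface
`{x = 0}`, and maps `∂_t` to a vector transverse to it. -/
structure IsCollarAt (F : ℝ × E → Euc (2 * n + 2)) (y : E) : Prop where
  contDiffAt : ContDiffAt ℝ ∞ F (0, y)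
  zero : ∀ᶠ y' in 𝓝 y, F (0, y') 0 = 0
  transverse : fderiv ℝ F (0, y) (1, 0) 0 ≠ 0

/-- The limit of `t` times the scattering coefficients of the image of the tangent vector `v` to
`{t = const}`. Its `x²∂_x` component need not vanish, as the slices need not be tangent to the level
sets of `x`. -/
def collarLimit (F : ℝ × E → Euc (2 * n + 2)) (y v : E) : Euc (2 * n + 2) :=
  (fderiv ℝ (fun q => fderiv ℝ F q (0, v) 0) (0, y) (1, 0) /
      (fderiv ℝ F (0, y) (1, 0) 0) ^ 2) • EuclideanSpace.single 0 1 +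
    (fderiv ℝ F (0, y) (1, 0) 0)⁻¹ • fderiv ℝ F (0, y) (0, v)

namespace IsCollarAt

variable {F : ℝ × E → Euc (2 * n + 2)} {y : E} (hF : IsCollarAt F y)
include hF

theorem tendsto_div : Filter.Tendsto (fun q : ℝ × E => F q 0 / q.1) (𝓝[{q | q.1 ≠ 0}] (0, y))
    (𝓝 (fderiv ℝ F (0, y) (1, 0) 0)) := by
  rw [← fderiv_coord (hF.contDiffAt.differentiableAt (by simp))]
  exact tendsto_div_of_eventually_zero
    ((EuclideanSpace.proj (𝕜 := ℝ) (0 : Fin (2 * n + 2))).contDiff.contDiffAt.comp _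
      (hF.contDiffAt.of_le (by simp))) hF.zero

theorem eventually_fderiv_zero (v : E) : ∀ᶠ y' in 𝓝 y, fderiv ℝ F (0, y') (0, v) 0 = 0 := by
  have h1 : ∀ᶠ q in 𝓝 ((0 : ℝ), y), ContDiffAt ℝ 1 F q :=
    (hF.contDiffAt.of_le (by simp)).eventually (by simp)
  have h2 : Filter.Tendsto (fun y' : E => ((0 : ℝ), y')) (𝓝 y) (𝓝 (0, y)) :=
    (by fun_prop : Continuous (fun y' : E => ((0 : ℝ), y'))).tendsto y
  filter_upwards [h2.eventually h1, hF.zero.eventually_nhds] with y' h3 h4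
  have hd : DifferentiableAt ℝ F (0, y') := h3.differentiableAt (by simp)
  have h5 : HasFDerivAt (fun y' : E => ((0 : ℝ), y')) (ContinuousLinearMap.inr ℝ ℝ E) y' :=
    hasFDerivAt_prodMk_right 0 y'
  have h6 := (((EuclideanSpace.proj (𝕜 := ℝ) (0 : Fin (2 * n + 2))).hasFDerivAt
    (x := F (0, y'))).comp _ hd.hasFDerivAt).comp y' h5
  have h7 : HasFDerivAt (fun y' : E => F (0, y') 0) (0 : E →L[ℝ] ℝ) y' :=
    (hasFDerivAt_const (0 : ℝ) y').congr_of_eventuallyEq h4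
  have h8 := congrArg (fun L => L v) (h6.unique h7)
  simpa using h8

theorem fderiv_zero (v : E) : fderiv ℝ F (0, y) (0, v) 0 = 0 :=
  (hF.eventually_fderiv_zero v).self_of_nhds

theorem collarLimit_eq (v : E) : collarLimit F y v = WithLp.toLp 2 fun i => if i = 0 then
    fderiv ℝ (fun q => fderiv ℝ F q (0, v) 0) (0, y) (1, 0) / (fderiv ℝ F (0, y) (1, 0) 0) ^ 2
    else fderiv ℝ F (0, y) (0, v) i / fderiv ℝ F (0, y) (1, 0) 0 := by
  ext i
  by_cases hi : i = 0
  · subst hi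
    simp [collarLimit, hF.fderiv_zero v]
  · simp [collarLimit, hi]
    ring

theorem tendsto_fderiv (p : ℝ × E) (i : Fin (2 * n + 2)) :
    Filter.Tendsto (fun q => fderiv ℝ F q p i) (𝓝[{q | q.1 ≠ 0}] (0, y))
      (𝓝 (fderiv ℝ F (0, y) p i)) :=
  (contDiffAt_fderiv_apply_coord hF.contDiffAt p i).continuousAt.tendsto.mono_left
    nhdsWithin_le_nhds

theorem eventually_ne : ∀ᶠ q in 𝓝[{q | q.1 ≠ 0}] ((0 : ℝ), y), F q 0 ≠ 0 := by
  filter_upwards [hF.tendsto_div.eventually_ne hF.transverse] with q hq h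
  exact hq (by rw [h, zero_div])

theorem tendsto_scLift_slice (v : E) :
    Filter.Tendsto (fun q : ℝ × E => q.1 • scLift (F q) (fderiv ℝ F q (0, v)))
      (𝓝[{q | q.1 ≠ 0}] (0, y)) (𝓝 (collarLimit F y v)) := by
  have h3 : ∀ᶠ q : ℝ × E in 𝓝[{q | q.1 ≠ 0}] ((0 : ℝ), y), q.1 ≠ 0 := eventually_mem_nhdsWithin
  have hg := hF.tendsto_div
  have hγ := tendsto_div_of_eventually_zero
    ((contDiffAt_fderiv_apply_coord hF.contDiffAt (0, v) 0).of_le (by simp))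
    (hF.eventually_fderiv_zero v)
  rw [hF.collarLimit_eq]
  refine ((PiLp.continuous_toLp 2 _).tendsto _).comp (f := fun q : ℝ × E =>
    fun i : Fin (2 * n + 2) => if i = 0 then fderiv ℝ F q (0, v) 0 / q.1 / (F q 0 / q.1) ^ 2
      else fderiv ℝ F q (0, v) i / (F q 0 / q.1)) ?_ |>.congr' ?_
  · rw [tendsto_pi_nhds]
    intro i
    by_cases hi : i = 0
    · simp only [hi, if_true]
      exact hγ.div (hg.pow 2) (pow_ne_zero 2 hF.transverse)
    · simp only [hi, if_false]
      exact (hF.tendsto_fderiv _ i).div hg hF.transverse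
  · filter_upwards [h3, hF.eventually_ne] with q hq hq'
    ext i
    by_cases hi : i = 0
    · subst hi
      simp [scLift]
      field_simp
    · simp [scLift, hi]
      field_simp

theorem tendsto_scLift_normal :
    Filter.Tendsto (fun q : ℝ × E => q.1 ^ 2 • scLift (F q) (fderiv ℝ F q (1, 0)))
      (𝓝[{q | q.1 ≠ 0}] (0, y))
      (𝓝 ((fderiv ℝ F (0, y) (1, 0) 0)⁻¹ • EuclideanSpace.single 0 1)) := by
  have h3 : ∀ᶠ q : ℝ × E in 𝓝[{q | q.1 ≠ 0}] ((0 : ℝ), y), q.1 ≠ 0 := eventually_mem_nhdsWithin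
  have hg := hF.tendsto_div
  have ht : Filter.Tendsto (fun q : ℝ × E => q.1) (𝓝[{q | q.1 ≠ 0}] (0, y)) (𝓝 0) :=
    (continuous_fst.tendsto ((0 : ℝ), y)).mono_left nhdsWithin_le_nhds
  have hlim : ((fderiv ℝ F (0, y) (1, 0) 0)⁻¹ • EuclideanSpace.single 0 1 : Euc (2 * n + 2)) =
      WithLp.toLp 2 fun i => if i = 0 then
        fderiv ℝ F (0, y) (1, 0) 0 / (fderiv ℝ F (0, y) (1, 0) 0) ^ 2
        else 0 * fderiv ℝ F (0, y) (1, 0) i / fderiv ℝ F (0, y) (1, 0) 0 := by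
    ext i
    by_cases hi : i = 0
    · subst hi
      simp
      have := hF.transverse
      field_simp
    · simp [hi]
  rw [hlim]
  refine ((PiLp.continuous_toLp 2 _).tendsto _).comp (f := fun q : ℝ × E =>
    fun i : Fin (2 * n + 2) => if i = 0 then fderiv ℝ F q (1, 0) 0 / (F q 0 / q.1) ^ 2
      else q.1 * fderiv ℝ F q (1, 0) i / (F q 0 / q.1)) ?_ |>.congr' ?_
  · rw [tendsto_pi_nhds]
    intro i
    by_cases hi : i = 0
    · simp only [hi, if_true]
      exact (hF.tendsto_fderiv _ 0).div (hg.pow 2) (pow_ne_zero 2 hF.transverse)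
    · simp only [hi, if_false]
      exact (ht.mul (hF.tendsto_fderiv _ i)).div hg hF.transverse
  · filter_upwards [h3, hF.eventually_ne] with q hq hq'
    ext i
    by_cases hi : i = 0
    · subst hi
      simp [scLift]
      field_simp
    · simp [scLift, hi]
      field_simp

variable {a : Euc (2 * n + 2) → Euc (2 * n + 2) [⋀^Fin 2]→L[ℝ] ℝ}
  (ha : ContinuousAt a (F (0, y)))
include ha

theorem tendsto_eval {g h : ℝ × E → Euc (2 * n + 2)} {g₀ h₀ : Euc (2 * n + 2)}
    (hg : Filter.Tendsto g (𝓝[{q | q.1 ≠ 0}] (0, y)) (𝓝 g₀))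
    (hh : Filter.Tendsto h (𝓝[{q | q.1 ≠ 0}] (0, y)) (𝓝 h₀)) :
    Filter.Tendsto (fun q => a (F q) ![g q, h q]) (𝓝[{q | q.1 ≠ 0}] (0, y))
      (𝓝 (a (F (0, y)) ![g₀, h₀])) := by
  refine Filter.Tendsto.eval (ha.tendsto.comp
    (hF.contDiffAt.continuousAt.tendsto.mono_left nhdsWithin_le_nhds)) ?_
  rw [tendsto_pi_nhds]
  intro i
  fin_cases i
  · exact hg
  · exact hh

/-- The form restricted to slices grows like `1/t²`, as the scattering coefficients of vectors tangent
to them are of order `1/t`. -/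
theorem tendsto_slice_form (v w : E) :
    Filter.Tendsto (fun q : ℝ × E => q.1 ^ 2 * a (F q) ![scLift (F q) (fderiv ℝ F q (0, v)),
      scLift (F q) (fderiv ℝ F q (0, w))]) (𝓝[{q | q.1 ≠ 0}] (0, y))
      (𝓝 (a (F (0, y)) ![collarLimit F y v, collarLimit F y w])) := by
  refine (hF.tendsto_eval ha (hF.tendsto_scLift_slice v) (hF.tendsto_scLift_slice w)).congr ?_
  intro q
  rw [form_smul_smul]
  ring

/-- The direction `∂_t` has scattering coefficients of order `1/t²`, and only its `x²∂_x` component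
contributes to the limit. -/
theorem tendsto_normal_form (v : E) :
    Filter.Tendsto (fun q : ℝ × E => q.1 ^ 3 * a (F q) ![scLift (F q) (fderiv ℝ F q (0, v)),
      scLift (F q) (fderiv ℝ F q (1, 0))]) (𝓝[{q | q.1 ≠ 0}] (0, y))
      (𝓝 (((fderiv ℝ F (0, y) (1, 0) 0) ^ 2)⁻¹ *
        a (F (0, y)) ![fderiv ℝ F (0, y) (0, v), EuclideanSpace.single 0 1])) := by
  have h := hF.tendsto_eval ha (hF.tendsto_scLift_slice v) hF.tendsto_scLift_normal
  have e : a (F (0, y)) ![collarLimit F y v,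
      (fderiv ℝ F (0, y) (1, 0) 0)⁻¹ • EuclideanSpace.single 0 1] =
      ((fderiv ℝ F (0, y) (1, 0) 0) ^ 2)⁻¹ *
        a (F (0, y)) ![fderiv ℝ F (0, y) (0, v), EuclideanSpace.single 0 1] := by
    rw [collarLimit, ← formBilin_apply]
    simp only [map_add, map_smul, LinearMap.add_apply, LinearMap.smul_apply, formBilin_apply,
      form_self, smul_eq_mul]
    ring
  rw [e] at h
  refine h.congr fun q => ?_
  rw [form_smul_smul]
  ring

omit hF ha in
/-- On vectors annihilated by the contact form the limiting form is a multiple of the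
coefficient form on the hypersurface. -/
theorem collarLimit_form_of_ker (B : Euc (2 * n + 2) [⋀^Fin 2]→L[ℝ] ℝ) {v w : E}
    (hv : B ![fderiv ℝ F (0, y) (0, v), EuclideanSpace.single 0 1] = 0)
    (hw : B ![fderiv ℝ F (0, y) (0, w), EuclideanSpace.single 0 1] = 0) :
    B ![collarLimit F y v, collarLimit F y w] = ((fderiv ℝ F (0, y) (1, 0) 0) ^ 2)⁻¹ *
      B ![fderiv ℝ F (0, y) (0, v), fderiv ℝ F (0, y) (0, w)] := by
  have hw' : B ![EuclideanSpace.single 0 1, fderiv ℝ F (0, y) (0, w)] = 0 := by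
    rw [form_skew, hw, neg_zero]
  rw [collarLimit, collarLimit, ← formBilin_apply]
  simp only [map_add, map_smul, LinearMap.add_apply, LinearMap.smul_apply, formBilin_apply,
      form_self, smul_eq_mul, hv, hw']
  ring

end IsCollarAt

end ScLimits

/-! ### The induced contact form and its exterior derivative -/

section InducedForm

variable {n : ℕ} {E : Type*} [NormedAddCommGroup E] [NormedSpace ℝ E]

/-- The 1-form `a(·, x²∂_x)` on the coordinate space, where `a` is evaluated on scattering
coefficients: it is `α₀` if `a` represents `α₀ ∧ dx/x³ + β/x²`. -/
def normalForm (a : Euc (2 * n + 2) → Euc (2 * n + 2) [⋀^Fin 2]→L[ℝ] ℝ)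
    (u : Euc (2 * n + 2)) : Euc (2 * n + 2) [⋀^Fin 1]→L[ℝ] ℝ :=
  -(a u).curryLeft (EuclideanSpace.single 0 1)

theorem normalForm_apply (a : Euc (2 * n + 2) → Euc (2 * n + 2) [⋀^Fin 2]→L[ℝ] ℝ)
    (u p : Euc (2 * n + 2)) :
    normalForm a u ![p] = a u ![p, EuclideanSpace.single 0 1] := by
  rw [form_skew]
  rfl

theorem contDiffOn_normalForm {T : Set (Euc (2 * n + 2))}
    {a : Euc (2 * n + 2) → Euc (2 * n + 2) [⋀^Fin 2]→L[ℝ] ℝ} (ha : ContDiffOn ℝ ∞ a T) :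
    ContDiffOn ℝ ∞ (normalForm a) T := by
  let L : (Euc (2 * n + 2) [⋀^Fin 2]→L[ℝ] ℝ) →L[ℝ] (Euc (2 * n + 2) [⋀^Fin 1]→L[ℝ] ℝ) :=
    LinearMap.mkContinuous
      { toFun := fun b => b.curryLeft (EuclideanSpace.single 0 1)
        map_add' := fun b c => rfl
        map_smul' := fun r b => rfl }
      ‖(EuclideanSpace.single 0 1 : Euc (2 * n + 2))‖
      (fun b => by
        have h := b.curryLeft.le_opNorm (EuclideanSpace.single 0 1)
        rw [ContinuousAlternatingMap.norm_curryLeft] at h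
        exact h.trans_eq (mul_comm _ _))
  exact (L.contDiff.comp_contDiffOn ha).neg

/-- On vectors tangent to the hypersurface, `dη = 2 a` for `η = normalForm a`, if the scattering form
is closed. -/
theorem extDeriv_normalForm {T : Set (Euc (2 * n + 2))} (hT : IsOpen T)
    {w a : Euc (2 * n + 2) → Euc (2 * n + 2) [⋀^Fin 2]→L[ℝ] ℝ}
    (ha : ContDiffOn ℝ ∞ a T)
    (heq : ∀ u ∈ T, u 0 ≠ 0 → ∀ p q, w u ![scFrame u p, scFrame u q] = a u ![p, q])
    (hw : ∀ u ∈ T, u 0 ≠ 0 → DifferentiableAt ℝ w u)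
    (hclosed : ∀ u ∈ T, u 0 ≠ 0 → extDeriv w u = 0)
    {u p q : Euc (2 * n + 2)} (hu : u ∈ T) (hu0 : u 0 = 0) (hp : p 0 = 0) (hq : q 0 = 0) :
    extDeriv (normalForm a) u ![p, q] = 2 * a u ![p, q] := by
  have hd : DifferentiableAt ℝ (normalForm a) u :=
    ((contDiffOn_normalForm ha).contDiffAt (hT.mem_nhds hu)).differentiableAt (by simp)
  have h := fderiv_sub_fderiv_of_closed hT ha heq hw hclosed hu hu0 hp hq
  rw [extDeriv_apply hd, Fin.sum_univ_two]
  have r0 : (0 : Fin 2).removeNth ![p, q] = ![q] := by ext i; fin_cases i; rfl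
  have r1 : (1 : Fin 2).removeNth ![p, q] = ![p] := by ext i; fin_cases i; rfl
  have e : ∀ r, (fun u => normalForm a u ![r]) =
      fun u => -a u ![EuclideanSpace.single 0 1, r] := fun r => rfl
  rw [r0, r1, e, e]
  simp only [fderiv_fun_neg]
  simp
  linear_combination -h

/-- The 1-form induced on a parametrized piece `k` of the hypersurface `x = 0`. -/
def inducedForm (a : Euc (2 * n + 2) → Euc (2 * n + 2) [⋀^Fin 2]→L[ℝ] ℝ)
    (k : E → Euc (2 * n + 2)) (y : E) : E [⋀^Fin 1]→L[ℝ] ℝ :=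
  (normalForm a (k y)).compContinuousLinearMap (fderiv ℝ k y)

theorem inducedForm_apply (a : Euc (2 * n + 2) → Euc (2 * n + 2) [⋀^Fin 2]→L[ℝ] ℝ)
    (k : E → Euc (2 * n + 2)) (y v : E) :
    inducedForm a k y ![v] = a (k y) ![fderiv ℝ k y v, EuclideanSpace.single 0 1] := by
  rw [← normalForm_apply]
  change normalForm a (k y) _ = _
  congr 1
  funext i
  fin_cases i
  rfl

theorem contDiffAt_inducedForm {T : Set (Euc (2 * n + 2))} (hT : IsOpen T)
    {a : Euc (2 * n + 2) → Euc (2 * n + 2) [⋀^Fin 2]→L[ℝ] ℝ} (ha : ContDiffOn ℝ ∞ a T)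
    {k : E → Euc (2 * n + 2)} {y : E} (hk : ContDiffAt ℝ ∞ k y) (hy : k y ∈ T) :
    ContDiffAt ℝ ∞ (inducedForm a k) y := by
  have h1 : ContDiffAt ℝ ∞ (fun y => normalForm a (k y)) y :=
    ContDiffAt.comp y (g := normalForm a) ((contDiffOn_normalForm ha).contDiffAt (hT.mem_nhds hy)) hk
  exact ContDiffAt.comp y (contDiff_compContinuousLinearMap 1).contDiffAt
    (h1.prodMk (hk.fderiv_right (by simp)))

theorem extDeriv_inducedForm {T : Set (Euc (2 * n + 2))} (hT : IsOpen T)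
    {w a : Euc (2 * n + 2) → Euc (2 * n + 2) [⋀^Fin 2]→L[ℝ] ℝ}
    (ha : ContDiffOn ℝ ∞ a T)
    (heq : ∀ u ∈ T, u 0 ≠ 0 → ∀ p q, w u ![scFrame u p, scFrame u q] = a u ![p, q])
    (hw : ∀ u ∈ T, u 0 ≠ 0 → DifferentiableAt ℝ w u)
    (hclosed : ∀ u ∈ T, u 0 ≠ 0 → extDeriv w u = 0)
    {k : E → Euc (2 * n + 2)} {y : E} (hk : ContDiffAt ℝ ∞ k y) (hy : k y ∈ T)
    (hk0 : ∀ᶠ y' in 𝓝 y, k y' 0 = 0) (v v' : E) :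
    extDeriv (inducedForm a k) y ![v, v'] =
      2 * a (k y) ![fderiv ℝ k y v, fderiv ℝ k y v'] := by
  have hη : DifferentiableAt ℝ (normalForm a) (k y) :=
    ((contDiffOn_normalForm ha).contDiffAt (hT.mem_nhds hy)).differentiableAt (by simp)
  have hDk : ∀ v, fderiv ℝ k y v 0 = 0 := by
    intro v
    have h1 := ((EuclideanSpace.proj (𝕜 := ℝ) (0 : Fin (2 * n + 2))).hasFDerivAt
      (x := k y)).comp y (hk.differentiableAt (by simp)).hasFDerivAt
    have h2 : HasFDerivAt (fun y' : E => k y' 0) (0 : E →L[ℝ] ℝ) y :=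
      (hasFDerivAt_const (0 : ℝ) y).congr_of_eventuallyEq hk0
    simpa using congrArg (fun L => L v) (h1.unique h2)
  have h := extDeriv_pullback hη hk (by
    rw [minSmoothness_of_isRCLikeNormedField]
    exact WithTop.coe_le_coe.2 (le_top : (2 : ℕ∞) ≤ ⊤))
  change extDeriv (fun y => (normalForm a (k y)).compContinuousLinearMap (fderiv ℝ k y)) y _ = _
  rw [h, ← extDeriv_normalForm hT ha heq hw hclosed hy hk0.self_of_nhds (hDk v) (hDk v')]
  change extDeriv (normalForm a) (k y) _ = _
  congr 1
  funext i
  fin_cases i <;> rfl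

/-- If two 1-forms are proportional near a point then so are their exterior derivatives on the
common kernel at that point. -/
theorem extDeriv_eq_of_proportional {θ α : E → E [⋀^Fin 1]→L[ℝ] ℝ} {y : E}
    (hθ : DifferentiableAt ℝ θ y) (hα : DifferentiableAt ℝ α y)
    (hprop : ∀ᶠ y' in 𝓝 y, ∃ l : ℝ, ∀ v, θ y' ![v] = l * α y' ![v]) {l : ℝ}
    (hl : ∀ v, θ y ![v] = l * α y ![v]) {v₀ : E} (hv₀ : α y ![v₀] ≠ 0) {v w : E}
    (hv : α y ![v] = 0) (hw : α y ![w] = 0) :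
    extDeriv θ y ![v, w] = l * extDeriv α y ![v, w] := by
  have happ : ∀ {β : E → E [⋀^Fin 1]→L[ℝ] ℝ}, DifferentiableAt ℝ β y → ∀ c,
      DifferentiableAt ℝ (fun y => β y c) y := fun h c =>
    (ContinuousAlternatingMap.apply ℝ E ℝ c).differentiableAt.comp y h
  have hext : ∀ {β : E → E [⋀^Fin 1]→L[ℝ] ℝ}, DifferentiableAt ℝ β y →
      extDeriv β y ![v, w] = fderiv ℝ (fun y => β y ![w]) y v - fderiv ℝ (fun y => β y ![v]) y w := by
    intro β hβ
    have r0 : (0 : Fin 2).removeNth ![v, w] = ![w] := by funext i; fin_cases i; rfl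
    have r1 : (1 : Fin 2).removeNth ![v, w] = ![v] := by funext i; fin_cases i; rfl
    rw [extDeriv_apply hβ, Fin.sum_univ_two, r0, r1]
    simp
    ring
  -- the factor of proportionality is differentiable, being a quotient of values on `v₀`
  set c : E → ℝ := fun y => θ y ![v₀] / α y ![v₀] with hc
  have hcd : DifferentiableAt ℝ c y := by
    simp only [hc, div_eq_mul_inv]
    exact (happ hθ ![v₀]).fun_mul ((happ hα ![v₀]).fun_inv hv₀)
  have hcy : c y = l := by
    rw [hc]
    simp only [hl v₀]
    field_simp
  have hev : ∀ r, (fun y => θ y ![r]) =ᶠ[𝓝 y] fun y => c y * α y ![r] := by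
    intro r
    filter_upwards [hprop, (happ hα ![v₀]).continuousAt.eventually_ne hv₀] with y' ⟨l', h⟩ h0
    rw [hc]
    simp only [h v₀, h r]
    field_simp
  have hder : ∀ r s, α y ![r] = 0 → fderiv ℝ (fun y => θ y ![r]) y s =
      l * fderiv ℝ (fun y => α y ![r]) y s := by
    intro r s hr
    rw [(hev r).fderiv_eq, fderiv_fun_mul hcd (happ hα _)]
    simp [hr, hcy]
  rw [hext hθ, hext hα, hder _ _ hv, hder _ _ hw]
  ring

end InducedForm

section Collar

variable {n : ℕ}
  {Z : Type*} [TopologicalSpace Z] [ChartedSpace (Euc (2 * n + 1)) Z]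
  {X : Type*} [TopologicalSpace X] [ChartedSpace (Euc (2 * n + 2)) X]

/-- The map `(t, y) ↦ (t, φ⁻¹ y)` as a partial diffeomorphism. -/
def prodChartSymm (φ : OpenPartialHomeomorph Z (Euc (2 * n + 1)))
    (hφ : φ ∈ IsManifold.maximalAtlas (𝓡 (2 * n + 1)) ∞ Z) :
    PartialDiffeomorph 𝓘(ℝ, ℝ × Euc (2 * n + 1)) (𝓘(ℝ, ℝ).prod (𝓡 (2 * n + 1)))
      (ℝ × Euc (2 * n + 1)) (ℝ × Z) ∞ where
  toPartialEquiv := ((OpenPartialHomeomorph.refl ℝ).prod φ.symm).toPartialEquiv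
  open_source := ((OpenPartialHomeomorph.refl ℝ).prod φ.symm).open_source
  open_target := ((OpenPartialHomeomorph.refl ℝ).prod φ.symm).open_target
  contMDiffOn_toFun := by
    have h1 : ContMDiffOn 𝓘(ℝ, ℝ × Euc (2 * n + 1)) 𝓘(ℝ, ℝ) ∞
        (fun q : ℝ × Euc (2 * n + 1) => q.1) (Set.univ ×ˢ φ.target) :=
      contDiff_fst.contMDiff.contMDiffOn
    have h2 : ContMDiffOn 𝓘(ℝ, ℝ × Euc (2 * n + 1)) (𝓡 (2 * n + 1)) ∞
        (fun q : ℝ × Euc (2 * n + 1) => φ.symm q.2) (Set.univ ×ˢ φ.target) :=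
      (contMDiffOn_symm_of_mem_maximalAtlas hφ).comp contDiff_snd.contMDiff.contMDiffOn
        fun q hq => hq.2
    exact h1.prodMk h2
  contMDiffOn_invFun := by
    have h1 : ContMDiffOn (𝓘(ℝ, ℝ).prod (𝓡 (2 * n + 1))) 𝓘(ℝ, ℝ) ∞
        (fun q : ℝ × Z => q.1) (Set.univ ×ˢ φ.source) := contMDiff_fst.contMDiffOn
    have h2 : ContMDiffOn (𝓘(ℝ, ℝ).prod (𝓡 (2 * n + 1))) (𝓡 (2 * n + 1)) ∞
        (fun q : ℝ × Z => φ q.2) (Set.univ ×ˢ φ.source) :=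
      (contMDiffOn_of_mem_maximalAtlas hφ).comp contMDiff_snd.contMDiffOn fun q hq => hq.2
    exact h1.prodMk_space h2

/-- The collar `τ` in the coordinates of a chart `φ` of the hypersurface. -/
def collarMap (τ : ℝ × Z → X) (φ : OpenPartialHomeomorph Z (Euc (2 * n + 1)))
    (q : ℝ × Euc (2 * n + 1)) : X := τ (q.1, φ.symm q.2)

variable {ι : Z → X} {τ : ℝ × Z → X} {φ : OpenPartialHomeomorph Z (Euc (2 * n + 1))}

theorem isLocalDiffeomorphAt_collarMap (hτ : IsTubularMap n ι τ)
    (hφ : φ ∈ IsManifold.maximalAtlas (𝓡 (2 * n + 1)) ∞ Z) {q : ℝ × Euc (2 * n + 1)}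
    (hq : q.2 ∈ φ.target) :
    IsLocalDiffeomorphAt 𝓘(ℝ, ℝ × Euc (2 * n + 1)) (𝓡 (2 * n + 2)) ∞ (collarMap τ φ) q := by
  have h1 : IsLocalDiffeomorphAt 𝓘(ℝ, ℝ × Euc (2 * n + 1)) (𝓘(ℝ, ℝ).prod (𝓡 (2 * n + 1))) ∞
      (prodChartSymm φ hφ) q :=
    (prodChartSymm φ hφ).isLocalDiffeomorphAt _ _ _ ⟨trivial, hq⟩
  exact h1.comp (g := τ) (𝓡 (2 * n + 2)) X (hτ.isLocalDiffeomorph _)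

theorem IsTubularMap.mem_range_iff (hτ : IsTubularMap n ι τ) (t : ℝ) (z : Z) :
    τ (t, z) ∈ Set.range ι ↔ t = 0 := by
  constructor
  · rintro ⟨z', hz'⟩
    rw [← hτ.zero_section] at hz'
    exact (congrArg Prod.fst (hτ.injective hz')).symm
  · rintro rfl
    exact ⟨z, (hτ.zero_section z).symm⟩

/-- In an adapted chart the collar crosses the hypersurface transversally, since its differential is
surjective while the slice directions span only `{x = 0}`. -/
theorem isCollarAt_collarMap (hτ : IsTubularMap n ι τ)
    (hφ : φ ∈ IsManifold.maximalAtlas (𝓡 (2 * n + 1)) ∞ Z)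
    {e : OpenPartialHomeomorph X (Euc (2 * n + 2))} (he : IsAdaptedChart (Set.range ι) e)
    {y : Euc (2 * n + 1)} (hy : y ∈ φ.target) (hye : ι (φ.symm y) ∈ e.source) :
    IsCollarAt (fun q => e (collarMap τ φ q)) y := by
  have hG := isLocalDiffeomorphAt_collarMap hτ hφ (q := (0, y)) hy
  have hmem : collarMap τ φ (0, y) ∈ e.source := by
    rw [collarMap, hτ.zero_section]
    exact hye
  have hzero : ∀ᶠ y' in 𝓝 y, e (collarMap τ φ (0, y')) 0 = 0 := by
    have hc : ContinuousAt (fun y' => collarMap τ φ (0, y')) y :=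
      ContinuousAt.comp (f := fun y' : Euc (2 * n + 1) => ((0 : ℝ), y'))
        hG.contMDiffAt.continuousAt (by fun_prop)
    filter_upwards [hc.eventually (e.open_source.mem_nhds hmem)] with y' hy'
    exact (he.2 _ hy').1 ((hτ.mem_range_iff _ _).2 rfl)
  have hd := contDiffAt_chart_comp he.1 hmem hG.contMDiffAt
  refine ⟨hd, hzero, fun h0 => ?_⟩
  have hsurj : Function.Surjective (fderiv ℝ (fun q => e (collarMap τ φ q)) (0, y)) := by
    have hmd := mdifferentiable_of_mem_maximalAtlas he.1
    have h3 : fderiv ℝ (fun q => e (collarMap τ φ q)) (0, y) =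
        (mfderiv (𝓡 (2 * n + 2)) (𝓡 (2 * n + 2)) e (collarMap τ φ (0, y))).comp
          (mfderiv 𝓘(ℝ, ℝ × Euc (2 * n + 1)) (𝓡 (2 * n + 2)) (collarMap τ φ) (0, y)) := by
      rw [← mfderiv_eq_fderiv]
      exact mfderiv_comp _ (hmd.mdifferentiableAt hmem) (hG.mdifferentiableAt (by simp))
    rw [h3]
    exact (hmd.mfderiv_surjective hmem).comp
      (hG.mfderivToContinuousLinearEquiv (by simp)).surjective
  have hslice : ∀ v, fderiv ℝ (fun q => e (collarMap τ φ q)) (0, y) (0, v) 0 = 0 := by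
    intro v
    have h5 : HasFDerivAt (fun y' : Euc (2 * n + 1) => ((0 : ℝ), y'))
      (ContinuousLinearMap.inr ℝ ℝ (Euc (2 * n + 1))) y := hasFDerivAt_prodMk_right 0 y
    have h6 := (HasFDerivAt.comp (0, y) (f := fun q => e (collarMap τ φ q))
      (EuclideanSpace.proj (𝕜 := ℝ) (0 : Fin (2 * n + 2))).hasFDerivAt
        (hd.differentiableAt (by simp)).hasFDerivAt).comp y h5
    have h7 : HasFDerivAt (fun y' => e (collarMap τ φ (0, y')) 0)
        (0 : Euc (2 * n + 1) →L[ℝ] ℝ) y :=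
      (hasFDerivAt_const (0 : ℝ) y).congr_of_eventuallyEq hzero
    simpa using congrArg (fun L => L v) (h6.unique h7)
  obtain ⟨p, hp⟩ := hsurj (EuclideanSpace.single 0 1)
  have hp2 : p = p.1 • ((1 : ℝ), (0 : Euc (2 * n + 1))) + (0, p.2) := by ext <;> simp
  have h1 := congrArg (fun u : Euc (2 * n + 2) => u 0) hp
  rw [hp2, map_add, map_smul] at h1
  simp [h0, hslice] at h1

end Collar

/-! ### Slices of a collar -/

section SliceAlgebra

variable {V : Type*} [AddCommGroup V] [Module ℝ V]

omit [AddCommGroup V] [Module ℝ V] in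
theorem contactVol_smul (n : ℕ) (a : V → ℝ) (B : V → V → ℝ) (s r : ℝ)
    (v : Fin (2 * n + 1) → V) :
    contactVol n (fun x => s * a x) (fun x y => r * B x y) v = s * r ^ n * contactVol n a B v := by
  rw [contactVol, contactVol, Finset.mul_sum]
  refine Finset.sum_congr rfl fun σ _ => ?_
  rw [Finset.prod_mul_distrib, Finset.prod_const, Finset.card_univ, Fintype.card_fin]
  ring

omit [AddCommGroup V] [Module ℝ V] in
theorem tendsto_contactVol {β : Type*} {l : Filter β} (n : ℕ) {a : β → V → ℝ}
    {B : β → V → V → ℝ} {a₀ : V → ℝ} {B₀ : V → V → ℝ} (v : Fin (2 * n + 1) → V)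
    (ha : ∀ i, Filter.Tendsto (fun x => a x (v i)) l (𝓝 (a₀ (v i))))
    (hB : ∀ i j, Filter.Tendsto (fun x => B x (v i) (v j)) l (𝓝 (B₀ (v i) (v j)))) :
    Filter.Tendsto (fun x => contactVol n (a x) (B x) v) l (𝓝 (contactVol n a₀ B₀ v)) := by
  refine tendsto_finsetSum _ fun σ _ => Filter.Tendsto.const_mul _ ?_
  exact (ha _).mul (tendsto_finsetProd _ fun i _ => hB _ _)

/-- If all convex combinations of `s B` and `D`, `s > 0`, have a nonvanishing volume with `a`, then
`B + c D` is nondegenerate on the kernel of `a` for all `c ≥ 0`. The compact parameter space makes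
this condition accessible to limit arguments, unlike that on all `c ≥ 0`. -/
theorem nondegOn_add_of_contactVol [FiniteDimensional ℝ V] (n : ℕ)
    (hV : Module.finrank ℝ V = 2 * n + 1) (a : V →ₗ[ℝ] ℝ) (B D : V →ₗ[ℝ] V →ₗ[ℝ] ℝ)
    (hB : ∀ v w, B v w = -B w v) (hD : ∀ v w, D v w = -D w v) {s : ℝ} (hs : 0 < s)
    {b : Fin (2 * n + 1) → V}
    (h : ∀ μ ∈ Set.Icc (0 : ℝ) 1,
      contactVol n a (fun v w => μ * (s * B v w) + (1 - μ) * D v w) b ≠ 0)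
    {c : ℝ} (hc : 0 ≤ c) : NondegOn {v | a v = 0} fun v w => B v w + c * D v w := by
  have hpos : 0 < 1 + s * c := by positivity
  -- the weight for which the convex combination is a multiple of `B + c D`
  set μ : ℝ := 1 / (1 + s * c) with hμ
  have hμ0 : 0 < μ := by positivity
  have hμ1 : μ ≤ 1 := by
    rw [hμ, div_le_one hpos]
    nlinarith [mul_nonneg hs.le hc]
  have hnd := nondegOn_ker_of_contactVol_ne_zero n hV a ((μ * s) • B + (1 - μ) • D)
    (fun v w => by simp [hB v w, hD v w]; ring) (v := b) (by
      have := h μ ⟨hμ0.le, hμ1⟩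
      simpa [mul_assoc] using this)
  intro v hv hvw
  refine hnd v hv fun w hw => ?_
  have h1 := hvw w hw
  have h2 : 1 - μ = μ * s * c := by
    rw [hμ]
    field_simp
    ring
  simp only [LinearMap.add_apply, LinearMap.smul_apply, smul_eq_mul, h2]
  linear_combination (μ * s) * h1

end SliceAlgebra

section Slices

variable {n : ℕ}
  {Z : Type*} [TopologicalSpace Z] [ChartedSpace (Euc (2 * n + 1)) Z]
  {X : Type*} [TopologicalSpace X] [ChartedSpace (Euc (2 * n + 2)) X]

/-- The slice `{t} × Z` of the collar `τ` satisfies, at the point `z`, the conditions required of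
the boundary of a weak filling. The orientation condition is stated for the normal vector `∂_t`,
which points towards the hypersurface for `t < 0` and away from it for `t > 0`. -/
structure IsWeakSlice (Ω : DForm (2 * n + 2) X 2) (α : DForm (2 * n + 1) Z 1) (τ : ℝ × Z → X)
    (t : ℝ) (z : Z) : Prop where
  nondeg : ∀ c : ℝ, 0 ≤ c → NondegOn {v | α z ![v] = 0} fun v w =>
    Ω (τ (t, z)) ![mfderiv (𝓡 (2 * n + 1)) (𝓡 (2 * n + 2)) (fun z' => τ (t, z')) z v,
      mfderiv (𝓡 (2 * n + 1)) (𝓡 (2 * n + 2)) (fun z' => τ (t, z')) z w] + c * extD α z ![v, w]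
  orientation : ∀ v : Fin (2 * n + 1) → TangentSpace (𝓡 (2 * n + 1)) z, 0 < contactVolAt α z v →
    t * symplVol n (fun a b => Ω (τ (t, z)) ![a, b])
      (Fin.cons (mfderiv 𝓘(ℝ, ℝ) (𝓡 (2 * n + 2)) (fun s => τ (s, z)) t (1 : ℝ)) fun i =>
        mfderiv (𝓡 (2 * n + 1)) (𝓡 (2 * n + 2)) (fun z' => τ (t, z')) z (v i)) < 0

/-- A criterion for the conditions on a slice in terms of one tuple of tangent vectors. -/
theorem isWeakSlice_of_contactVol {Ω : DForm (2 * n + 2) X 2} {α : DForm (2 * n + 1) Z 1}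
    {τ : ℝ × Z → X} {t : ℝ} {z : Z} (ht : t ≠ 0)
    (b : Fin (2 * n + 1) → TangentSpace (𝓡 (2 * n + 1)) z)
    (h1 : ∀ μ ∈ Set.Icc (0 : ℝ) 1, contactVol n (fun v => α z ![v]) (fun v w =>
      μ * (t ^ 2 * Ω (τ (t, z)) ![
        mfderiv (𝓡 (2 * n + 1)) (𝓡 (2 * n + 2)) (fun z' => τ (t, z')) z v,
        mfderiv (𝓡 (2 * n + 1)) (𝓡 (2 * n + 2)) (fun z' => τ (t, z')) z w]) +
      (1 - μ) * extD α z ![v, w]) b ≠ 0)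
    (h2 : 0 < contactVol n (fun v => t ^ 3 * Ω (τ (t, z)) ![
        mfderiv (𝓡 (2 * n + 1)) (𝓡 (2 * n + 2)) (fun z' => τ (t, z')) z v,
        mfderiv 𝓘(ℝ, ℝ) (𝓡 (2 * n + 2)) (fun s => τ (s, z)) t (1 : ℝ)])
      (fun v w => t ^ 2 * Ω (τ (t, z)) ![
        mfderiv (𝓡 (2 * n + 1)) (𝓡 (2 * n + 2)) (fun z' => τ (t, z')) z v,
        mfderiv (𝓡 (2 * n + 1)) (𝓡 (2 * n + 2)) (fun z' => τ (t, z')) z w]) b *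
      contactVolAt α z b) : IsWeakSlice Ω α τ t z := by
  have hV : Module.finrank ℝ (TangentSpace (𝓡 (2 * n + 1)) z) = 2 * n + 1 := by
    change Module.finrank ℝ (Euc (2 * n + 1)) = _
    simp
  have hfin : FiniteDimensional ℝ (TangentSpace (𝓡 (2 * n + 1)) z) :=
    inferInstanceAs (FiniteDimensional ℝ (Euc (2 * n + 1)))
  set L := mfderiv (𝓡 (2 * n + 1)) (𝓡 (2 * n + 2)) (fun z' => τ (t, z')) z with hL
  set ν : TangentSpace (𝓡 (2 * n + 2)) (τ (t, z)) :=
    mfderiv 𝓘(ℝ, ℝ) (𝓡 (2 * n + 2)) (fun s => τ (s, z)) t (1 : ℝ) with hν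
  set B : TangentSpace (𝓡 (2 * n + 1)) z →ₗ[ℝ] TangentSpace (𝓡 (2 * n + 1)) z →ₗ[ℝ] ℝ :=
    (formBilin (Ω (τ (t, z)))).compl₁₂ L.toLinearMap L.toLinearMap with hB
  set A : TangentSpace (𝓡 (2 * n + 1)) z →ₗ[ℝ] ℝ :=
    ((formBilin (Ω (τ (t, z)))).flip ν).comp L.toLinearMap with hA
  have hBs : ∀ v w, B v w = -B w v := fun v w => form_skew _ _ _
  refine ⟨fun c hc => ?_, fun v hv => ?_⟩
  · exact nondegOn_add_of_contactVol n hV (formLin (α z)) B (formBilin (extD α z)) hBs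
      (fun v w => form_skew (extD α z) v w) (s := t ^ 2) (by positivity) (b := b) h1 hc
  · have hA' : contactVolAlt n (t ^ 3 • A) (t ^ 2 • B) v * contactVolAt α z v > 0 := by
      have e : ∀ u, contactVolAt α z u =
          contactVolAlt n (formLin (α z)) (formBilin (extD α z)) u := fun u => by
        rw [contactVolAlt_apply n _ _ fun v w => form_skew (extD α z) v w]
        rfl
      rw [e] at h2 hv ⊢
      refine mul_pos_of_mul_pos_of_top hV _ _ (b := b) ?_ hv.ne'
      rw [contactVolAlt_apply n _ _ fun v w => by simp [hBs v w]]
      exact h2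
    rw [contactVolAlt_apply n _ _ fun v w => by simp [hBs v w]] at hA'
    have h3 : contactVol n (t ^ 3 • A) (fun a b => (t ^ 2 • B) a b) v =
        t ^ 3 * (t ^ 2) ^ n * contactVol n A (fun a b => B a b) v :=
      contactVol_smul n A (fun a b => B a b) (t ^ 3) (t ^ 2) v
    have h4 : symplVol n (fun a b => Ω (τ (t, z)) ![a, b]) (Fin.cons ν fun i => L (v i)) =
        (2 * n + 2) * contactVol n (fun x => -1 * A x) (fun a b => 1 * B a b) v := by
      rw [symplVol_cons n fun a b => form_skew _ a b]
      have e1 : ∀ x, -1 * A x = Ω (τ (t, z)) ![ν, L x] := fun x => by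
        rw [form_skew, neg_one_mul]
        rfl
      simp only [e1, one_mul]
      rfl
    rw [h4, contactVol_smul]
    rw [h3] at hA'
    have h5 : 0 < t ^ 3 * (t ^ 2) ^ n * contactVol n A (fun a b => B a b) v :=
      (pos_iff_pos_of_mul_pos hA').2 hv
    have h6 : 0 < t ^ 2 * (t ^ 2) ^ n := by positivity
    have h7 : 0 < t * contactVol n A (fun a b => B a b) v := by
      have : t ^ 3 * (t ^ 2) ^ n * contactVol n A (fun a b => B a b) v =
        (t ^ 2 * (t ^ 2) ^ n) * (t * contactVol n A (fun a b => B a b) v) := by ring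
      rw [this] at h5
      exact (pos_iff_pos_of_mul_pos h5).1 h6
    have h8 : (0 : ℝ) < 2 * n + 2 := by positivity
    have h9 := mul_pos h8 h7
    have h10 : (1 : ℝ) ^ n = 1 := one_pow n
    rw [h10]
    linarith

end Slices

/-! ### Scattering forms on a collar -/

section CollarForms

variable {n : ℕ}
  {Z : Type*} [TopologicalSpace Z] [ChartedSpace (Euc (2 * n + 1)) Z]
  {X : Type*} [TopologicalSpace X] [ChartedSpace (Euc (2 * n + 2)) X]
  {ι : Z → X} {τ : ℝ × Z → X} {φ : OpenPartialHomeomorph Z (Euc (2 * n + 1))}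
  {Ω : DForm (2 * n + 2) X 2} {α : DForm (2 * n + 1) Z 1}

section Derivatives

theorem IsTubularMap.contMDiff (hτ : IsTubularMap n ι τ) :
    ContMDiff (𝓘(ℝ, ℝ).prod (𝓡 (2 * n + 1))) (𝓡 (2 * n + 2)) ∞ τ :=
  fun p => (hτ.isLocalDiffeomorph p).contMDiffAt

theorem IsTubularMap.contMDiff_slice (hτ : IsTubularMap n ι τ) (t : ℝ) :
    ContMDiff (𝓡 (2 * n + 1)) (𝓡 (2 * n + 2)) ∞ fun z => τ (t, z) :=
  hτ.contMDiff.comp (contMDiff_const.prodMk contMDiff_id)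

theorem IsTubularMap.contMDiff_normal (hτ : IsTubularMap n ι τ) (z : Z) :
    ContMDiff 𝓘(ℝ, ℝ) (𝓡 (2 * n + 2)) ∞ fun t => τ (t, z) :=
  hτ.contMDiff.comp (contMDiff_id.prodMk contMDiff_const)

theorem mfderiv_collarMap_slice (hτ : IsTubularMap n ι τ)
    (hφ : φ ∈ IsManifold.maximalAtlas (𝓡 (2 * n + 1)) ∞ Z) {q : ℝ × Euc (2 * n + 1)}
    (hq : q.2 ∈ φ.target) (v : Euc (2 * n + 1)) :
    mfderiv 𝓘(ℝ, ℝ × Euc (2 * n + 1)) (𝓡 (2 * n + 2)) (collarMap τ φ) q ((0 : ℝ), v) =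
      mfderiv (𝓡 (2 * n + 1)) (𝓡 (2 * n + 2)) (fun z => τ (q.1, z)) (φ.symm q.2)
        (mfderiv (𝓡 (2 * n + 1)) (𝓡 (2 * n + 1)) φ.symm q.2 v) := by
  have hG := (isLocalDiffeomorphAt_collarMap hτ hφ hq).mdifferentiableAt (by simp)
  have h1 : HasMFDerivAt 𝓘(ℝ, Euc (2 * n + 1)) 𝓘(ℝ, ℝ × Euc (2 * n + 1))
      (fun y : Euc (2 * n + 1) => (q.1, y)) q.2
      (ContinuousLinearMap.inr ℝ ℝ (Euc (2 * n + 1))) :=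
    (hasFDerivAt_prodMk_right q.1 q.2).hasMFDerivAt
  have h2 := HasMFDerivAt.comp (g := collarMap τ φ) q.2 hG.hasMFDerivAt h1
  have h3 := HasMFDerivAt.comp (g := fun z => τ (q.1, z)) q.2
    (((hτ.contMDiff_slice q.1).mdifferentiable (by simp)) (φ.symm q.2)).hasMFDerivAt
    ((mdifferentiable_of_mem_maximalAtlas hφ).mdifferentiableAt_symm hq).hasMFDerivAt
  exact congrArg (fun L => L v) (hasMFDerivAt_unique h2 h3)

theorem mfderiv_collarMap_normal (hτ : IsTubularMap n ι τ)
    (hφ : φ ∈ IsManifold.maximalAtlas (𝓡 (2 * n + 1)) ∞ Z) {q : ℝ × Euc (2 * n + 1)}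
    (hq : q.2 ∈ φ.target) :
    mfderiv 𝓘(ℝ, ℝ × Euc (2 * n + 1)) (𝓡 (2 * n + 2)) (collarMap τ φ) q ((1 : ℝ), 0) =
      mfderiv 𝓘(ℝ, ℝ) (𝓡 (2 * n + 2)) (fun t => τ (t, φ.symm q.2)) q.1 (1 : ℝ) := by
  have hG := (isLocalDiffeomorphAt_collarMap hτ hφ hq).mdifferentiableAt (by simp)
  have h1 : HasMFDerivAt 𝓘(ℝ, ℝ) 𝓘(ℝ, ℝ × Euc (2 * n + 1))
      (fun t : ℝ => (t, q.2)) q.1 (ContinuousLinearMap.inl ℝ ℝ (Euc (2 * n + 1))) :=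
    (hasFDerivAt_prodMk_left q.1 q.2).hasMFDerivAt
  have h2 := HasMFDerivAt.comp (g := collarMap τ φ) q.1 hG.hasMFDerivAt h1
  have h3 := (((hτ.contMDiff_normal (φ.symm q.2)).mdifferentiable (by simp)) q.1).hasMFDerivAt
  exact congrArg (fun L => L (1 : ℝ)) (hasMFDerivAt_unique h2 h3)

end Derivatives

theorem apply_eq_of_forall_eq {V : Type*} {k : ℕ} {f : (Fin k → V) → ℝ} {v w : Fin k → V}
    (h : ∀ i, v i = w i) : f v = f w := by rw [funext h]

theorem pullForm_collarMap_slice (hτ : IsTubularMap n ι τ)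
    (hφ : φ ∈ IsManifold.maximalAtlas (𝓡 (2 * n + 1)) ∞ Z) {q : ℝ × Euc (2 * n + 1)}
    (hq : q.2 ∈ φ.target) (v w : Euc (2 * n + 1)) :
    pullForm (collarMap τ φ) Ω q ![(0, v), (0, w)] = Ω (τ (q.1, φ.symm q.2)) ![
      mfderiv (𝓡 (2 * n + 1)) (𝓡 (2 * n + 2)) (fun z => τ (q.1, z)) (φ.symm q.2)
        (mfderiv (𝓡 (2 * n + 1)) (𝓡 (2 * n + 1)) φ.symm q.2 v),
      mfderiv (𝓡 (2 * n + 1)) (𝓡 (2 * n + 2)) (fun z => τ (q.1, z)) (φ.symm q.2)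
        (mfderiv (𝓡 (2 * n + 1)) (𝓡 (2 * n + 1)) φ.symm q.2 w)] := by
  rw [← mfderiv_collarMap_slice hτ hφ hq, ← mfderiv_collarMap_slice hτ hφ hq]
  refine apply_eq_of_forall_eq (f := Ω (collarMap τ φ q)) fun i => ?_
  fin_cases i <;> rfl

theorem pullForm_collarMap_normal (hτ : IsTubularMap n ι τ)
    (hφ : φ ∈ IsManifold.maximalAtlas (𝓡 (2 * n + 1)) ∞ Z) {q : ℝ × Euc (2 * n + 1)}
    (hq : q.2 ∈ φ.target) (v : Euc (2 * n + 1)) :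
    pullForm (collarMap τ φ) Ω q ![(0, v), (1, 0)] = Ω (τ (q.1, φ.symm q.2)) ![
      mfderiv (𝓡 (2 * n + 1)) (𝓡 (2 * n + 2)) (fun z => τ (q.1, z)) (φ.symm q.2)
        (mfderiv (𝓡 (2 * n + 1)) (𝓡 (2 * n + 1)) φ.symm q.2 v),
      mfderiv 𝓘(ℝ, ℝ) (𝓡 (2 * n + 2)) (fun t => τ (t, φ.symm q.2)) q.1 (1 : ℝ)] := by
  rw [← mfderiv_collarMap_slice hτ hφ hq, ← mfderiv_collarMap_normal hτ hφ hq]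
  refine apply_eq_of_forall_eq (f := Ω (collarMap τ φ q)) fun i => ?_
  fin_cases i <;> rfl

/-- The pullback of a scattering form to a collar, in terms of its coefficients. -/
theorem pullForm_collarMap_eq (hτ : IsTubularMap n ι τ)
    (hφ : φ ∈ IsManifold.maximalAtlas (𝓡 (2 * n + 1)) ∞ Z)
    {e : OpenPartialHomeomorph X (Euc (2 * n + 2))} (he : IsAdaptedChart (Set.range ι) e)
    {a : Euc (2 * n + 2) → Euc (2 * n + 2) [⋀^Fin 2]→L[ℝ] ℝ} (ha : IsScRepr Ω e a)
    {q : ℝ × Euc (2 * n + 1)} (hq : q.2 ∈ φ.target) (hqe : collarMap τ φ q ∈ e.source)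
    (h0 : q.1 ≠ 0) (p p' : ℝ × Euc (2 * n + 1)) :
    pullForm (collarMap τ φ) Ω q ![p, p'] = a (e (collarMap τ φ q)) ![
      scLift (e (collarMap τ φ q)) (fderiv ℝ (fun q => e (collarMap τ φ q)) q p),
      scLift (e (collarMap τ φ q)) (fderiv ℝ (fun q => e (collarMap τ φ q)) q p')] := by
  have hG := (isLocalDiffeomorphAt_collarMap hτ hφ hq).mdifferentiableAt (by simp)
  have hne : e (collarMap τ φ q) 0 ≠ 0 := fun h =>
    h0 ((hτ.mem_range_iff _ _).1 ((he.2 _ hqe).2 h))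
  rw [pullForm_eq_inChart he.1 hqe hG, ← ha.eq_frame _ (e.map_source hqe) hne,
    scFrame_scLift hne, scFrame_scLift hne]
  refine apply_eq_of_forall_eq (f := inChart e Ω (e (collarMap τ φ q))) fun i => ?_
  fin_cases i <;> rfl

section Limits

variable (hτ : IsTubularMap n ι τ) (hφ : φ ∈ IsManifold.maximalAtlas (𝓡 (2 * n + 1)) ∞ Z)
    {e : OpenPartialHomeomorph X (Euc (2 * n + 2))} (he : IsAdaptedChart (Set.range ι) e)
    {a : Euc (2 * n + 2) → Euc (2 * n + 2) [⋀^Fin 2]→L[ℝ] ℝ} (ha : IsScRepr Ω e a)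
    {y : Euc (2 * n + 1)} (hy : y ∈ φ.target) (hye : ι (φ.symm y) ∈ e.source)
include hτ hφ he ha hy hye

omit he ha in
theorem eventually_collarMap_mem : ∀ᶠ q in 𝓝 ((0 : ℝ), y),
    q.2 ∈ φ.target ∧ collarMap τ φ q ∈ e.source := by
  have hG := (isLocalDiffeomorphAt_collarMap hτ hφ (q := (0, y)) hy).contMDiffAt.continuousAt
  refine Filter.Eventually.and (continuous_snd.continuousAt.eventually
    (φ.open_target.mem_nhds hy)) (hG.eventually (e.open_source.mem_nhds ?_))
  rwa [collarMap, hτ.zero_section]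

omit hτ hφ he hy in
theorem IsScRepr.continuousAt (hτ : IsTubularMap n ι τ) :
    ContinuousAt a (e (collarMap τ φ (0, y))) := by
  refine (ha.smooth.contDiffAt (e.open_target.mem_nhds (e.map_source ?_))).continuousAt
  rwa [collarMap, hτ.zero_section]

/-- Along slices the form grows like `1/t²`. -/
theorem tendsto_collar_slice (v w : Euc (2 * n + 1)) :
    Filter.Tendsto (fun q : ℝ × Euc (2 * n + 1) =>
      q.1 ^ 2 * pullForm (collarMap τ φ) Ω q ![(0, v), (0, w)]) (𝓝[{q | q.1 ≠ 0}] (0, y))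
      (𝓝 (a (e (collarMap τ φ (0, y))) ![collarLimit (fun q => e (collarMap τ φ q)) y v,
        collarLimit (fun q => e (collarMap τ φ q)) y w])) := by
  have hF := isCollarAt_collarMap hτ hφ he hy hye
  refine (hF.tendsto_slice_form (IsScRepr.continuousAt ha hye hτ) v w).congr' ?_
  filter_upwards [(eventually_collarMap_mem hτ hφ hy hye).filter_mono nhdsWithin_le_nhds,
    eventually_mem_nhdsWithin] with q hq hq0
  rw [pullForm_collarMap_eq hτ hφ he ha hq.1 hq.2 hq0]

/-- The contraction of the form with `∂_t` grows like `1/t³`. -/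
theorem tendsto_collar_normal (v : Euc (2 * n + 1)) :
    Filter.Tendsto (fun q : ℝ × Euc (2 * n + 1) =>
      q.1 ^ 3 * pullForm (collarMap τ φ) Ω q ![(0, v), (1, 0)]) (𝓝[{q | q.1 ≠ 0}] (0, y))
      (𝓝 (((fderiv ℝ (fun q => e (collarMap τ φ q)) (0, y) (1, 0) 0) ^ 2)⁻¹ *
        inducedForm a (fun y => e (collarMap τ φ (0, y))) y ![v])) := by
  have hF := isCollarAt_collarMap hτ hφ he hy hye
  have h1 : fderiv ℝ (fun y => e (collarMap τ φ (0, y))) y v =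
      fderiv ℝ (fun q => e (collarMap τ φ q)) (0, y) (0, v) :=
    congrArg (fun L => L v) (HasFDerivAt.comp (g := fun q => e (collarMap τ φ q)) y
      (hF.contDiffAt.differentiableAt (by simp)).hasFDerivAt
      (hasFDerivAt_prodMk_right (0 : ℝ) y)).fderiv
  rw [inducedForm_apply, h1]
  refine (hF.tendsto_normal_form (IsScRepr.continuousAt ha hye hτ) v).congr' ?_
  filter_upwards [(eventually_collarMap_mem hτ hφ hy hye).filter_mono nhdsWithin_le_nhds,
    eventually_mem_nhdsWithin] with q hq hq0
  rw [pullForm_collarMap_eq hτ hφ he ha hq.1 hq.2 hq0]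

end Limits

end CollarForms

/-! ### Comparison with the contact form -/

theorem neBot_nhdsWithin_fst_ne {E : Type*} [NormedAddCommGroup E] [NormedSpace ℝ E] (y : E) :
    (𝓝[{q : ℝ × E | q.1 ≠ 0}] ((0 : ℝ), y)).NeBot := by
  have h : Filter.Tendsto (fun t : ℝ => (t, y)) (𝓝[≠] 0) (𝓝[{q : ℝ × E | q.1 ≠ 0}] ((0 : ℝ), y)) := by
    refine tendsto_nhdsWithin_iff.2 ⟨?_, eventually_mem_nhdsWithin⟩
    exact ((by fun_prop : Continuous fun t : ℝ => (t, y)).tendsto 0).mono_left nhdsWithin_le_nhds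
  exact Filter.NeBot.of_map (h.neBot)

section LocalSlices

variable {n : ℕ}
  {Z : Type*} [TopologicalSpace Z] [ChartedSpace (Euc (2 * n + 1)) Z]
  {X : Type*} [TopologicalSpace X] [ChartedSpace (Euc (2 * n + 2)) X]
  {ι : Z → X} {τ : ℝ × Z → X} {φ : OpenPartialHomeomorph Z (Euc (2 * n + 1))}
  {Ω : DForm (2 * n + 2) X 2} {α : DForm (2 * n + 1) Z 1}

section Proportional

variable (hτ : IsTubularMap n ι τ) (hφ : φ ∈ IsManifold.maximalAtlas (𝓡 (2 * n + 1)) ∞ Z)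
    {e : OpenPartialHomeomorph X (Euc (2 * n + 2))} (he : IsAdaptedChart (Set.range ι) e)
    {a : Euc (2 * n + 2) → Euc (2 * n + 2) [⋀^Fin 2]→L[ℝ] ℝ} (ha : IsScRepr Ω e a)
    {y : Euc (2 * n + 1)} (hy : y ∈ φ.target) (hye : ι (φ.symm y) ∈ e.source)
include hτ hφ he ha hy hye

/-- The 1-forms induced on the hypersurface through two adapted charts are proportional: both are
multiples of the limit of `t³ Ω(·, ∂_t)`. -/
theorem inducedForm_proportional {e' : OpenPartialHomeomorph X (Euc (2 * n + 2))}
    (he' : IsAdaptedChart (Set.range ι) e')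
    {a' : Euc (2 * n + 2) → Euc (2 * n + 2) [⋀^Fin 2]→L[ℝ] ℝ} (ha' : IsScRepr Ω e' a')
    (hye' : ι (φ.symm y) ∈ e'.source) : ∃ l : ℝ, 0 < l ∧ ∀ v,
      inducedForm a (fun y => e (collarMap τ φ (0, y))) y ![v] =
        l * inducedForm a' (fun y => e' (collarMap τ φ (0, y))) y ![v] := by
  have hg := (isCollarAt_collarMap hτ hφ he hy hye).transverse
  have hg' := (isCollarAt_collarMap hτ hφ he' hy hye').transverse
  set g := fderiv ℝ (fun q => e (collarMap τ φ q)) (0, y) (1, 0) 0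
  set g' := fderiv ℝ (fun q => e' (collarMap τ φ q)) (0, y) (1, 0) 0
  have hnb := neBot_nhdsWithin_fst_ne y
  refine ⟨g ^ 2 * (g' ^ 2)⁻¹, by positivity, fun v => ?_⟩
  have h := tendsto_nhds_unique (tendsto_collar_normal hτ hφ he ha hy hye v)
    (tendsto_collar_normal hτ hφ he' ha' hy hye' v)
  change (g ^ 2)⁻¹ * _ = (g' ^ 2)⁻¹ * _ at h
  rw [mul_assoc, ← h, mul_inv_cancel_left₀ (pow_ne_zero 2 hg)]

/-- The induced 1-form is a positive multiple of the contact form, in the coordinates of `φ`. -/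
theorem inducedForm_eq_mul_contactForm (hα : InducesContact ι Ω α) : ∃ l : ℝ, 0 < l ∧ ∀ v,
      inducedForm a (fun y => e (collarMap τ φ (0, y))) y ![v] =
        l * pullForm φ.symm α y ![v] := by
  obtain ⟨e', a', hye', he', ha', c, hc, h⟩ := hα (φ.symm y)
  obtain ⟨l, hl, hl'⟩ := inducedForm_proportional hτ hφ he ha hy hye he' ha' hye'
  refine ⟨l * c, mul_pos hl hc, fun v => ?_⟩
  have hι : ContMDiff (𝓡 (2 * n + 1)) (𝓡 (2 * n + 2)) ∞ ι := by
    have := hτ.contMDiff_slice 0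
    rwa [funext fun z => hτ.zero_section z] at this
  have h1 : MDifferentiableAt (𝓡 (2 * n + 1)) (𝓡 (2 * n + 2)) (fun z' => e' (ι z')) (φ.symm y) :=
    MDifferentiableAt.comp (g := e') _
      ((mdifferentiable_of_mem_maximalAtlas he'.1).mdifferentiableAt hye')
      (hι.mdifferentiable (by simp) _)
  have h3 : (fun z' => e' (ι z')) ∘ φ.symm = fun y => e' (collarMap τ φ (0, y)) := by
    funext y'
    simp [collarMap, hτ.zero_section]
  have h4 : fderiv ℝ (fun y => e' (collarMap τ φ (0, y))) y v =
      mfderiv (𝓡 (2 * n + 1)) (𝓡 (2 * n + 2)) (fun z' => e' (ι z')) (φ.symm y)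
        (mfderiv (𝓡 (2 * n + 1)) (𝓡 (2 * n + 1)) φ.symm y v) := by
    rw [← h3, ← mfderiv_eq_fderiv]
    exact congrArg (fun L => L v) (mfderiv_comp y (g := fun z' => e' (ι z')) h1
      ((mdifferentiable_of_mem_maximalAtlas hφ).mdifferentiableAt_symm hy))
  rw [hl', inducedForm_apply, h4, mul_assoc]
  congr 1
  have h5 := h (mfderiv (𝓡 (2 * n + 1)) (𝓡 (2 * n + 1)) φ.symm y v)
  have h6 : e' (collarMap τ φ (0, y)) = e' (ι (φ.symm y)) := congrArg e' (hτ.zero_section _)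
  rw [h6]
  refine h5.trans ?_
  congr 1
  refine apply_eq_of_forall_eq (f := α (φ.symm y)) fun i => ?_
  fin_cases i
  rfl

end Proportional

/-- The limiting slice form is linear in both arguments. -/
theorem IsCollarAt.exists_collarLimit_linear {E : Type*} [NormedAddCommGroup E] [NormedSpace ℝ E]
    {F : ℝ × E → Euc (2 * n + 2)} {y : E} (hF : IsCollarAt F y) :
    ∃ S : E →ₗ[ℝ] Euc (2 * n + 2), ∀ v, S v = collarLimit F y v := by
  have hD : DifferentiableAt ℝ (fderiv ℝ F) (0, y) :=
    (hF.contDiffAt.fderiv_right (m := ∞) (by simp)).differentiableAt (by simp)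
  have h : ∀ p, fderiv ℝ (fun q => fderiv ℝ F q p 0) (0, y) (1, 0) =
      fderiv ℝ (fderiv ℝ F) (0, y) (1, 0) p 0 := by
    intro p
    have h1 := ((EuclideanSpace.proj (𝕜 := ℝ) (0 : Fin (2 * n + 2))).hasFDerivAt
      (x := fderiv ℝ F (0, y) p)).comp (0, y)
      (hD.hasFDerivAt.clm_apply (hasFDerivAt_const p ((0 : ℝ), y)))
    have h2 : fderiv ℝ (fun q => fderiv ℝ F q p 0) (0, y) = _ := h1.fderiv
    rw [h2]
    simp
  refine ⟨{ toFun := collarLimit F y, map_add' := fun v w => ?_, map_smul' := fun c v => ?_ },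
    fun v => rfl⟩
  · have e : ((0 : ℝ), v + w) = (0, v) + (0, w) := by simp
    simp only [collarLimit, h]
    rw [e, map_add, map_add, PiLp.add_apply, add_div, add_smul, smul_add]
    abel
  · have e : ((0 : ℝ), c • v) = c • ((0 : ℝ), v) := by simp
    simp only [collarLimit, h]
    rw [e, map_smul, map_smul, PiLp.smul_apply, RingHom.id_apply, smul_add, smul_smul, smul_smul,
      smul_smul, smul_eq_mul]
    congr 2
    · ring
    · ring

end LocalSlices

/-! ### Slices close to the hypersurface -/

section LocalSlices

variable {n : ℕ}
  {Z : Type*} [TopologicalSpace Z] [ChartedSpace (Euc (2 * n + 1)) Z]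
  {X : Type*} [TopologicalSpace X] [ChartedSpace (Euc (2 * n + 2)) X]
  {ι : Z → X} {τ : ℝ × Z → X} {φ : OpenPartialHomeomorph Z (Euc (2 * n + 1))}
  {Ω : DForm (2 * n + 2) X 2} {α : DForm (2 * n + 1) Z 1}

theorem contMDiffAt_chart_symm {d : ℕ} {M : Type*} [TopologicalSpace M]
    [ChartedSpace (Euc d) M] {φ : OpenPartialHomeomorph M (Euc d)}
    (hφ : φ ∈ IsManifold.maximalAtlas (𝓡 d) ∞ M) {y : Euc d} (hy : y ∈ φ.target) :
    ContMDiffAt 𝓘(ℝ, Euc d) (𝓡 d) ∞ φ.symm y :=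
  (contMDiffOn_symm_of_mem_maximalAtlas hφ).contMDiffAt (φ.open_target.mem_nhds hy)

variable [IsManifold (𝓡 (2 * n + 1)) ∞ Z] [IsManifold (𝓡 (2 * n + 2)) ∞ X]

omit [TopologicalSpace Z] [ChartedSpace (Euc (2 * n + 1)) Z] [IsManifold (𝓡 (2 * n + 1)) ∞ Z] in
theorem IsAdaptedChart.smooth_closed {S : Set X} (hΩ : IsSymplecticOn Ω Sᶜ)
    {e : OpenPartialHomeomorph X (Euc (2 * n + 2))} (he : IsAdaptedChart S e)
    {u : Euc (2 * n + 2)} (hu : u ∈ e.target) (hu0 : u 0 ≠ 0) :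
    DifferentiableAt ℝ (inChart e Ω) u ∧ extDeriv (inChart e Ω) u = 0 := by
  obtain ⟨V, hV, hSV, hs⟩ := hΩ.smooth
  have hmem : e.symm u ∈ Sᶜ := fun h => hu0 <| by
    have := (he.2 _ (e.map_target hu)).1 h
    rwa [e.right_inv hu] at this
  have hVn := hV.mem_nhds (hSV hmem)
  have hsm := contMDiffAt_chart_symm he.1 hu
  refine ⟨(contDiffAt_pullForm hs hVn hsm).differentiableAt (by simp), ?_⟩
  rw [inChart_eq_pullForm, extDeriv_pullForm hs hVn hsm]
  ext v
  change extD Ω (e.symm u) _ = 0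
  rw [hΩ.closed _ hmem]
  rfl

/-- On the contact hyperplanes the limiting slice form is a positive multiple of `dα`. -/
theorem collarLimit_form_eq (hα : SmoothFormOn α Set.univ) (hi : InducesContact ι Ω α)
    (hΩ : IsSymplecticOn Ω (Set.range ι)ᶜ) (hτ : IsTubularMap n ι τ)
    (hφ : φ ∈ IsManifold.maximalAtlas (𝓡 (2 * n + 1)) ∞ Z)
    {e : OpenPartialHomeomorph X (Euc (2 * n + 2))} (he : IsAdaptedChart (Set.range ι) e)
    {a : Euc (2 * n + 2) → Euc (2 * n + 2) [⋀^Fin 2]→L[ℝ] ℝ} (ha : IsScRepr Ω e a)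
    {y : Euc (2 * n + 1)} (hy : y ∈ φ.target) (hye : ι (φ.symm y) ∈ e.source)
    {v₀ : Euc (2 * n + 1)} (hv₀ : pullForm φ.symm α y ![v₀] ≠ 0) :
    ∃ l : ℝ, 0 < l ∧
      (∀ v, inducedForm a (fun y => e (collarMap τ φ (0, y))) y ![v] =
        l * pullForm φ.symm α y ![v]) ∧
      ∀ v w, pullForm φ.symm α y ![v] = 0 → pullForm φ.symm α y ![w] = 0 →
        a (e (collarMap τ φ (0, y))) ![collarLimit (fun q => e (collarMap τ φ q)) y v,
          collarLimit (fun q => e (collarMap τ φ q)) y w] =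
        ((fderiv ℝ (fun q => e (collarMap τ φ q)) (0, y) (1, 0) 0) ^ 2)⁻¹ * (l / 2) *
          extDeriv (pullForm φ.symm α) y ![v, w] := by
  obtain ⟨l, hl, hl'⟩ := inducedForm_eq_mul_contactForm hτ hφ he ha hy hye hi
  refine ⟨l, hl, hl', fun v w hv hw => ?_⟩
  have hF := isCollarAt_collarMap hτ hφ he hy hye
  have hin : Continuous fun y : Euc (2 * n + 1) => ((0 : ℝ), y) := by fun_prop
  have hk : ContDiffAt ℝ ∞ (fun y => e (collarMap τ φ (0, y))) y :=
    ContDiffAt.comp (f := fun y : Euc (2 * n + 1) => ((0 : ℝ), y))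
      (g := fun q => e (collarMap τ φ q)) y hF.contDiffAt
      (contDiff_const.prodMk contDiff_id).contDiffAt
  have hmem := (hin.tendsto y).eventually (eventually_collarMap_mem hτ hφ hy hye)
  have hky : e (collarMap τ φ (0, y)) ∈ e.target := e.map_source hmem.self_of_nhds.2
  have hDk : ∀ v, fderiv ℝ (fun y => e (collarMap τ φ (0, y))) y v =
      fderiv ℝ (fun q => e (collarMap τ φ q)) (0, y) (0, v) := fun v =>
    congrArg (fun L => L v) (HasFDerivAt.comp (g := fun q => e (collarMap τ φ q)) y
      (hF.contDiffAt.differentiableAt (by simp)).hasFDerivAt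
      (hasFDerivAt_prodMk_right (0 : ℝ) y)).fderiv
  have h1 := extDeriv_inducedForm e.open_target ha.smooth ha.eq_frame
    (fun u hu hu0 => (he.smooth_closed hΩ hu hu0).1)
    (fun u hu hu0 => (he.smooth_closed hΩ hu hu0).2) hk hky hF.zero v w
  have h2 := extDeriv_eq_of_proportional
    ((contDiffAt_inducedForm e.open_target ha.smooth hk hky).differentiableAt (by simp))
    ((contDiffAt_pullForm hα Filter.univ_mem
      (contMDiffAt_chart_symm hφ hy)).differentiableAt (by simp))
    (by
      filter_upwards [hmem] with y' hy'
      have hye' : ι (φ.symm y') ∈ e.source := by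
        have := hy'.2
        rwa [collarMap, hτ.zero_section] at this
      obtain ⟨l', -, h⟩ := inducedForm_eq_mul_contactForm hτ hφ he ha hy'.1 hye' hi
      exact ⟨l', h⟩)
    hl' hv₀ hv hw
  have hker : ∀ v, pullForm φ.symm α y ![v] = 0 → a (e (collarMap τ φ (0, y))) ![
      fderiv ℝ (fun q => e (collarMap τ φ q)) (0, y) (0, v), EuclideanSpace.single 0 1] = 0 := by
    intro v hv
    rw [← hDk, ← inducedForm_apply a (fun y => e (collarMap τ φ (0, y))), hl', hv, mul_zero]
  rw [IsCollarAt.collarLimit_form_of_ker _ (hker v hv) (hker w hw), mul_assoc]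
  congr 1
  rw [hDk, hDk] at h1
  linarith

omit [IsManifold (𝓡 (2 * n + 2)) ∞ X] in
theorem pullForm_chart_symm_extD (hα : SmoothFormOn α Set.univ)
    (hφ : φ ∈ IsManifold.maximalAtlas (𝓡 (2 * n + 1)) ∞ Z) {y : Euc (2 * n + 1)}
    (hy : y ∈ φ.target) (v w : Euc (2 * n + 1)) :
    extD α (φ.symm y) ![mfderiv (𝓡 (2 * n + 1)) (𝓡 (2 * n + 1)) φ.symm y v,
      mfderiv (𝓡 (2 * n + 1)) (𝓡 (2 * n + 1)) φ.symm y w] =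
    extDeriv (pullForm φ.symm α) y ![v, w] := by
  rw [extDeriv_pullForm hα Filter.univ_mem (contMDiffAt_chart_symm hφ hy)]
  refine apply_eq_of_forall_eq (f := extD α (φ.symm y)) fun i => ?_
  fin_cases i <;> rfl

omit [IsManifold (𝓡 (2 * n + 1)) ∞ Z] in
theorem pullForm_chart_symm_apply {y : Euc (2 * n + 1)} (v : Euc (2 * n + 1)) :
    α (φ.symm y) ![mfderiv (𝓡 (2 * n + 1)) (𝓡 (2 * n + 1)) φ.symm y v] =
    pullForm φ.symm α y ![v] := by
  refine apply_eq_of_forall_eq (f := α (φ.symm y)) fun i => ?_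
  fin_cases i
  rfl

/-- Slices close to the hypersurface satisfy the boundary conditions of a weak filling: on
`ker α` the rescaled form `t² Ω` tends to a positive multiple of `dα`, while `t³ Ω(·, ∂_t)` tends to
a positive multiple of `α`. -/
theorem eventually_isWeakSlice (hα : IsContactForm α) (hΩ : IsScatteringFilling ι Ω α)
    (hτ : IsTubularMap n ι τ) (z₀ : Z) :
    ∀ᶠ p : ℝ × Z in 𝓝 ((0 : ℝ), z₀), p.1 ≠ 0 → IsWeakSlice Ω α τ p.1 p.2 := by
  set φ := chartAt (Euc (2 * n + 1)) z₀ with hφdef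
  have hφ := IsManifold.chart_mem_maximalAtlas (I := 𝓡 (2 * n + 1)) (n := ∞) z₀
  rw [← hφdef] at hφ
  set y₀ := φ z₀ with hy₀def
  have hz₀ : z₀ ∈ φ.source := mem_chart_source _ z₀
  have hy₀ : y₀ ∈ φ.target := φ.map_source hz₀
  have hz₀' : φ.symm y₀ = z₀ := φ.left_inv hz₀
  obtain ⟨e, a, hze, he, ha, -⟩ := hΩ.induces z₀
  have hye : ι (φ.symm y₀) ∈ e.source := by rwa [hz₀']
  -- a tuple of tangent vectors on which the contact volume does not vanish
  obtain ⟨b, hb⟩ : ∃ b : Fin (2 * n + 1) → Euc (2 * n + 1),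
      contactVol n (fun v => pullForm φ.symm α y₀ ![v])
        (fun v w => extDeriv (pullForm φ.symm α) y₀ ![v, w]) b ≠ 0 := by
    obtain ⟨v', hv'⟩ := hα.contact (φ.symm y₀)
    have hsurj := (mdifferentiable_of_mem_maximalAtlas hφ).symm.mfderiv_surjective hy₀
    choose b hb using fun i => hsurj (v' i)
    refine ⟨b, ?_⟩
    have h : (fun i => mfderiv (𝓡 (2 * n + 1)) (𝓡 (2 * n + 1)) φ.symm y₀ (b i)) = v' := funext hb
    rw [← h] at hv'
    simp only [← pullForm_chart_symm_apply, ← pullForm_chart_symm_extD hα.smooth hφ hy₀]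
    exact hv'
  obtain ⟨v₀, hv₀⟩ : ∃ v₀, pullForm φ.symm α y₀ ![v₀] ≠ 0 := by
    by_contra! h
    refine hb ?_
    simp [contactVol, h]
  obtain ⟨l, hl, hθ, hσ⟩ := collarLimit_form_eq hα.smooth hΩ.induces hΩ.scattering.symplectic hτ
    hφ he ha hy₀ hye hv₀
  have hF := isCollarAt_collarMap hτ hφ he hy₀ hye
  obtain ⟨S, hS⟩ := hF.exists_collarLimit_linear
  set g := fderiv ℝ (fun q => e (collarMap τ φ q)) (0, y₀) (1, 0) 0 with hg
  have hg0 : g ≠ 0 := hF.transverse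
  set κ : ℝ := (g ^ 2)⁻¹ * (l / 2) with hκ
  have hκ0 : 0 < κ := by positivity
  set A₀ := formLin (pullForm φ.symm α y₀)
  set D₀ := formBilin (extDeriv (pullForm φ.symm α) y₀)
  set σ : Euc (2 * n + 1) →ₗ[ℝ] Euc (2 * n + 1) →ₗ[ℝ] ℝ :=
    (formBilin (a (e (collarMap τ φ (0, y₀))))).compl₁₂ S S with hσdef
  have hσskew : ∀ v w, σ v w = -σ w v := fun v w => form_skew _ _ _
  have hDskew : ∀ v w, D₀ v w = -D₀ w v :=
    fun v w => form_skew (extDeriv (pullForm φ.symm α) y₀) v w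
  have hσker : ∀ v w, A₀ v = 0 → A₀ w = 0 → σ v w = κ * D₀ v w := by
    intro v w hv hw
    have := hσ v w hv hw
    rw [← hS, ← hS] at this
    exact this
  have hfr : Module.finrank ℝ (Euc (2 * n + 1)) = 2 * n + 1 := by simp
  -- the limits of the data as `(t, y) → (0, y₀)`
  set N := 𝓝[{q : ℝ × Euc (2 * n + 1) | q.1 ≠ 0}] ((0 : ℝ), y₀) with hN
  have hαc : ContDiffAt ℝ ∞ (pullForm φ.symm α) y₀ :=
    contDiffAt_pullForm hα.smooth Filter.univ_mem (contMDiffAt_chart_symm hφ hy₀)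
  have hsnd : Filter.Tendsto (fun q : ℝ × Euc (2 * n + 1) => q.2) N (𝓝 y₀) :=
    (continuous_snd.tendsto ((0 : ℝ), y₀)).mono_left nhdsWithin_le_nhds
  have hA : ∀ v, Filter.Tendsto (fun q : ℝ × Euc (2 * n + 1) => pullForm φ.symm α q.2 ![v]) N
      (𝓝 (A₀ v)) := fun v =>
    (((ContinuousAlternatingMap.apply ℝ (Euc (2 * n + 1)) ℝ ![v]).continuous.continuousAt.comp
      hαc.continuousAt).tendsto).comp hsnd
  have hextc : ContinuousAt (extDeriv (pullForm φ.symm α)) y₀ := by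
    have h1 : ContDiffAt ℝ 0 (fderiv ℝ (pullForm φ.symm α)) y₀ := hαc.fderiv_right (by simp)
    exact (ContinuousAlternatingMap.alternatizeUncurryFinCLM ℝ (Euc (2 * n + 1)) ℝ).continuous.continuousAt.comp
      h1.continuousAt
  have hD : ∀ v w, Filter.Tendsto (fun q : ℝ × Euc (2 * n + 1) =>
      extDeriv (pullForm φ.symm α) q.2 ![v, w]) N (𝓝 (D₀ v w)) := fun v w =>
    (((ContinuousAlternatingMap.apply ℝ (Euc (2 * n + 1)) ℝ ![v, w]).continuous.continuousAt.comp
      hextc).tendsto).comp hsnd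
  have hB : ∀ v w, Filter.Tendsto (fun q : ℝ × Euc (2 * n + 1) =>
      q.1 ^ 2 * pullForm (collarMap τ φ) Ω q ![(0, v), (0, w)]) N (𝓝 (σ v w)) := by
    intro v w
    have := tendsto_collar_slice hτ hφ he ha hy₀ hye v w
    rw [← hS, ← hS] at this
    exact this
  have hC : ∀ v, Filter.Tendsto (fun q : ℝ × Euc (2 * n + 1) =>
      q.1 ^ 3 * pullForm (collarMap τ φ) Ω q ![(0, v), (1, 0)]) N (𝓝 ((g ^ 2)⁻¹ * l * A₀ v)) := by
    intro v
    have := tendsto_collar_normal hτ hφ he ha hy₀ hye v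
    rw [hθ, ← mul_assoc] at this
    exact this
  -- by compactness of `[0, 1]`, nonvanishing in the limit for each weight is uniform in the weight
  set Q₁ : ℝ × Euc (2 * n + 1) → ℝ → ℝ := fun q μ =>
    contactVol n (fun v => pullForm φ.symm α q.2 ![v]) (fun v w =>
      μ * (q.1 ^ 2 * pullForm (collarMap τ φ) Ω q ![(0, v), (0, w)]) +
        (1 - μ) * extDeriv (pullForm φ.symm α) q.2 ![v, w]) b with hQ₁
  have h1 : ∀ᶠ q in 𝓝 ((0 : ℝ), y₀), ∀ μ ∈ Set.Icc (0 : ℝ) 1, q.1 ≠ 0 → Q₁ q μ ≠ 0 := by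
    refine isCompact_Icc.eventually_forall_of_forall_eventually fun μ₀ hμ₀ => ?_
    have hlim : Filter.Tendsto (fun p : (ℝ × Euc (2 * n + 1)) × ℝ => Q₁ p.1 p.2) (N ×ˢ 𝓝 μ₀)
        (𝓝 (contactVol n A₀ (fun v w => (μ₀ • σ + (1 - μ₀) • D₀) v w) b)) := by
      refine tendsto_contactVol n b (fun i => (hA _).comp Filter.tendsto_fst) fun i j => ?_
      have hμ : Filter.Tendsto (fun p : (ℝ × Euc (2 * n + 1)) × ℝ => p.2) (N ×ˢ 𝓝 μ₀) (𝓝 μ₀) :=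
        Filter.tendsto_snd
      exact (hμ.mul ((hB _ _).comp Filter.tendsto_fst)).add
        ((tendsto_const_nhds.sub hμ).mul ((hD _ _).comp Filter.tendsto_fst))
    rw [contactVol_eq_of_ker n hfr A₀ D₀ (μ₀ • σ + (1 - μ₀) • D₀) hDskew
      (fun v w => by simp [hσskew v w, hDskew v w]; ring) (μ₀ * κ + (1 - μ₀))
      (fun v w hv hw => by simp [hσker v w hv hw]; ring)] at hlim
    have hpos : 0 < μ₀ * κ + (1 - μ₀) := by
      rcases hμ₀.1.eq_or_lt with h | h
      · rw [← h]
        norm_num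
      · have := mul_pos h hκ0
        linarith [hμ₀.2]
    have h2 := hlim.eventually_ne (mul_ne_zero (pow_ne_zero n hpos.ne') hb)
    have h3 : N ×ˢ 𝓝 μ₀ = 𝓝[{p : (ℝ × Euc (2 * n + 1)) × ℝ | p.1.1 ≠ 0}] (((0 : ℝ), y₀), μ₀) := by
      rw [hN, ← nhdsWithin_univ μ₀, ← nhdsWithin_prod_eq]
      congr 1
      ext p
      simp
    rw [h3, eventually_nhdsWithin_iff] at h2
    exact h2
  -- the limit of this product is a positive multiple of the square of `α ∧ (dα)^n`
  have h2 : ∀ᶠ q in N, 0 < contactVol n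
      (fun v => q.1 ^ 3 * pullForm (collarMap τ φ) Ω q ![(0, v), (1, 0)])
      (fun v w => q.1 ^ 2 * pullForm (collarMap τ φ) Ω q ![(0, v), (0, w)]) b *
      contactVol n (fun v => pullForm φ.symm α q.2 ![v])
        (fun v w => extDeriv (pullForm φ.symm α) q.2 ![v, w]) b := by
    have hlim := (tendsto_contactVol n b (a := fun q : ℝ × Euc (2 * n + 1) => fun v =>
        q.1 ^ 3 * pullForm (collarMap τ φ) Ω q ![(0, v), (1, 0)])
      (B := fun q v w => q.1 ^ 2 * pullForm (collarMap τ φ) Ω q ![(0, v), (0, w)])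
      (a₀ := fun v => (g ^ 2)⁻¹ * l * A₀ v) (B₀ := fun v w => 1 * σ v w)
      (fun i => hC _) fun i j => by rw [one_mul]; exact hB _ _).mul
      (tendsto_contactVol n b (a := fun q : ℝ × Euc (2 * n + 1) => fun v =>
        pullForm φ.symm α q.2 ![v])
        (B := fun q v w => extDeriv (pullForm φ.symm α) q.2 ![v, w]) (a₀ := A₀)
        (B₀ := fun v w => D₀ v w) (fun i => hA _) fun i j => hD _ _)
    refine hlim.eventually_const_lt ?_
    rw [contactVol_smul, contactVol_eq_of_ker n hfr A₀ D₀ σ hDskew hσskew κ hσker]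
    have hb' : contactVol n A₀ (fun v w => D₀ v w) b ≠ 0 := hb
    have : 0 < (g ^ 2)⁻¹ * l * 1 ^ n * κ ^ n * contactVol n A₀ (fun v w => D₀ v w) b ^ 2 := by
      positivity
    linarith
  rw [hN, eventually_nhdsWithin_iff] at h2
  have h3 : ∀ᶠ q in 𝓝 ((0 : ℝ), y₀), q.1 ≠ 0 → IsWeakSlice Ω α τ q.1 (φ.symm q.2) := by
    filter_upwards [h1, h2, continuous_snd.continuousAt.eventually
      (φ.open_target.mem_nhds hy₀)] with q hq1 hq2 hqφ hq0
    refine isWeakSlice_of_contactVol hq0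
      (fun i => mfderiv (𝓡 (2 * n + 1)) (𝓡 (2 * n + 1)) φ.symm q.2 (b i)) (fun μ hμ => ?_) ?_
    · have := hq1 μ hμ hq0
      simp only [hQ₁, ← pullForm_chart_symm_apply, ← pullForm_chart_symm_extD hα.smooth hφ hqφ,
        pullForm_collarMap_slice hτ hφ hqφ] at this
      exact this
    · have := hq2 hq0
      simp only [← pullForm_chart_symm_apply, ← pullForm_chart_symm_extD hα.smooth hφ hqφ,
        pullForm_collarMap_slice hτ hφ hqφ, pullForm_collarMap_normal hτ hφ hqφ] at this
      exact this
  have h4 : Filter.Tendsto (fun p : ℝ × Z => (p.1, φ p.2)) (𝓝 ((0 : ℝ), z₀)) (𝓝 ((0 : ℝ), y₀)) := by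
    have : ContinuousAt (fun p : ℝ × Z => (p.1, φ p.2)) ((0 : ℝ), z₀) :=
      continuousAt_fst.prodMk ((φ.continuousAt hz₀).comp (f := Prod.snd) continuousAt_snd)
    exact this
  filter_upwards [h4.eventually h3, continuous_snd.continuousAt.eventually
      (φ.open_source.mem_nhds hz₀)] with p hp hpφ hp0
  have := hp hp0
  rwa [φ.left_inv hpφ] at this

end LocalSlices

/-! ### Orientations on the two sides of the hypersurface -/

/-- All nonzero top degree forms vanish on the same tuples, the linearly dependent ones. -/
theorem top_ne_zero_of_top_ne_zero {V : Type*} [AddCommGroup V] [Module ℝ V]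
    [FiniteDimensional ℝ V] {m : ℕ} (hV : Module.finrank ℝ V = m)
    {T₁ T₂ : V [⋀^Fin m]→ₗ[ℝ] ℝ} {b : Fin m → V} (hb : T₁ b ≠ 0) (hT : T₂ ≠ 0) : T₂ b ≠ 0 := by
  obtain ⟨u, hu⟩ : ∃ u, T₂ u ≠ 0 := by
    by_contra! h
    exact hT (AlternatingMap.ext h)
  intro h
  have hli : LinearIndependent ℝ b := by
    by_contra h
    exact hb (T₁.map_linearDependent b h)
  have hE : Nonempty (Module.Basis (Fin m) ℝ V) := ⟨Module.finBasisOfFinrankEq ℝ V hV⟩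
  set e := basisOfLinearIndependentOfCardEqFinrank' b hli (by simp [hV]) with he
  have heb : (e : Fin m → V) = b := by simp [he]
  rw [T₂.eq_smul_basis_det e, heb, h, zero_smul] at hu
  exact hu rfl

theorem tendsto_symplVol {V β : Type*} {l : Filter β} (n : ℕ)
    {B : β → V → V → ℝ} {B₀ : V → V → ℝ} (v : Fin (2 * n + 2) → V)
    (hB : ∀ i j, Filter.Tendsto (fun x => B x (v i) (v j)) l (𝓝 (B₀ (v i) (v j)))) :
    Filter.Tendsto (fun x => symplVol n (B x) v) l (𝓝 (symplVol n B₀ v)) :=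
  tendsto_finsetSum _ fun _ _ =>
    Filter.Tendsto.const_mul _ (tendsto_finsetProd _ fun _ _ => hB _ _)

theorem pullForm_pair {d : ℕ} {M : Type*} [TopologicalSpace M] [ChartedSpace (Euc d) M]
    {E : Type*} [NormedAddCommGroup E] [NormedSpace ℝ E] (f : E → M) (Ω : DForm d M 2) (q v w : E) :
    pullForm f Ω q ![v, w] =
      Ω (f q) ![mfderiv 𝓘(ℝ, E) (𝓡 d) f q v, mfderiv 𝓘(ℝ, E) (𝓡 d) f q w] := by
  refine apply_eq_of_forall_eq (f := Ω (f q)) fun i => ?_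
  fin_cases i <;> rfl

section Orientation

variable {n : ℕ} {X : Type*} [TopologicalSpace X] [ChartedSpace (Euc (2 * n + 2)) X]

/-- The set of points where the orientations given by `Ω^(n+1)` and `μ` agree. -/
def agreeSet (Ω : DForm (2 * n + 2) X 2) (μ : DForm (2 * n + 2) X (2 * n + 2)) : Set X :=
  {p | ∃ v, 0 < symplVol n (fun a b => Ω p ![a, b]) v * μ p v}

variable {Ω : DForm (2 * n + 2) X 2} {μ : DForm (2 * n + 2) X (2 * n + 2)}

theorem symplVol_pullForm {E : Type*} [NormedAddCommGroup E] [NormedSpace ℝ E] (f : E → X)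
    (Ω : DForm (2 * n + 2) X 2) (q : E) (b : Fin (2 * n + 2) → E) :
    symplVol n (fun v w => pullForm f Ω q ![v, w]) b = symplVol n (fun v w => Ω (f q) ![v, w])
      fun i => mfderiv 𝓘(ℝ, E) (𝓡 (2 * n + 2)) f q (b i) := by
  rw [symplVol, symplVol]
  simp only [pullForm_pair]

theorem mem_agreeSet_iff {p : X} :
    p ∈ agreeSet Ω μ ↔ ∃ v, 0 < symplVol n (fun a b => Ω p ![a, b]) v * μ p v := Iff.rfl

theorem mem_agreeSet_of_pullForm {E : Type*} [NormedAddCommGroup E] [NormedSpace ℝ E] {f : E → X}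
    {q : E} {b : Fin (2 * n + 2) → E}
    (h : 0 < symplVol n (fun v w => pullForm f Ω q ![v, w]) b * pullForm f μ q b) :
    f q ∈ agreeSet Ω μ := by
  rw [symplVol_pullForm] at h
  rw [mem_agreeSet_iff]
  exact ⟨fun i => mfderiv 𝓘(ℝ, E) (𝓡 (2 * n + 2)) f q (b i), h⟩

theorem SmoothFormOn.neg {d k : ℕ} {M : Type*} [TopologicalSpace M] [ChartedSpace (Euc d) M]
    {μ : DForm d M k} {S : Set M} (hμ : SmoothFormOn μ S) :
    SmoothFormOn (fun p => -μ p) S := fun e he => (hμ e he).neg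

theorem symplVolAlt_form (p : X) (v : Fin (2 * n + 2) → TangentSpace (𝓡 (2 * n + 2)) p) :
    symplVolAlt n (formBilin (Ω p)) v = symplVol n (fun a b => Ω p ![a, b]) v :=
  symplVolAlt_apply n _ _

theorem finrank_tangentSpace (d : ℕ) {M : Type*} [TopologicalSpace M] [ChartedSpace (Euc d) M]
    (p : M) : Module.finrank ℝ (TangentSpace (𝓡 d) p) = d := by
  change Module.finrank ℝ (Euc d) = _
  simp

instance finiteDimensional_tangentSpace (d : ℕ) {M : Type*} [TopologicalSpace M]
    [ChartedSpace (Euc d) M] (p : M) : FiniteDimensional ℝ (TangentSpace (𝓡 d) p) :=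
  inferInstanceAs (FiniteDimensional ℝ (Euc d))

/-- Two top degree forms cannot agree and disagree in sign on different bases. -/
theorem disjoint_agreeSet_neg : Disjoint (agreeSet Ω μ) (agreeSet Ω fun p => -μ p) := by
  rw [Set.disjoint_left]
  rintro p ⟨v, hv⟩ ⟨u, hu⟩
  change 0 < symplVol n (fun a b => Ω p ![a, b]) u * -(μ p u) at hu
  have hu' : μ p u ≠ 0 := by
    rintro h
    simp [h] at hu
  have := mul_pos_of_mul_pos_of_top (finrank_tangentSpace _ p) (symplVolAlt n (formBilin (Ω p)))
    (μ p).toAlternatingMap (b := v) (u := u) (by rw [symplVolAlt_form]; exact hv) hu'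
  rw [symplVolAlt_form] at this
  change 0 < symplVol n (fun a b => Ω p ![a, b]) u * μ p u at this
  linarith

theorem mem_agreeSet_or_neg {p : X} (hp : NondegOn Set.univ fun v w => Ω p ![v, w])
    (hμ : μ p ≠ 0) : p ∈ agreeSet Ω μ ∪ agreeSet Ω fun p => -μ p := by
  obtain ⟨v, hv⟩ := exists_symplVol_ne_zero n (finrank_tangentSpace (2 * n + 2) p)
    (formBilin (Ω p)) (fun v w => form_skew (Ω p) v w)
    (fun v h => hp v trivial fun w _ => h w)
  have hμ' : (μ p).toAlternatingMap ≠ 0 := fun h => hμ <| by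
    ext u
    exact congrArg (fun T => T u) h
  have h2 : μ p v ≠ 0 := top_ne_zero_of_top_ne_zero (finrank_tangentSpace _ p)
    (T₁ := symplVolAlt n (formBilin (Ω p))) (by rw [symplVolAlt_apply]; exact hv) hμ'
  rcases lt_or_gt_of_ne (mul_ne_zero hv h2) with h | h
  · right
    refine ⟨v, ?_⟩
    change 0 < symplVol n (fun a b => Ω p ![a, b]) v * -(μ p v)
    rw [mul_neg]
    exact neg_pos.2 h
  · exact Or.inl ⟨v, h⟩

variable [IsManifold (𝓡 (2 * n + 2)) ∞ X]

theorem agreeSet_mem_nhds {V : Set X} (hΩ : SmoothFormOn Ω V) (hμ : SmoothFormOn μ Set.univ)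
    {p : X} (hV : V ∈ 𝓝 p) (hp : p ∈ agreeSet Ω μ) : agreeSet Ω μ ∈ 𝓝 p := by
  obtain ⟨φ, hφ, hps⟩ : ∃ φ ∈ IsManifold.maximalAtlas (𝓡 (2 * n + 2)) ∞ X, p ∈ φ.source :=
    ⟨_, IsManifold.chart_mem_maximalAtlas p, mem_chart_source _ p⟩
  obtain ⟨y, hy, rfl⟩ : ∃ y ∈ φ.target, φ.symm y = p := ⟨φ p, φ.map_source hps, φ.left_inv hps⟩
  obtain ⟨v, hv⟩ := hp
  have hsurj := (mdifferentiable_of_mem_maximalAtlas hφ).symm.mfderiv_surjective hy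
  obtain ⟨b, hb⟩ : ∃ b : Fin (2 * n + 2) → Euc (2 * n + 2), ∀ i,
      mfderiv (𝓡 (2 * n + 2)) (𝓡 (2 * n + 2)) φ.symm y (b i) = v i :=
    ⟨fun i => (hsurj (v i)).choose, fun i => (hsurj (v i)).choose_spec⟩
  have hsm := contMDiffAt_chart_symm hφ hy
  have hΩc := (contDiffAt_pullForm hΩ hV hsm).continuousAt
  have hμc := (contDiffAt_pullForm hμ Filter.univ_mem hsm).continuousAt
  have hlim : Filter.Tendsto (fun y => symplVol n (fun a b => pullForm φ.symm Ω y ![a, b]) b *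
      pullForm φ.symm μ y b) (𝓝 y) (𝓝 (symplVol n (fun a b =>
        pullForm φ.symm Ω y ![a, b]) b * pullForm φ.symm μ y b)) := by
    refine Filter.Tendsto.mul (tendsto_symplVol n b fun i j => ?_) ?_
    · exact ((ContinuousAlternatingMap.apply ℝ (Euc (2 * n + 2)) ℝ
        ![b i, b j]).continuous.continuousAt.comp hΩc).tendsto
    · exact ((ContinuousAlternatingMap.apply ℝ (Euc (2 * n + 2)) ℝ
        b).continuous.continuousAt.comp hμc).tendsto
  have hpos : 0 < symplVol n (fun a b =>
        pullForm φ.symm Ω y ![a, b]) b * pullForm φ.symm μ y b := by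
    rw [← funext hb] at hv
    rw [symplVol_pullForm]
    exact hv
  have hφt := φ.continuousAt hps
  rw [ContinuousAt, φ.right_inv hy] at hφt
  have hev := hφt.eventually (hlim.eventually_const_lt hpos)
  filter_upwards [hev, φ.open_source.mem_nhds hps] with q hq hqs
  rw [← φ.left_inv hqs]
  exact mem_agreeSet_of_pullForm hq

theorem isOpen_inter_agreeSet {S : Set X} (hS : IsOpen S) (hΩ : IsSymplecticOn Ω S)
    (hμ : SmoothFormOn μ Set.univ) : IsOpen (S ∩ agreeSet Ω μ) := by
  obtain ⟨V, hV, hSV, hs⟩ := hΩ.smooth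
  rw [isOpen_iff_mem_nhds]
  rintro p ⟨hp, hp'⟩
  exact Filter.inter_mem (hS.mem_nhds hp)
    (agreeSet_mem_nhds hs hμ (hV.mem_nhds (hSV hp)) hp')

/-- A symplectic form induces the same or the opposite orientation at all points of a preconnected
set. -/
theorem subset_agreeSet {S C : Set X} (hS : IsOpen S) (hΩ : IsSymplecticOn Ω S)
    (hμ : SmoothFormOn μ Set.univ) (hμ0 : ∀ p, μ p ≠ 0) (hC : IsPreconnected C) (hCS : C ⊆ S)
    {p : X} (hp : p ∈ C) (hp' : p ∈ agreeSet Ω μ) : C ⊆ agreeSet Ω μ := by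
  have h := hC.subset_left_of_subset_union (isOpen_inter_agreeSet hS hΩ hμ)
    (isOpen_inter_agreeSet hS hΩ hμ.neg)
    (disjoint_agreeSet_neg.mono Set.inter_subset_right Set.inter_subset_right) (fun q hq => ?_)
    ⟨p, hp, hCS hp, hp'⟩
  · exact h.trans Set.inter_subset_right
  · rcases mem_agreeSet_or_neg (hΩ.nondeg q (hCS hq)) (hμ0 q) with h | h
    · exact Or.inl ⟨hCS hq, h⟩
    · exact Or.inr ⟨hCS hq, h⟩

end Orientation

theorem mul_pos_of_continuous_of_ne_zero {f : ℝ → ℝ} (hf : Continuous f) (h : ∀ s, f s ≠ 0)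
    (a b : ℝ) : 0 < f a * f b := by
  by_contra hle
  rcases (mul_ne_zero (h a) (h b)).lt_or_gt with hlt | hlt
  · rcases mul_neg_iff.1 hlt with ⟨h1, h2⟩ | ⟨h1, h2⟩
    · obtain ⟨s, hs⟩ := mem_range_of_exists_le_of_exists_ge hf ⟨b, h2.le⟩ ⟨a, h1.le⟩
      exact h s hs
    · obtain ⟨s, hs⟩ := mem_range_of_exists_le_of_exists_ge hf ⟨a, h1.le⟩ ⟨b, h2.le⟩
      exact h s hs
  · exact hle hlt

section Separation

variable {n : ℕ}
  {Z : Type*} [TopologicalSpace Z] [ChartedSpace (Euc (2 * n + 1)) Z]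
  {X : Type*} [TopologicalSpace X] [ChartedSpace (Euc (2 * n + 2)) X]
  {ι : Z → X} {τ : ℝ × Z → X}
  {Ω : DForm (2 * n + 2) X 2} {α : DForm (2 * n + 1) Z 1}
  {μ : DForm (2 * n + 2) X (2 * n + 2)}

theorem contactVolAt_eq_contactVolAlt (α : DForm (2 * n + 1) Z 1) (z : Z)
    (v : Fin (2 * n + 1) → TangentSpace (𝓡 (2 * n + 1)) z) :
    contactVolAt α z v = contactVolAlt n (formLin (α z)) (formBilin (extD α z)) v :=
  (contactVolAlt_apply n (formLin (α z)) (formBilin (extD α z))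
    (fun v w => form_skew (extD α z) v w) v).symm

/-- Changing the sign of one vector makes the contact volume positive. -/
theorem IsContactForm.exists_pos (hα : IsContactForm α) (z : Z) :
    ∃ v, 0 < contactVolAt α z v := by
  obtain ⟨v, hv⟩ := hα.contact z
  rcases lt_or_gt_of_ne hv with h | h
  · refine ⟨Function.update v 0 ((-1 : ℝ) • v 0), ?_⟩
    rw [contactVolAt_eq_contactVolAlt] at h ⊢
    rw [AlternatingMap.map_update_smul, Function.update_eq_self, smul_eq_mul]
    linarith
  · exact ⟨v, h⟩

variable [IsManifold (𝓡 (2 * n + 1)) ∞ Z] [IsManifold (𝓡 (2 * n + 2)) ∞ X]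

/-- The orientation given by `Ω^(n+1)` flips across the hypersurface, since the orientation condition
on slices has the sign of `t` in it. -/
theorem exists_agreeSet_flip (hα : IsContactForm α) (hΩ : IsScatteringFilling ι Ω α)
    (hτ : IsTubularMap n ι τ) (hμ : SmoothFormOn μ Set.univ) (hμ0 : ∀ p, μ p ≠ 0) (z : Z) :
    ∃ t : ℝ, 0 < t ∧ ((τ (t, z) ∈ agreeSet Ω μ ∧ τ (-t, z) ∈ agreeSet Ω fun p => -μ p) ∨
      (τ (-t, z) ∈ agreeSet Ω μ ∧ τ (t, z) ∈ agreeSet Ω fun p => -μ p)) := by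
  obtain ⟨φ, hφ, hzs⟩ : ∃ φ ∈ IsManifold.maximalAtlas (𝓡 (2 * n + 1)) ∞ Z, z ∈ φ.source :=
    ⟨_, IsManifold.chart_mem_maximalAtlas z, mem_chart_source _ z⟩
  obtain ⟨y, hy, rfl⟩ : ∃ y ∈ φ.target, φ.symm y = z := ⟨φ z, φ.map_source hzs, φ.left_inv hzs⟩
  obtain ⟨v, hv⟩ := hα.exists_pos (φ.symm y)
  have hsurj := (mdifferentiable_of_mem_maximalAtlas hφ).symm.mfderiv_surjective hy
  obtain ⟨b, hb⟩ : ∃ b : Fin (2 * n + 1) → Euc (2 * n + 1), ∀ i,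
      mfderiv (𝓡 (2 * n + 1)) (𝓡 (2 * n + 1)) φ.symm y (b i) = v i :=
    ⟨fun i => (hsurj (v i)).choose, fun i => (hsurj (v i)).choose_spec⟩
  rw [← funext hb] at hv
  set G := collarMap τ φ
  have hG : ∀ s : ℝ, IsLocalDiffeomorphAt 𝓘(ℝ, ℝ × Euc (2 * n + 1)) (𝓡 (2 * n + 2)) ∞ G (s, y) :=
    fun s => isLocalDiffeomorphAt_collarMap hτ hφ hy
  set w : Fin (2 * n + 2) → ℝ × Euc (2 * n + 1) := Fin.cons (1, 0) fun i => (0, b i) with hw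
  set f : ℝ → ℝ := fun s => symplVol n (fun a b => pullForm G Ω (s, y) ![a, b]) w with hf
  set g : ℝ → ℝ := fun s => pullForm G μ (s, y) w with hg
  have hpush : ∀ s : ℝ, (fun i => mfderiv 𝓘(ℝ, ℝ × Euc (2 * n + 1)) (𝓡 (2 * n + 2)) G (s, y) (w i)) =
      (Fin.cons (mfderiv 𝓘(ℝ, ℝ) (𝓡 (2 * n + 2)) (fun s => τ (s, φ.symm y)) s (1 : ℝ)) fun i =>
        mfderiv (𝓡 (2 * n + 1)) (𝓡 (2 * n + 2)) (fun z' => τ (s, z')) (φ.symm y)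
          (mfderiv (𝓡 (2 * n + 1)) (𝓡 (2 * n + 1)) φ.symm y (b i))) := by
    intro s
    funext i
    refine Fin.cases ?_ (fun i => ?_) i
    · exact mfderiv_collarMap_normal hτ hφ (q := (s, y)) hy
    · exact mfderiv_collarMap_slice hτ hφ (q := (s, y)) hy (b i)
  -- the sign of `Ω^(n+1)` on the frame is opposite to that of `s`
  have hfs : ∀ s : ℝ, IsWeakSlice Ω α τ s (φ.symm y) → s * f s < 0 := by
    intro s hs
    have := hs.orientation _ hv
    have hfs : f s = _ := symplVol_pullForm G Ω (s, y) w
    rw [hfs]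
    exact (congrArg (fun u => s * symplVol n (fun a b => Ω (τ (s, φ.symm y)) ![a, b]) u)
      (hpush s)).trans_lt this
  obtain ⟨t, ht, h1, h2⟩ : ∃ t : ℝ, 0 < t ∧ t * f t < 0 ∧ -t * f (-t) < 0 := by
    have hc : Continuous fun t : ℝ => (t, φ.symm y) := by fun_prop
    have h1 := (hc.tendsto 0).eventually (eventually_isWeakSlice hα hΩ hτ (φ.symm y))
    have h2 : ∀ᶠ t : ℝ in 𝓝 0, -t ≠ 0 → IsWeakSlice Ω α τ (-t) (φ.symm y) := by
      have h3 := (continuous_neg (G := ℝ)).tendsto 0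
      rw [neg_zero] at h3
      exact h3.eventually h1
    have h4 : ∀ᶠ t : ℝ in 𝓝[>] 0, 0 < t := eventually_mem_nhdsWithin
    obtain ⟨t, ht1, ht2, ht⟩ := ((h1.filter_mono nhdsWithin_le_nhds).and
      ((h2.filter_mono nhdsWithin_le_nhds).and h4)).exists
    exact ⟨t, ht, hfs t (ht1 ht.ne'), hfs (-t) (ht2 (by simpa using ht.ne'))⟩
  have hfr : Module.finrank ℝ (ℝ × Euc (2 * n + 1)) = 2 * n + 2 := by
    rw [Module.finrank_prod]
    simp
    ring
  -- the frame is a basis, so that `μ` does not vanish on it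
  have hg0 : ∀ s, g s ≠ 0 := by
    intro s
    refine top_ne_zero_of_top_ne_zero hfr (T₁ := symplVolAlt n (formBilin (pullForm G Ω (t, y))))
      (T₂ := (pullForm G μ (s, y)).toAlternatingMap) (b := w) ?_ ?_
    · rw [symplVolAlt_apply]
      intro h
      have h' : f t = 0 := h
      rw [h', mul_zero] at h1
      exact lt_irrefl _ h1
    · intro h
      refine hμ0 (G (s, y)) ?_
      ext u
      have hs := ((hG s).mfderivToContinuousLinearEquiv (by simp)).surjective
      choose u' hu' using fun i => hs (u i)
      rw [← funext hu']
      exact congrArg (fun T => T u') h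
  have hgc : Continuous g := by
    rw [continuous_iff_continuousAt]
    intro s
    have h1 := (contDiffAt_pullForm hμ Filter.univ_mem (hG s).contMDiffAt).continuousAt
    have h2 : ContinuousAt (fun s : ℝ => (s, y)) s := by fun_prop
    have h3 := ContinuousAt.comp (g := pullForm G μ) (f := fun s : ℝ => (s, y)) h1 h2
    exact (ContinuousAlternatingMap.apply ℝ (ℝ × Euc (2 * n + 1)) ℝ w).continuous.continuousAt.comp h3
  have hgg := mul_pos_of_continuous_of_ne_zero hgc hg0 t (-t)
  have hmem : ∀ s, 0 < f s * g s → τ (s, φ.symm y) ∈ agreeSet Ω μ := by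
    intro s hs
    exact mem_agreeSet_of_pullForm (f := G) (q := (s, y)) (b := w) hs
  have hmem' : ∀ s, f s * g s < 0 → τ (s, φ.symm y) ∈ agreeSet Ω fun p => -μ p := by
    intro s hs
    have hs : 0 < f s * -(g s) := by linarith
    exact mem_agreeSet_of_pullForm (f := G) (q := (s, y)) (b := w) (μ := fun p => -μ p) hs
  have h1' : f t < 0 := (pos_iff_neg_of_mul_neg h1).1 ht
  have h2' : 0 < f (-t) := by nlinarith
  refine ⟨t, ht, ?_⟩
  rcases lt_or_gt_of_ne (hg0 t) with h | h
  · have h' : g (-t) < 0 := (neg_iff_neg_of_mul_pos hgg).1 h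
    exact Or.inl ⟨hmem _ (mul_pos_of_neg_of_neg h1' h), hmem' _ (mul_neg_of_pos_of_neg h2' h')⟩
  · have h' : 0 < g (-t) := (pos_iff_pos_of_mul_pos hgg).1 h
    exact Or.inr ⟨hmem _ (mul_pos h2' h'), hmem' _ (mul_neg_of_neg_of_pos h1' h)⟩

/-- The two sides of the hypersurface are not connected to each other in its complement: `Ω^(n+1)`
induces opposite orientations on them, relative to an orientation of `X`. -/
theorem not_both_sides [ConnectedSpace Z] (hX : Orientable (2 * n + 2) X) (hα : IsContactForm α)
    (hΩ : IsScatteringFilling ι Ω α) (hτ : IsTubularMap n ι τ) {C : Set X} (hC : IsPreconnected C)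
    (hCZ : C ⊆ (Set.range ι)ᶜ) {t t' : ℝ} {z z' : Z} (ht : 0 < t) (ht' : t' < 0)
    (h : τ (t, z) ∈ C) (h' : τ (t', z') ∈ C) : False := by
  obtain ⟨μ, hμ, hμ0⟩ := hX
  have hconn : ∀ I : Set ℝ, IsPreconnected I → IsPreconnected (τ '' (I ×ˢ Set.univ)) := fun I hI =>
    (hI.prod isPreconnected_univ).image _ hτ.contMDiff.continuous.continuousOn
  -- adding both halves of the collar to `C` gives a connected set off the hypersurface
  set D := (C ∪ τ '' (Set.Ioi 0 ×ˢ Set.univ)) ∪ τ '' (Set.Iio 0 ×ˢ Set.univ) with hD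
  have hDc : IsPreconnected D :=
    IsPreconnected.union (τ (t', z')) (Or.inl h') ⟨(t', z'), ⟨ht', trivial⟩, rfl⟩
      (IsPreconnected.union (τ (t, z)) h ⟨(t, z), ⟨ht, trivial⟩, rfl⟩ hC (hconn _ isPreconnected_Ioi))
      (hconn _ isPreconnected_Iio)
  have hDS : D ⊆ (Set.range ι)ᶜ := by
    refine Set.union_subset (Set.union_subset hCZ ?_) ?_
    · rintro _ ⟨⟨s, z⟩, ⟨hs, -⟩, rfl⟩ hr
      exact (ne_of_gt hs) ((hτ.mem_range_iff _ _).1 hr)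
    · rintro _ ⟨⟨s, z⟩, ⟨hs, -⟩, rfl⟩ hr
      exact (ne_of_lt hs) ((hτ.mem_range_iff _ _).1 hr)
  have hpos : ∀ s : ℝ, 0 < s → τ (s, z) ∈ D := fun s hs =>
    Or.inl (Or.inr ⟨(s, z), ⟨hs, trivial⟩, rfl⟩)
  have hneg : ∀ s : ℝ, s < 0 → τ (s, z) ∈ D := fun s hs => Or.inr ⟨(s, z), ⟨hs, trivial⟩, rfl⟩
  have hS : IsOpen (Set.range ι)ᶜ := hΩ.isClosed_range.isOpen_compl
  have key : ∀ p ∈ D, ∀ q ∈ D, p ∈ agreeSet Ω μ → q ∈ agreeSet Ω (fun p => -μ p) → False :=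
    fun p hp q hq h1 h2 => Set.disjoint_left.1 disjoint_agreeSet_neg
      (subset_agreeSet hS hΩ.scattering.symplectic hμ hμ0 hDc hDS hp h1 hq) h2
  obtain ⟨s, hs, ⟨h1, h2⟩ | ⟨h1, h2⟩⟩ := exists_agreeSet_flip hα hΩ hτ hμ hμ0 z
  · exact key _ (hpos s hs) _ (hneg (-s) (by linarith)) h1 h2
  · exact key _ (hneg (-s) (by linarith)) _ (hpos s hs) h1 h2

end Separation

/-! ### Components of the complement of the collar -/

theorem isClosed_connectedComponentIn {Y : Type*} [TopologicalSpace Y] {K : Set Y}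
    (hK : IsClosed K) (x : Y) : IsClosed (connectedComponentIn K x) := by
  by_cases hx : x ∈ K
  · rw [connectedComponentIn_eq_image hx]
    exact hK.isClosedEmbedding_subtypeVal.isClosedMap _ isClosed_connectedComponent
  · rw [connectedComponentIn_eq_empty hx]
    exact isClosed_empty

section Domain

variable {n : ℕ}
  {Z : Type*} [TopologicalSpace Z] [ChartedSpace (Euc (2 * n + 1)) Z]
  {X : Type*} [TopologicalSpace X] [ChartedSpace (Euc (2 * n + 2)) X]
  {ι : Z → X} {τ : ℝ × Z → X}

theorem IsTubularMap.isOpenMap (hτ : IsTubularMap n ι τ) : IsOpenMap τ :=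
  hτ.isLocalDiffeomorph.isOpenMap

theorem IsTubularMap.image_mem_nhds (hτ : IsTubularMap n ι τ) {I : Set ℝ} (hI : IsOpen I) {t : ℝ}
    (ht : t ∈ I) (z : Z) : τ '' (I ×ˢ Set.univ) ∈ 𝓝 (τ (t, z)) :=
  (hτ.isOpenMap _ (hI.prod isOpen_univ)).mem_nhds ⟨(t, z), ⟨ht, trivial⟩, rfl⟩

theorem IsTubularMap.mem_image_iff (hτ : IsTubularMap n ι τ) {I : Set ℝ} {t : ℝ} {z : Z} :
    τ (t, z) ∈ τ '' (I ×ˢ Set.univ) ↔ t ∈ I := by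
  rw [hτ.injective.mem_set_image]
  simp

/-- A closed set `W` that contains the part `{t ≥ ε}` of the collar, but no other point of it, and
that has no frontier points off the collar. -/
structure IsCollarDomain (τ : ℝ × Z → X) (ε : ℝ) (W : Set X) : Prop where
  isClosed : IsClosed W
  mem_iff : ∀ t z, τ (t, z) ∈ W ↔ ε ≤ t
  mem_nhds : ∀ p ∈ W, p ∉ Set.range τ → W ∈ 𝓝 p

variable [CompactSpace Z] [T2Space X]

omit [ChartedSpace (Euc (2 * n + 1)) Z] [ChartedSpace (Euc (2 * n + 2)) X] in
theorem isClosed_image_collar (hτ : Continuous τ) (ε : ℝ) :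
    IsClosed (τ '' (Set.Icc (-ε) ε ×ˢ Set.univ)) :=
  ((isCompact_Icc.prod isCompact_univ).image hτ).isClosed

/-- A component of the complement of the collar neighbourhood which lies in the same component of `X`
as the hypersurface meets the collar: otherwise it would be open and closed in `X`. -/
theorem exists_collar_mem (hτ : IsTubularMap n ι τ) {ε : ℝ} {x : X}
    (hx : x ∉ τ '' (Set.Ioo (-ε) ε ×ˢ Set.univ)) (hxZ : ∃ z, ι z ∈ connectedComponent x) :
    ∃ t z, τ (t, z) ∈ connectedComponentIn (τ '' (Set.Ioo (-ε) ε ×ˢ Set.univ))ᶜ x := by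
  have hlc : LocallyConnectedSpace X := ChartedSpace.locallyConnectedSpace (Euc (2 * n + 2)) X
  by_contra! h
  set K := (τ '' (Set.Ioo (-ε) ε ×ˢ Set.univ))ᶜ with hK
  set W := connectedComponentIn K x with hW
  have hKc : IsClosed K := (hτ.isOpenMap _ (isOpen_Ioo.prod isOpen_univ)).isClosed_compl
  have hWc : IsClosed W := isClosed_connectedComponentIn hKc x
  have hxW : x ∈ W := mem_connectedComponentIn hx
  have hWo : IsOpen W := by
    rw [isOpen_iff_mem_nhds]
    intro p hp
    have hpO : p ∉ τ '' (Set.Icc (-ε) ε ×ˢ Set.univ) := by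
      rintro ⟨⟨t, z⟩, -, rfl⟩
      exact h t z hp
    have hKp : K ∈ 𝓝 p := by
      refine Filter.mem_of_superset
        ((isClosed_image_collar hτ.contMDiff.continuous ε).isOpen_compl.mem_nhds hpO) ?_
      exact Set.compl_subset_compl.2 (Set.image_mono
        (Set.prod_mono Set.Ioo_subset_Icc_self subset_rfl))
    rw [hW, connectedComponentIn_eq hp]
    exact connectedComponentIn_mem_nhds hKp
  obtain ⟨z, hz⟩ := hxZ
  have := (IsClopen.connectedComponent_subset ⟨hWc, hWo⟩ hxW) hz
  rw [← hτ.zero_section] at this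
  exact h 0 z this

variable [IsManifold (𝓡 (2 * n + 1)) ∞ Z] [IsManifold (𝓡 (2 * n + 2)) ∞ X]
  {Ω : DForm (2 * n + 2) X 2} {α : DForm (2 * n + 1) Z 1}

/-- A component of the complement of the collar neighbourhood that contains a point of the positive
end of the collar contains all of that end, and no point of the negative end. -/
theorem isCollarDomain_connectedComponentIn [ConnectedSpace Z] (hX : Orientable (2 * n + 2) X)
    (hα : IsContactForm α) (hΩ : IsScatteringFilling ι Ω α) (hτ : IsTubularMap n ι τ) {ε : ℝ}
    (hε : 0 < ε) {x : X} {t : ℝ} {z : Z} (ht : 0 < t)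
    (h : τ (t, z) ∈ connectedComponentIn (τ '' (Set.Ioo (-ε) ε ×ˢ Set.univ))ᶜ x) :
    IsCollarDomain τ ε (connectedComponentIn (τ '' (Set.Ioo (-ε) ε ×ˢ Set.univ))ᶜ x) := by
  have hlc : LocallyConnectedSpace X := ChartedSpace.locallyConnectedSpace (Euc (2 * n + 2)) X
  rw [connectedComponentIn_eq h]
  set K := (τ '' (Set.Ioo (-ε) ε ×ˢ Set.univ))ᶜ with hK
  set W := connectedComponentIn K (τ (t, z)) with hW
  have hKc : IsClosed K := (hτ.isOpenMap _ (isOpen_Ioo.prod isOpen_univ)).isClosed_compl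
  have hWK : W ⊆ K := connectedComponentIn_subset _ _
  have hKmem : ∀ s z', τ (s, z') ∈ K ↔ s ∉ Set.Ioo (-ε) ε := fun s z' => by
    rw [hK, Set.mem_compl_iff, hτ.mem_image_iff]
  have htK : τ (t, z) ∈ K := connectedComponentIn_subset _ _ h
  have hεt : ε ≤ t := by
    by_contra! hlt
    exact (hKmem t z).1 htK ⟨by linarith, hlt⟩
  have hend : τ '' (Set.Ici ε ×ˢ Set.univ) ⊆ W := by
    refine IsPreconnected.subset_connectedComponentIn ?_ ⟨(t, z), ⟨hεt, trivial⟩, rfl⟩ ?_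
    · exact (isPreconnected_Ici.prod isPreconnected_univ).image _ hτ.contMDiff.continuous.continuousOn
    · rintro _ ⟨⟨s, z'⟩, ⟨hs, -⟩, rfl⟩
      exact (hKmem s z').2 fun h => absurd h.2 (not_lt.2 hs)
  have hWZ : W ⊆ (Set.range ι)ᶜ := by
    rintro p hp ⟨z', rfl⟩
    have := hWK hp
    rw [← hτ.zero_section, hKmem] at this
    exact this ⟨by linarith, hε⟩
  refine ⟨isClosed_connectedComponentIn hKc _, fun s z' => ⟨fun hs => ?_, fun hs => ?_⟩, ?_⟩
  · by_contra! hlt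
    have h1 := (hKmem s z').1 (hWK hs)
    have h2 : s < 0 := by
      by_contra! h0
      exact h1 ⟨by linarith, hlt⟩
    exact not_both_sides hX hα hΩ hτ isPreconnected_connectedComponentIn hWZ ht h2
      (mem_connectedComponentIn htK) hs
  · exact hend ⟨(s, z'), ⟨hs, trivial⟩, rfl⟩
  · intro p hp hpτ
    have hKp : K ∈ 𝓝 p := by
      refine Filter.mem_of_superset ((isClosed_image_collar hτ.contMDiff.continuous
        ε).isOpen_compl.mem_nhds fun h => hpτ (Set.image_subset_range _ _ h)) ?_
      exact Set.compl_subset_compl.2 (Set.image_mono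
        (Set.prod_mono Set.Ioo_subset_Icc_self subset_rfl))
    rw [hW, connectedComponentIn_eq hp]
    exact connectedComponentIn_mem_nhds hKp

end Domain

section InverseCollar

variable {n : ℕ}
  {Z : Type*} [TopologicalSpace Z] [ChartedSpace (Euc (2 * n + 1)) Z]
  {X : Type*} [TopologicalSpace X] [ChartedSpace (Euc (2 * n + 2)) X]
  {ι : Z → X} {τ : ℝ × Z → X}

theorem IsTubularMap.contMDiffAt_invFun [Nonempty (ℝ × Z)] (hτ : IsTubularMap n ι τ) (p : ℝ × Z) :
    ContMDiffAt (𝓡 (2 * n + 2)) (𝓘(ℝ, ℝ).prod (𝓡 (2 * n + 1))) ∞ (Function.invFun τ) (τ p) := by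
  have h := hτ.isLocalDiffeomorph p
  refine h.localInverse_contMDiffAt.congr_of_eventuallyEq ?_
  filter_upwards [h.localInverse_open_source.mem_nhds h.localInverse_mem_source] with q hq
  refine hτ.injective ?_
  rw [h.localInverse_right_inv hq]
  refine Function.invFun_eq ⟨_, h.localInverse_right_inv hq⟩

theorem IsTubularMap.invFun_apply [Nonempty (ℝ × Z)] (hτ : IsTubularMap n ι τ) (p : ℝ × Z) :
    Function.invFun τ (τ p) = p := Function.leftInverse_invFun hτ.injective p

variable {ε : ℝ} {W : Set X}

theorem IsCollarDomain.frontier_eq (hW : IsCollarDomain τ ε W) (hτ : IsTubularMap n ι τ) :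
    frontier W = Set.range fun z => τ (ε, z) := by
  ext p
  rw [hW.isClosed.frontier_eq]
  constructor
  · rintro ⟨hp, hpi⟩
    rw [mem_interior_iff_mem_nhds] at hpi
    by_cases hpτ : p ∈ Set.range τ
    · obtain ⟨⟨t, z⟩, rfl⟩ := hpτ
      rcases ((hW.mem_iff t z).1 hp).eq_or_lt with h | h
      · exact ⟨z, by rw [h]⟩
      · refine (hpi (Filter.mem_of_superset (hτ.image_mem_nhds isOpen_Ioi h z) ?_)).elim
        rintro _ ⟨⟨s, z'⟩, ⟨hs, -⟩, rfl⟩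
        exact (hW.mem_iff s z').2 (le_of_lt hs)
    · exact (hpi (hW.mem_nhds p hp hpτ)).elim
  · rintro ⟨z, rfl⟩
    refine ⟨(hW.mem_iff ε z).2 le_rfl, fun hpi => ?_⟩
    rw [mem_interior_iff_mem_nhds] at hpi
    have h1 : ∀ᶠ s in 𝓝 ε, τ (s, z) ∈ W :=
      ((hτ.contMDiff_normal z).continuous.tendsto ε).eventually hpi
    have h2 : ∀ᶠ s : ℝ in 𝓝[<] ε, s < ε := eventually_mem_nhdsWithin
    obtain ⟨s, hs, hs'⟩ := ((h1.filter_mono nhdsWithin_le_nhds).and h2).exists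
    exact absurd ((hW.mem_iff s z).1 hs) (not_le.2 hs')

/-- The collar coordinate is a defining function of a collar domain near its boundary. -/
theorem IsCollarDomain.isLocalDefFun [Nonempty (ℝ × Z)] (hW : IsCollarDomain τ ε W)
    (hτ : IsTubularMap n ι τ) (z : Z) :
    IsLocalDefFun (d := 2 * n + 2) W (τ (ε, z)) fun q => (Function.invFun τ q).1 - ε := by
  have hsm : ∀ p, ContMDiffAt (𝓡 (2 * n + 2)) 𝓘(ℝ, ℝ) ∞ (fun q => (Function.invFun τ q).1 - ε)
      (τ p) := fun p =>
    (contMDiffAt_fst.comp _ (hτ.contMDiffAt_invFun p)).sub contMDiffAt_const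
  refine ⟨Set.range τ, hτ.isLocalDiffeomorph.isOpen_range, ⟨_, rfl⟩, ?_, ?_, ?_, ?_⟩
  · rintro _ ⟨p, rfl⟩
    exact (hsm p).contMDiffWithinAt
  · simp [hτ.invFun_apply]
  · intro h0
    have h1 := HasMFDerivAt.comp (g := fun q => (Function.invFun τ q).1 - ε) ε
      ((hsm (ε, z)).mdifferentiableAt (by simp)).hasMFDerivAt
      (((hτ.contMDiff_normal z).mdifferentiable (by simp)) ε).hasMFDerivAt
    have h2 : ((fun q => (Function.invFun τ q).1 - ε) ∘ fun t => τ (t, z)) = fun t : ℝ => t - ε := by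
      funext t
      simp [hτ.invFun_apply]
    rw [h2] at h1
    have h3 : HasMFDerivAt 𝓘(ℝ, ℝ) 𝓘(ℝ, ℝ) (fun t : ℝ => t - ε) ε (ContinuousLinearMap.id ℝ ℝ) :=
      ((hasFDerivAt_id ε).sub_const ε).hasMFDerivAt
    have h4 := congrArg (fun L => L (1 : ℝ)) (hasMFDerivAt_unique h1 h3)
    have h5 : mfderiv (𝓡 (2 * n + 2)) 𝓘(ℝ, ℝ) (fun q => (Function.invFun τ q).1 - ε) (τ (ε, z))
      (mfderiv 𝓘(ℝ, ℝ) (𝓡 (2 * n + 2)) (fun t => τ (t, z)) ε (1 : ℝ)) = (1 : ℝ) := h4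
    rw [h0] at h5
    exact zero_ne_one (α := ℝ) h5
  · rintro _ ⟨⟨t, z'⟩, rfl⟩
    rw [hW.mem_iff]
    simp [hτ.invFun_apply]

theorem IsCollarDomain.isSmoothDomain (hW : IsCollarDomain τ ε W) (hτ : IsTubularMap n ι τ) :
    IsSmoothDomain (d := 2 * n + 2) W := by
  refine ⟨hW.isClosed, fun p hp => ?_⟩
  rw [hW.frontier_eq hτ] at hp
  obtain ⟨z, rfl⟩ := hp
  have : Nonempty (ℝ × Z) := ⟨(0, z)⟩
  exact ⟨_, hW.isLocalDefFun hτ z⟩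

end InverseCollar

/-! ### The boundary of a collar domain -/

section Outward

variable {n : ℕ}
  {Z : Type*} [TopologicalSpace Z] [ChartedSpace (Euc (2 * n + 1)) Z]
  {X : Type*} [TopologicalSpace X] [ChartedSpace (Euc (2 * n + 2)) X]
  {ι : Z → X} {τ : ℝ × Z → X} {ε : ℝ} {W : Set X}

variable [IsManifold (𝓡 (2 * n + 1)) ∞ Z]

/-- Outward vectors of a collar domain point towards decreasing `t`. -/
theorem IsCollarDomain.exists_eq_of_pointsOutward (hW : IsCollarDomain τ ε W)
    (hτ : IsTubularMap n ι τ) {z : Z} {ν : TangentSpace (𝓡 (2 * n + 2)) (τ (ε, z))}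
    (hν : PointsOutward W (τ (ε, z)) ν) : ∃ (r : ℝ) (u : TangentSpace (𝓡 (2 * n + 1)) z), r < 0 ∧
      ν = r • (mfderiv 𝓘(ℝ, ℝ) (𝓡 (2 * n + 2)) (fun t => τ (t, z)) ε (1 : ℝ) :
          TangentSpace (𝓡 (2 * n + 2)) (τ (ε, z))) +
        mfderiv (𝓡 (2 * n + 1)) (𝓡 (2 * n + 2)) (fun z' => τ (ε, z')) z u := by
  obtain ⟨φ, hφ, hzs⟩ : ∃ φ ∈ IsManifold.maximalAtlas (𝓡 (2 * n + 1)) ∞ Z, z ∈ φ.source :=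
    ⟨_, IsManifold.chart_mem_maximalAtlas z, mem_chart_source _ z⟩
  obtain ⟨y, hy, rfl⟩ : ∃ y ∈ φ.target, φ.symm y = z := ⟨φ z, φ.map_source hzs, φ.left_inv hzs⟩
  obtain ⟨f, ⟨V, hV, hpV, hfs, hfp, -, hfW⟩, hlt⟩ := hν
  set G := collarMap τ φ with hGdef
  have hG : IsLocalDiffeomorphAt 𝓘(ℝ, ℝ × Euc (2 * n + 1)) (𝓡 (2 * n + 2)) ∞ G (ε, y) :=
    isLocalDiffeomorphAt_collarMap hτ hφ hy
  have hf : HasMFDerivAt (𝓡 (2 * n + 2)) 𝓘(ℝ, ℝ) f (G (ε, y)) _ :=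
    ((hfs.contMDiffAt (hV.mem_nhds hpV)).mdifferentiableAt (by simp)).hasMFDerivAt
  have hG' : HasMFDerivAt 𝓘(ℝ, ℝ × Euc (2 * n + 1)) (𝓡 (2 * n + 2)) G (ε, y) _ :=
    (hG.mdifferentiableAt (by simp)).hasMFDerivAt
  set D : ℝ × Euc (2 * n + 1) →L[ℝ] ℝ := (mfderiv (𝓡 (2 * n + 2)) 𝓘(ℝ, ℝ) f (G (ε, y))).comp
    (mfderiv 𝓘(ℝ, ℝ × Euc (2 * n + 1)) (𝓡 (2 * n + 2)) G (ε, y)) with hD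
  have hfG : HasFDerivAt (fun q => f (G q)) D (ε, y) :=
    (HasMFDerivAt.comp (ε, y) hf hG').hasFDerivAt
  have hnonneg : ∀ᶠ q in 𝓝 (ε, y), ε ≤ q.1 → 0 ≤ f (G q) := by
    filter_upwards [hG'.continuousAt.eventually (hV.mem_nhds hpV)] with q hq hq1
    exact (hfW _ hq).1 ((hW.mem_iff _ _).2 hq1)
  -- along `∂W` the defining function has a minimum
  have hD0 : ∀ u, D (0, u) = 0 := by
    intro u
    have h1 := HasFDerivAt.comp (g := fun q => f (G q)) y hfG (hasFDerivAt_prodMk_right ε y)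
    have hc : Continuous fun y : Euc (2 * n + 1) => (ε, y) := by fun_prop
    have h2 : IsLocalMin ((fun q => f (G q)) ∘ fun y => (ε, y)) y := by
      filter_upwards [(hc.tendsto y).eventually hnonneg] with y' hy'
      exact hfp.trans_le (hy' le_rfl)
    exact congrArg (fun L => L u) (h2.hasFDerivAt_eq_zero h1)
  have hD1 : 0 ≤ D (1, 0) := by
    have h1 : HasDerivAt (fun t => f (G (t, y))) (D (1, 0)) ε := by
      have := (HasFDerivAt.comp (g := fun q => f (G q)) ε hfG
        (hasFDerivAt_prodMk_left ε y)).hasDerivAt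
      exact this
    have h2 := (hasDerivAt_iff_tendsto_slope.1 h1).mono_left
      (nhdsWithin_mono ε (fun s (hs : ε < s) => ne_of_gt hs) : 𝓝[>] ε ≤ 𝓝[≠] ε)
    have hc : Continuous fun t : ℝ => (t, y) := by fun_prop
    have h3 : ∀ᶠ s : ℝ in 𝓝[>] ε, ε < s := eventually_mem_nhdsWithin
    refine ge_of_tendsto h2 ?_
    filter_upwards [((hc.tendsto ε).eventually hnonneg).filter_mono nhdsWithin_le_nhds, h3]
      with s hs hs'
    have hfe : f (G (ε, y)) = 0 := hfp
    rw [slope_def_field, hfe, sub_zero]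
    exact div_nonneg (hs hs'.le) (sub_nonneg.2 hs'.le)
  obtain ⟨⟨r, u⟩, hru⟩ := (hG.mfderivToContinuousLinearEquiv (by simp)).surjective ν
  replace hru : mfderiv 𝓘(ℝ, ℝ × Euc (2 * n + 1)) (𝓡 (2 * n + 2)) G (ε, y) (r, u) = ν := hru
  have hsplit : ((r, u) : ℝ × Euc (2 * n + 1)) = r • ((1 : ℝ), (0 : Euc (2 * n + 1))) + (0, u) := by
    ext <;> simp
  refine ⟨r, mfderiv (𝓡 (2 * n + 1)) (𝓡 (2 * n + 1)) φ.symm y u, ?_, ?_⟩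
  · have h1 : D (r, u) < 0 := by
      rw [← hru] at hlt
      exact hlt
    rw [hsplit, map_add, map_smul, hD0, add_zero, smul_eq_mul] at h1
    exact (neg_iff_pos_of_mul_neg h1).2 (lt_of_le_of_ne hD1 fun h => by simp [← h] at h1)
  · have h1 := mfderiv_collarMap_normal hτ hφ (q := (ε, y)) hy
    have h2 := mfderiv_collarMap_slice hτ hφ (q := (ε, y)) hy u
    rw [← hru, hsplit]
    refine (map_add (mfderiv 𝓘(ℝ, ℝ × Euc (2 * n + 1)) (𝓡 (2 * n + 2)) G (ε, y)) _ _).trans ?_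
    refine congrArg₂ (· + ·) ?_ h2
    refine (map_smul (mfderiv 𝓘(ℝ, ℝ × Euc (2 * n + 1)) (𝓡 (2 * n + 2)) G (ε, y)) r _).trans ?_
    exact congrArg (fun x => r • x) h1

end Outward

section Embedding

variable {n : ℕ}
  {Z : Type*} [TopologicalSpace Z] [ChartedSpace (Euc (2 * n + 1)) Z]
  {X : Type*} [TopologicalSpace X] [ChartedSpace (Euc (2 * n + 2)) X]
  {ι : Z → X} {τ : ℝ × Z → X}

/-- The parametrization of a neighbourhood of the slice `{s} × Z` by `Euc (2 * n + 2)`, in which the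
slice is a linear hyperplane. -/
theorem isLocalDiffeomorphAt_collarMap_translate (hτ : IsTubularMap n ι τ) (s : ℝ)
    {φ : OpenPartialHomeomorph Z (Euc (2 * n + 1))}
    (hφ : φ ∈ IsManifold.maximalAtlas (𝓡 (2 * n + 1)) ∞ Z)
    (L : (Euc (2 * n + 1) × ℝ) ≃L[ℝ] Euc (2 * n + 2)) {y : Euc (2 * n + 1)} (hy : y ∈ φ.target) :
    IsLocalDiffeomorphAt (𝓡 (2 * n + 2)) (𝓡 (2 * n + 2)) ∞
      (fun u => collarMap τ φ ((L.symm u).2 + s, (L.symm u).1)) (L (y, 0)) := by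
  let K : Diffeomorph (𝓡 (2 * n + 2)) 𝓘(ℝ, ℝ × Euc (2 * n + 1)) (Euc (2 * n + 2))
      (ℝ × Euc (2 * n + 1)) ∞ :=
    { toFun := fun u => ((L.symm u).2 + s, (L.symm u).1)
      invFun := fun q => L (q.2, q.1 - s)
      left_inv := fun u => by simp
      right_inv := fun q => by simp
      contMDiff_toFun := by
        have : ContDiff ℝ ∞ fun u : Euc (2 * n + 2) => ((L.symm u).2 + s, (L.symm u).1) := by
          fun_prop
        exact this.contMDiff
      contMDiff_invFun := by
        have : ContDiff ℝ ∞ fun q : ℝ × Euc (2 * n + 1) => L (q.2, q.1 - s) := by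
          fun_prop
        exact this.contMDiff }
  have hK : IsLocalDiffeomorphAt (𝓡 (2 * n + 2)) 𝓘(ℝ, ℝ × Euc (2 * n + 1)) ∞ K (L (y, 0)) :=
    K.isLocalDiffeomorph _
  refine hK.comp (g := collarMap τ φ) (𝓡 (2 * n + 2)) X (isLocalDiffeomorphAt_collarMap hτ hφ ?_)
  have h : (K (L (y, 0))).2 = y := by
    change (L.symm (L (y, 0))).1 = y
    simp
  rwa [h]

variable [IsManifold (𝓡 (2 * n + 1)) ∞ Z] [IsManifold (𝓡 (2 * n + 2)) ∞ X]

theorem IsTubularMap.isImmersion_slice (hτ : IsTubularMap n ι τ) (s : ℝ) :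
    Manifold.IsImmersion (𝓡 (2 * n + 1)) (𝓡 (2 * n + 2)) ∞ fun z => τ (s, z) := by
  have L : (Euc (2 * n + 1) × ℝ) ≃L[ℝ] Euc (2 * n + 2) :=
    ContinuousLinearEquiv.ofFinrankEq (by rw [Module.finrank_prod]; simp)
  refine ⟨ℝ, inferInstance, inferInstance, fun z => ?_⟩
  obtain ⟨φ, hφ, hzs⟩ : ∃ φ ∈ IsManifold.maximalAtlas (𝓡 (2 * n + 1)) ∞ Z, z ∈ φ.source :=
    ⟨_, IsManifold.chart_mem_maximalAtlas z, mem_chart_source _ z⟩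
  obtain ⟨Φ, hΦ, hΦeq⟩ := isLocalDiffeomorphAt_collarMap_translate hτ s hφ L (φ.map_source hzs)
  have hval : ∀ y, L (y, 0) ∈ Φ.source → Φ (L (y, 0)) = τ (s, φ.symm y) := by
    intro y hy
    rw [← hΦeq hy]
    simp [collarMap]
  have hT : IsOpen {y : Euc (2 * n + 1) | L (y, 0) ∈ Φ.source} :=
    Φ.open_source.preimage (by fun_prop)
  set S := φ.source ∩ φ ⁻¹' {y | L (y, 0) ∈ Φ.source} with hS
  have hSo : IsOpen S := φ.isOpen_inter_preimage hT
  refine Manifold.IsImmersionAtOfComplement.mk_of_continuousAt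
    ((hτ.contMDiff_slice s).continuous.continuousAt) L (φ.restr S)
    Φ.toOpenPartialHomeomorph.symm ?_ ?_ ?_ ?_ ?_
  · rw [φ.restr_source, hSo.interior_eq]
    exact ⟨hzs, hzs, hΦ⟩
  · have := Φ.map_source hΦ
    have h2 := hval _ hΦ
    rw [φ.left_inv hzs] at h2
    change τ (s, z) ∈ Φ.target
    rw [← h2]
    exact this
  · exact restr_mem_maximalAtlas _ hφ hSo
  · exact OpenPartialHomeomorph.mem_maximalAtlas_of_contMDiffOn _ Φ.contMDiffOn_invFun
      Φ.contMDiffOn_toFun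
  · intro y hy
    have hy' : y ∈ φ.target ∧ φ.symm y ∈ S := by
      simpa [OpenPartialHomeomorph.extend, hSo.interior_eq] using hy
    have h1 : L (y, 0) ∈ Φ.source := by
      have := hy'.2.2
      rwa [Set.mem_preimage, φ.right_inv hy'.1] at this
    change Φ.symm (τ (s, φ.symm y)) = L (y, 0)
    rw [← hval y h1]
    exact Φ.left_inv h1

theorem IsTubularMap.isSmoothEmbedding_slice [CompactSpace Z] [T2Space X]
    (hτ : IsTubularMap n ι τ) (s : ℝ) :
    Manifold.IsSmoothEmbedding (𝓡 (2 * n + 1)) (𝓡 (2 * n + 2)) ∞ fun z => τ (s, z) := by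
  refine ⟨hτ.isImmersion_slice s, ?_⟩
  refine ((hτ.contMDiff_slice s).continuous.isClosedEmbedding fun z z' h => ?_).isEmbedding
  exact congrArg Prod.snd (hτ.injective h)

end Embedding

/-! ### Pushing along the collar -/

section PullbackForm

variable {d k : ℕ} {M : Type*} [TopologicalSpace M] [ChartedSpace (Euc d) M]

/-- The pullback of a form on a manifold by a self-map. -/
def pullbackForm (Ψ : M → M) (Ω : DForm d M k) : DForm d M k := fun p =>
  (Ω (Ψ p)).compContinuousLinearMap (mfderiv (𝓡 d) (𝓡 d) Ψ p)

variable {Ψ : M → M} {Ω : DForm d M k}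

theorem pullbackForm_pair (Ω : DForm d M 2) (p : M) (v w : TangentSpace (𝓡 d) p) :
    pullbackForm Ψ Ω p ![v, w] =
      Ω (Ψ p) ![mfderiv (𝓡 d) (𝓡 d) Ψ p v, mfderiv (𝓡 d) (𝓡 d) Ψ p w] := by
  refine apply_eq_of_forall_eq (f := Ω (Ψ p)) fun i => ?_
  fin_cases i <;> rfl

theorem inChart_pullbackForm (hΨ : ContMDiff (𝓡 d) (𝓡 d) ∞ Ψ)
    {e : OpenPartialHomeomorph M (Euc d)} (he : e ∈ IsManifold.maximalAtlas (𝓡 d) ∞ M) {u : Euc d}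
    (hu : u ∈ e.target) :
    inChart e (pullbackForm Ψ Ω) u = pullForm (fun u => Ψ (e.symm u)) Ω u := by
  have h : mfderiv (𝓡 d) (𝓡 d) (fun u => Ψ (e.symm u)) u =
      (mfderiv (𝓡 d) (𝓡 d) Ψ (e.symm u)).comp (mfderiv (𝓡 d) (𝓡 d) e.symm u) :=
    mfderiv_comp u (hΨ.mdifferentiable (by simp) _)
      ((mdifferentiable_of_mem_maximalAtlas he).mdifferentiableAt_symm hu)
  ext v
  change Ω (Ψ (e.symm u)) _ = Ω (Ψ (e.symm u)) _
  refine apply_eq_of_forall_eq (f := Ω (Ψ (e.symm u))) fun i => ?_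
  exact (congrArg (fun L => L (v i)) h).symm

variable [IsManifold (𝓡 d) ∞ M]

theorem contDiffAt_inChart_pullbackForm {V : Set M} (hΨ : ContMDiff (𝓡 d) (𝓡 d) ∞ Ψ)
    (hΩ : SmoothFormOn Ω V) {e : OpenPartialHomeomorph M (Euc d)}
    (he : e ∈ IsManifold.maximalAtlas (𝓡 d) ∞ M) {u : Euc d}
    (hu : u ∈ e.target) (hV : V ∈ 𝓝 (Ψ (e.symm u))) :
    ContDiffAt ℝ ∞ (inChart e (pullbackForm Ψ Ω)) u := by
  have h : ContMDiffAt (𝓡 d) (𝓡 d) ∞ (fun u => Ψ (e.symm u)) u :=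
    hΨ.contMDiffAt.comp u (contMDiffAt_chart_symm he hu)
  refine (contDiffAt_pullForm (f := fun u => Ψ (e.symm u)) hΩ hV h).congr_of_eventuallyEq ?_
  filter_upwards [e.open_target.mem_nhds hu] with u' hu'
  exact inChart_pullbackForm hΨ he hu'

theorem SmoothFormOn.pullbackForm {V : Set M} (hΨ : ContMDiff (𝓡 d) (𝓡 d) ∞ Ψ) (hV : IsOpen V)
    (hΩ : SmoothFormOn Ω V) : SmoothFormOn (pullbackForm Ψ Ω) (Ψ ⁻¹' V) := fun _ he _ hu =>
  (contDiffAt_inChart_pullbackForm hΨ hΩ (IsManifold.subset_maximalAtlas he) hu.1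
    (hV.mem_nhds hu.2)).contDiffWithinAt

/-- The pullback of a form closed at `Ψ p` is closed at `p`. -/
theorem extD_pullbackForm_eq_zero {V : Set M} (hΨ : ContMDiff (𝓡 d) (𝓡 d) ∞ Ψ)
    (hΩ : SmoothFormOn Ω V) {p : M} (hV : V ∈ 𝓝 (Ψ p)) (hp : extD Ω (Ψ p) = 0) :
    extD (pullbackForm Ψ Ω) p = 0 := by
  have he := IsManifold.chart_mem_maximalAtlas (I := 𝓡 d) (n := ∞) p
  have hu := mem_chart_target (Euc d) p
  have hpe : (chartAt (Euc d) p).symm (chartAt (Euc d) p p) = p :=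
    (chartAt (Euc d) p).left_inv (mem_chart_source _ p)
  have h : ContMDiffAt (𝓡 d) (𝓡 d) ∞ (fun u => Ψ ((chartAt (Euc d) p).symm u))
      (chartAt (Euc d) p p) :=
    hΨ.contMDiffAt.comp _ (contMDiffAt_chart_symm he hu)
  have h1 : inChart (chartAt (Euc d) p) (pullbackForm Ψ Ω) =ᶠ[𝓝 (chartAt (Euc d) p p)]
      pullForm (fun u => Ψ ((chartAt (Euc d) p).symm u)) Ω := by
    filter_upwards [(chartAt (Euc d) p).open_target.mem_nhds hu] with u' hu'
    exact inChart_pullbackForm hΨ he hu'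
  have h2 : extD Ω (Ψ ((chartAt (Euc d) p).symm (chartAt (Euc d) p p))) = 0 := by rw [hpe, hp]
  rw [extD, h1.extDeriv_eq, extDeriv_pullForm hΩ (by rwa [hpe]) h, pullForm, h2]
  rfl

end PullbackForm

section PushFunction

/-- A smooth function on the line which takes `ε` to `δ`, increases on `[ε, ∞)`, and is the identity
for `|t| ≥ 2 ε`. -/
def pushFun (ε δ t : ℝ) : ℝ :=
  t - (ε - δ) * (Real.smoothTransition ((2 * ε - t) / ε) *
    Real.smoothTransition ((2 * ε + t) / ε))

theorem contDiff_pushFun (ε δ : ℝ) : ContDiff ℝ ∞ (pushFun ε δ) := by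
  have h1 : ContDiff ℝ ∞ fun t : ℝ => Real.smoothTransition ((2 * ε - t) / ε) :=
    Real.smoothTransition.contDiff.comp ((contDiff_const.sub contDiff_id).div_const ε)
  have h2 : ContDiff ℝ ∞ fun t : ℝ => Real.smoothTransition ((2 * ε + t) / ε) :=
    Real.smoothTransition.contDiff.comp ((contDiff_const.add contDiff_id).div_const ε)
  exact contDiff_id.sub (contDiff_const.mul (h1.mul h2))

variable {ε δ t : ℝ}

theorem pushFun_of_le_abs (hε : 0 < ε) (ht : 2 * ε ≤ |t|) : pushFun ε δ t = t := by
  rcases le_abs.1 ht with h | h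
  · have : (2 * ε - t) / ε ≤ 0 := div_nonpos_of_nonpos_of_nonneg (by linarith) hε.le
    rw [pushFun, Real.smoothTransition.zero_of_nonpos this]
    ring
  · have : (2 * ε + t) / ε ≤ 0 := div_nonpos_of_nonpos_of_nonneg (by linarith) hε.le
    rw [pushFun, Real.smoothTransition.zero_of_nonpos this]
    ring

theorem pushFun_of_neg_le (hε : 0 < ε) (ht : -ε ≤ t) :
    pushFun ε δ t = t - (ε - δ) * Real.smoothTransition ((2 * ε - t) / ε) := by
  have : 1 ≤ (2 * ε + t) / ε := (one_le_div hε).2 (by linarith)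
  rw [pushFun, Real.smoothTransition.one_of_one_le this, mul_one]

theorem pushFun_self (hε : 0 < ε) : pushFun ε δ ε = δ := by
  have : 1 ≤ (2 * ε - ε) / ε := (one_le_div hε).2 (by linarith)
  rw [pushFun_of_neg_le hε (by linarith), Real.smoothTransition.one_of_one_le this]
  ring

theorem le_pushFun (hε : 0 < ε) (hδ : δ ≤ ε) (ht : ε ≤ t) : δ ≤ pushFun ε δ t := by
  rw [pushFun_of_neg_le hε (by linarith)]
  nlinarith [Real.smoothTransition.le_one ((2 * ε - t) / ε)]

/-- The difference quotients of `pushFun` at points of `[ε, ∞)` are at least `1`. -/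
theorem deriv_pushFun_pos (hε : 0 < ε) (hδ : δ ≤ ε) (ht : ε ≤ t) :
    0 < deriv (pushFun ε δ) t := by
  have hd : DifferentiableAt ℝ (pushFun ε δ) t :=
    (contDiff_pushFun ε δ).differentiable (by simp) t
  have h1 : Filter.Tendsto (slope (pushFun ε δ) t) (𝓝[>] t) (𝓝 (deriv (pushFun ε δ) t)) :=
    (hasDerivAt_iff_tendsto_slope.1 hd.hasDerivAt).mono_left
      (nhdsWithin_mono t (fun s (hs : t < s) => ne_of_gt hs) : 𝓝[>] t ≤ 𝓝[≠] t)
  have h2 : ∀ᶠ s : ℝ in 𝓝[>] t, t < s := eventually_mem_nhdsWithin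
  refine zero_lt_one.trans_le (ge_of_tendsto h1 ?_)
  filter_upwards [h2] with s hs
  rw [slope_def_field, pushFun_of_neg_le hε (by linarith), pushFun_of_neg_le hε (by linarith),
    le_div_iff₀ (by linarith)]
  have h3 : Real.smoothTransition ((2 * ε - s) / ε) ≤ Real.smoothTransition ((2 * ε - t) / ε) :=
    Real.smoothTransition.monotone (div_le_div_of_nonneg_right (by linarith) hε.le)
  nlinarith [mul_le_mul_of_nonneg_left h3 (sub_nonneg.2 hδ)]

end PushFunction

section PushMap

variable {n : ℕ}
  {Z : Type*} [TopologicalSpace Z] [ChartedSpace (Euc (2 * n + 1)) Z]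
  {X : Type*} [TopologicalSpace X] [ChartedSpace (Euc (2 * n + 2)) X]
  {ι : Z → X} {τ : ℝ × Z → X} {ψ : ℝ → ℝ}

open Classical in
/-- The self-map of `X` that is `(t, z) ↦ (ψ t, z)` on the collar and the identity elsewhere. -/
def pushMap [Nonempty (ℝ × Z)] (τ : ℝ × Z → X) (ψ : ℝ → ℝ) (p : X) : X :=
  if p ∈ Set.range τ then τ (ψ (Function.invFun τ p).1, (Function.invFun τ p).2) else p

variable [Nonempty (ℝ × Z)]

theorem pushMap_apply (hτ : IsTubularMap n ι τ) (t : ℝ) (z : Z) :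
    pushMap τ ψ (τ (t, z)) = τ (ψ t, z) := by
  rw [pushMap, if_pos ⟨_, rfl⟩, hτ.invFun_apply]

omit [TopologicalSpace Z] [ChartedSpace (Euc (2 * n + 1)) Z] [TopologicalSpace X]
  [ChartedSpace (Euc (2 * n + 2)) X] in
theorem pushMap_of_notMem {p : X} (hp : p ∉ Set.range τ) : pushMap τ ψ p = p := if_neg hp

variable [CompactSpace Z] [T2Space X] {R : ℝ}

/-- The collar is not assumed to be proper at its ends, but the points moved by `pushMap` lie in the
image of a compact part of it. -/
theorem pushMap_eventuallyEq (hτ : IsTubularMap n ι τ) (hψR : ∀ t, R ≤ |t| → ψ t = t) {p : X}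
    (hp : p ∉ Set.range τ) : pushMap τ ψ =ᶠ[𝓝 p] id := by
  filter_upwards [(isClosed_image_collar hτ.contMDiff.continuous R).isOpen_compl.mem_nhds
    fun h => hp (Set.image_subset_range _ _ h)] with q hq
  by_cases hqτ : q ∈ Set.range τ
  · obtain ⟨⟨t, z⟩, rfl⟩ := hqτ
    rw [Set.mem_compl_iff, hτ.mem_image_iff, Set.mem_Icc, ← abs_le, not_le] at hq
    rw [pushMap_apply hτ, hψR t hq.le]
    rfl
  · exact pushMap_of_notMem hqτ

theorem contMDiff_pushMap (hτ : IsTubularMap n ι τ) (hψ : ContDiff ℝ ∞ ψ)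
    (hψR : ∀ t, R ≤ |t| → ψ t = t) :
    ContMDiff (𝓡 (2 * n + 2)) (𝓡 (2 * n + 2)) ∞ (pushMap τ ψ) := by
  intro p
  by_cases hp : p ∈ Set.range τ
  · have h : ContMDiffAt (𝓡 (2 * n + 2)) (𝓡 (2 * n + 2)) ∞
        (fun p => τ (ψ (Function.invFun τ p).1, (Function.invFun τ p).2)) p := by
      obtain ⟨q, rfl⟩ := hp
      have h1 := hτ.contMDiffAt_invFun q
      refine hτ.contMDiff.contMDiffAt.comp (τ q) (ContMDiffAt.prodMk ?_ ?_)
      · exact hψ.contMDiff.contMDiffAt.comp (τ q) (contMDiffAt_fst.comp _ h1)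
      · exact contMDiffAt_snd.comp _ h1
    refine h.congr_of_eventuallyEq ?_
    filter_upwards [hτ.isLocalDiffeomorph.isOpen_range.mem_nhds hp] with q hq
    exact if_pos hq
  · exact contMDiffAt_id.congr_of_eventuallyEq (pushMap_eventuallyEq hτ hψR hp)

theorem mfderiv_pushMap_slice (hτ : IsTubularMap n ι τ) (hψ : ContDiff ℝ ∞ ψ)
    (hψR : ∀ t, R ≤ |t| → ψ t = t) (t : ℝ) (z : Z) (v : TangentSpace (𝓡 (2 * n + 1)) z) :
    (mfderiv (𝓡 (2 * n + 2)) (𝓡 (2 * n + 2)) (pushMap τ ψ) (τ (t, z))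
      (mfderiv (𝓡 (2 * n + 1)) (𝓡 (2 * n + 2)) (fun z' => τ (t, z')) z v) : Euc (2 * n + 2)) =
    mfderiv (𝓡 (2 * n + 1)) (𝓡 (2 * n + 2)) (fun z' => τ (ψ t, z')) z v := by
  have h := mfderiv_comp z (g := pushMap τ ψ)
    ((contMDiff_pushMap hτ hψ hψR).mdifferentiable (by simp) (τ (t, z)))
    ((hτ.contMDiff_slice t).mdifferentiable (by simp) z)
  have h1 : pushMap τ ψ ∘ (fun z' => τ (t, z')) = fun z' => τ (ψ t, z') :=
    funext fun z' => pushMap_apply hτ t z'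
  have h2 := congrArg (fun f : Z → X =>
    (mfderiv (𝓡 (2 * n + 1)) (𝓡 (2 * n + 2)) f z v : Euc (2 * n + 2))) h1
  exact (congrArg (fun L => L v) h).symm.trans h2

theorem mfderiv_pushMap_normal (hτ : IsTubularMap n ι τ) (hψ : ContDiff ℝ ∞ ψ)
    (hψR : ∀ t, R ≤ |t| → ψ t = t) (t : ℝ) (z : Z) :
    (mfderiv (𝓡 (2 * n + 2)) (𝓡 (2 * n + 2)) (pushMap τ ψ) (τ (t, z))
      (mfderiv 𝓘(ℝ, ℝ) (𝓡 (2 * n + 2)) (fun s => τ (s, z)) t (1 : ℝ)) : Euc (2 * n + 2)) =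
    deriv ψ t • (mfderiv 𝓘(ℝ, ℝ) (𝓡 (2 * n + 2)) (fun s => τ (s, z)) (ψ t) (1 : ℝ) :
      Euc (2 * n + 2)) := by
  have h := mfderiv_comp t (g := pushMap τ ψ)
    ((contMDiff_pushMap hτ hψ hψR).mdifferentiable (by simp) (τ (t, z)))
    ((hτ.contMDiff_normal z).mdifferentiable (by simp) t)
  have h1 : pushMap τ ψ ∘ (fun s => τ (s, z)) = (fun s => τ (s, z)) ∘ ψ :=
    funext fun s => pushMap_apply hτ s z
  have h2 := congrArg (fun f : ℝ → X =>
    (mfderiv 𝓘(ℝ, ℝ) (𝓡 (2 * n + 2)) f t (1 : ℝ) : Euc (2 * n + 2))) h1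
  have hψd : DifferentiableAt ℝ ψ t := hψ.differentiable (by simp) t
  have h3 := mfderiv_comp t (g := fun s => τ (s, z)) (f := ψ)
    ((hτ.contMDiff_normal z).mdifferentiable (by simp) (ψ t)) hψd.mdifferentiableAt
  refine (congrArg (fun L => L (1 : ℝ)) h).symm.trans (h2.trans ?_)
  refine (congrArg (fun L => L (1 : ℝ)) h3).trans ?_
  have h4 : mfderiv 𝓘(ℝ, ℝ) 𝓘(ℝ, ℝ) ψ t (1 : ℝ) = deriv ψ t • (1 : ℝ) := by
    rw [mfderiv_eq_fderiv, smul_eq_mul, mul_one]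
    rfl
  refine (congrArg (mfderiv 𝓘(ℝ, ℝ) (𝓡 (2 * n + 2)) (fun s => τ (s, z)) (ψ t)) h4).trans ?_
  exact map_smul (mfderiv 𝓘(ℝ, ℝ) (𝓡 (2 * n + 2)) (fun s => τ (s, z)) (ψ t)) (deriv ψ t) (1 : ℝ)

end PushMap

/-! ### The pulled back form on a collar domain -/

section SymplVol

variable {n : ℕ} {V : Type*} [AddCommGroup V] [Module ℝ V]

theorem symplVol_cons_smul (B : V →ₗ[ℝ] V →ₗ[ℝ] ℝ) (r : ℝ) (N : V) (v : Fin (2 * n + 1) → V) :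
    symplVol n (fun a b => B a b) (Fin.cons (r • N) v) =
      r * symplVol n (fun a b => B a b) (Fin.cons N v) := by
  have h1 : ∀ ν, symplVol n (fun a b => B a b) (Fin.cons ν v) = (symplVolAlt n B).curryLeft ν v :=
    fun ν => (symplVolAlt_apply n B _).symm
  rw [h1, h1, map_smul, AlternatingMap.smul_apply, smul_eq_mul]

/-- Modulo vectors tangent to a hyperplane, only the normal component of the first vector matters. -/
theorem symplVol_cons_smul_add {U : Type*} [AddCommGroup U] [Module ℝ U] [FiniteDimensional ℝ U]
    (hU : Module.finrank ℝ U = 2 * n + 1) (B : V →ₗ[ℝ] V →ₗ[ℝ] ℝ) (L : U →ₗ[ℝ] V) (r : ℝ) (N : V)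
    (u : U) (v : Fin (2 * n + 1) → U) :
    symplVol n (fun a b => B a b) (Fin.cons (r • N + L u) fun i => L (v i)) =
      r * symplVol n (fun a b => B a b) (Fin.cons N fun i => L (v i)) := by
  have h1 : ∀ ν, symplVol n (fun a b => B a b) (Fin.cons ν fun i => L (v i)) =
      (symplVolAlt n B).curryLeft ν fun i => L (v i) := fun ν => (symplVolAlt_apply n B _).symm
  have htan : (symplVolAlt n B).curryLeft (L u) (fun i => L (v i)) = 0 := by
    have hdep : ¬LinearIndependent ℝ (Fin.cons u v : Fin (2 * n + 2) → U) := by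
      intro h
      have := h.fintype_card_le_finrank
      rw [hU] at this
      simp at this
    have h2 := ((symplVolAlt n B).compLinearMap L).map_linearDependent _ hdep
    rw [AlternatingMap.compLinearMap_apply] at h2
    refine Eq.trans (congrArg (symplVolAlt n B) ?_) h2
    funext i
    refine Fin.cases ?_ (fun i => ?_) i <;> rfl
  rw [h1, h1, map_add, map_smul, AlternatingMap.add_apply, AlternatingMap.smul_apply, htan,
    add_zero, smul_eq_mul]

end SymplVol

section Filling

variable {n : ℕ}
  {Z : Type*} [TopologicalSpace Z] [ChartedSpace (Euc (2 * n + 1)) Z]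
  {X : Type*} [TopologicalSpace X] [ChartedSpace (Euc (2 * n + 2)) X]
  {ι : Z → X} {τ : ℝ × Z → X} {ψ : ℝ → ℝ} {R : ℝ}
  {Ω : DForm (2 * n + 2) X 2} {α : DForm (2 * n + 1) Z 1}

theorem apply_pair_congr_point (Ω : DForm (2 * n + 2) X 2) {p p' : X} (h : p = p')
    {v w v' w' : Euc (2 * n + 2)} (hv : v = v') (hw : w = w') : Ω p ![v, w] = Ω p' ![v', w'] := by
  subst h hv hw
  rfl

theorem symplVol_congr_point (Ω : DForm (2 * n + 2) X 2) {p p' : X} (h : p = p')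
    {w w' : Fin (2 * n + 2) → Euc (2 * n + 2)} (hw : w = w') :
    symplVol n (fun a b => Ω p ![a, b]) w = symplVol n (fun a b => Ω p' ![a, b]) w' := by
  subst h hw
  rfl

theorem symplVol_pullbackForm (Ψ : X → X) (Ω : DForm (2 * n + 2) X 2) (p : X)
    (w : Fin (2 * n + 2) → TangentSpace (𝓡 (2 * n + 2)) p) :
    symplVol n (fun a b => pullbackForm Ψ Ω p ![a, b]) w =
      symplVol n (fun a b => Ω (Ψ p) ![a, b])
        fun i => mfderiv (𝓡 (2 * n + 2)) (𝓡 (2 * n + 2)) Ψ p (w i) := by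
  rw [symplVol, symplVol]
  simp only [pullbackForm_pair]

section PushMap

variable [CompactSpace Z] [T2Space X] [Nonempty (ℝ × Z)] (hτ : IsTubularMap n ι τ)
  (hψ : ContDiff ℝ ∞ ψ) (hψR : ∀ t, R ≤ |t| → ψ t = t)
include hτ hψ hψR

/-- The differential of `pushMap` is bijective at points where `ψ` has nonzero derivative; off the
collar `pushMap` is locally the identity. -/
theorem bijective_mfderiv_pushMap {p : X} (hp : ∀ t z, p = τ (t, z) → deriv ψ t ≠ 0) :
    Function.Bijective (mfderiv (𝓡 (2 * n + 2)) (𝓡 (2 * n + 2)) (pushMap τ ψ) p) := by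
  by_cases hpτ : p ∈ Set.range τ
  · obtain ⟨⟨t, z⟩, rfl⟩ := hpτ
    have hψd : DifferentiableAt ℝ ψ t := hψ.differentiable (by simp) t
    have h1 := HasMFDerivAt.comp (g := pushMap τ ψ) (t, z)
      ((contMDiff_pushMap hτ hψ hψR).mdifferentiable (by simp) (τ (t, z))).hasMFDerivAt
      (hτ.contMDiff.mdifferentiable (by simp) (t, z)).hasMFDerivAt
    have h2 : HasMFDerivAt (𝓘(ℝ, ℝ).prod (𝓡 (2 * n + 1))) (𝓘(ℝ, ℝ).prod (𝓡 (2 * n + 1)))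
        (Prod.map ψ (id : Z → Z)) (t, z)
        ((fderiv ℝ ψ t).prodMap (ContinuousLinearMap.id ℝ (Euc (2 * n + 1)))) := by
      have h := HasMFDerivAt.prodMap (p := (t, z)) hψd.mdifferentiableAt.hasMFDerivAt
        (hasMFDerivAt_id (I := 𝓡 (2 * n + 1)) z)
      rw [mfderiv_eq_fderiv, mfderiv_id] at h
      exact h
    have h3 := HasMFDerivAt.comp (g := τ) (t, z)
      (hτ.contMDiff.mdifferentiable (by simp) (ψ t, z)).hasMFDerivAt h2
    have h4 : pushMap τ ψ ∘ τ = τ ∘ Prod.map ψ id := funext fun q => pushMap_apply hτ q.1 q.2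
    rw [h4] at h1
    have h5 := hasMFDerivAt_unique h1 h3
    have b1 : Function.Bijective
        (mfderiv (𝓘(ℝ, ℝ).prod (𝓡 (2 * n + 1))) (𝓡 (2 * n + 2)) τ (t, z)) :=
      ((hτ.isLocalDiffeomorph (t, z)).mfderivToContinuousLinearEquiv (by simp)).bijective
    have b2 : Function.Bijective
        (mfderiv (𝓘(ℝ, ℝ).prod (𝓡 (2 * n + 1))) (𝓡 (2 * n + 2)) τ (ψ t, z)) :=
      ((hτ.isLocalDiffeomorph (ψ t, z)).mfderivToContinuousLinearEquiv (by simp)).bijective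
    have b3 : Function.Bijective fun x : ℝ => fderiv ℝ ψ t x := by
      have h6 : (fun x : ℝ => fderiv ℝ ψ t x) = fun x => x * deriv ψ t := by
        funext x
        rw [fderiv_eq_smul_deriv, smul_eq_mul]
      rw [h6]
      exact mulRight_bijective₀ _ (hp t z rfl)
    have b4 : Function.Bijective (Prod.map (fun x : ℝ => fderiv ℝ ψ t x)
        (id : Euc (2 * n + 1) → Euc (2 * n + 1))) := b3.prodMap Function.bijective_id
    refine (Function.Bijective.of_comp_iff _ b1).1 ?_
    have h6 : mfderiv (𝓡 (2 * n + 2)) (𝓡 (2 * n + 2)) (pushMap τ ψ) (τ (t, z)) ∘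
        mfderiv (𝓘(ℝ, ℝ).prod (𝓡 (2 * n + 1))) (𝓡 (2 * n + 2)) τ (t, z) =
        mfderiv (𝓘(ℝ, ℝ).prod (𝓡 (2 * n + 1))) (𝓡 (2 * n + 2)) τ (ψ t, z) ∘
          Prod.map (fun x : ℝ => fderiv ℝ ψ t x) id := by
      funext x
      exact congrArg (fun L => L x) h5
    rw [h6]
    exact b2.comp b4
  · rw [(pushMap_eventuallyEq hτ hψR hpτ).mfderiv_eq, mfderiv_id]
    exact Function.bijective_id

variable [IsManifold (𝓡 (2 * n + 2)) ∞ X]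

omit [IsManifold (𝓡 (2 * n + 2)) ∞ X] in
theorem pullback_pushMap_slice (Ω : DForm (2 * n + 2) X 2) (t : ℝ) (z : Z)
    (v w : TangentSpace (𝓡 (2 * n + 1)) z) :
    pullbackForm (pushMap τ ψ) Ω (τ (t, z)) ![
      mfderiv (𝓡 (2 * n + 1)) (𝓡 (2 * n + 2)) (fun z' => τ (t, z')) z v,
      mfderiv (𝓡 (2 * n + 1)) (𝓡 (2 * n + 2)) (fun z' => τ (t, z')) z w] =
    Ω (τ (ψ t, z)) ![mfderiv (𝓡 (2 * n + 1)) (𝓡 (2 * n + 2)) (fun z' => τ (ψ t, z')) z v,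
      mfderiv (𝓡 (2 * n + 1)) (𝓡 (2 * n + 2)) (fun z' => τ (ψ t, z')) z w] := by
  rw [pullbackForm_pair]
  exact apply_pair_congr_point Ω (pushMap_apply hτ t z) (mfderiv_pushMap_slice hτ hψ hψR t z v)
    (mfderiv_pushMap_slice hτ hψ hψR t z w)

/-- The pulled back form is symplectic on the domain: there `pushMap` avoids the hypersurface, where
the form is singular, and has bijective differential. -/
theorem IsCollarDomain.isSymplecticOn {W : Set X} {ε : ℝ} (hW : IsCollarDomain τ ε W)
    (hΩ : IsSymplecticOn Ω (Set.range ι)ᶜ) (hψ0 : ∀ t, ε ≤ t → 0 < ψ t)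
    (hψ1 : ∀ t, ε ≤ t → 0 < deriv ψ t) : IsSymplecticOn (pullbackForm (pushMap τ ψ) Ω) W := by
  have hsm := contMDiff_pushMap hτ hψ hψR
  obtain ⟨V, hV, hSV, hs⟩ := hΩ.smooth
  have hmem : ∀ p ∈ W, pushMap τ ψ p ∈ (Set.range ι)ᶜ := by
    intro p hp
    by_cases hpτ : p ∈ Set.range τ
    · obtain ⟨⟨t, z⟩, rfl⟩ := hpτ
      rw [pushMap_apply hτ, Set.mem_compl_iff, hτ.mem_range_iff]
      exact (hψ0 t ((hW.mem_iff t z).1 hp)).ne'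
    · rw [pushMap_of_notMem hpτ]
      rintro ⟨z, rfl⟩
      exact hpτ ⟨(0, z), hτ.zero_section z⟩
  refine ⟨⟨pushMap τ ψ ⁻¹' V, hV.preimage hsm.continuous, fun p hp => hSV (hmem p hp),
    hs.pullbackForm hsm hV⟩, fun p hp => ?_, fun p hp v _ hv => ?_⟩
  · exact extD_pullbackForm_eq_zero hsm hs (hV.mem_nhds (hSV (hmem p hp))) (hΩ.closed _ (hmem p hp))
  · have hb := bijective_mfderiv_pushMap hτ hψ hψR (p := p) (by
      rintro t z rfl
      exact (hψ1 t ((hW.mem_iff t z).1 hp)).ne')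
    refine hb.1 ?_
    rw [map_zero]
    refine hΩ.nondeg _ (hmem p hp) _ trivial fun w _ => ?_
    obtain ⟨w, rfl⟩ := hb.2 w
    exact (pullbackForm_pair Ω p v w).symm.trans (hv w trivial)

omit [IsManifold (𝓡 (2 * n + 2)) ∞ X] in
/-- The boundary orientation of a collar domain is the contact orientation. Outward vectors are
negative multiples of `∂_t` modulo the boundary, and `pushMap` takes `∂_t` to a positive multiple
of `∂_t`, so this is the orientation condition on the slice to which the boundary is pushed. -/
theorem IsCollarDomain.symplVol_pos [IsManifold (𝓡 (2 * n + 1)) ∞ Z] {W : Set X} {ε : ℝ}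
    (hW : IsCollarDomain τ ε W) (hψ0 : 0 < ψ ε) (hψ1 : 0 < deriv ψ ε) {z : Z}
    (hs : IsWeakSlice Ω α τ (ψ ε) z) {ν : TangentSpace (𝓡 (2 * n + 2)) (τ (ε, z))}
    {v : Fin (2 * n + 1) → TangentSpace (𝓡 (2 * n + 1)) z} (hν : PointsOutward W (τ (ε, z)) ν)
    (hv : 0 < contactVolAt α z v) :
    0 < symplVol n (fun a b => pullbackForm (pushMap τ ψ) Ω (τ (ε, z)) ![a, b])
      (Fin.cons ν fun i =>
        mfderiv (𝓡 (2 * n + 1)) (𝓡 (2 * n + 2)) (fun z' => τ (ε, z')) z (v i)) := by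
  obtain ⟨r, u, hr, rfl⟩ := hW.exists_eq_of_pointsOutward hτ hν
  set N' : Euc (2 * n + 2) :=
    mfderiv 𝓘(ℝ, ℝ) (𝓡 (2 * n + 2)) (fun s => τ (s, z)) (ψ ε) (1 : ℝ) with hN'
  set L' : Fin (2 * n + 1) → Euc (2 * n + 2) := fun i =>
    mfderiv (𝓡 (2 * n + 1)) (𝓡 (2 * n + 2)) (fun z' => τ (ψ ε, z')) z (v i) with hL'
  have hneg : ψ ε * symplVol n (fun a b => Ω (τ (ψ ε, z)) ![a, b]) (Fin.cons N' L') < 0 :=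
    hs.orientation v hv
  have h2 := (pos_iff_neg_of_mul_neg hneg).1 hψ0
  have h3 := symplVol_cons_smul_add (finrank_tangentSpace (2 * n + 1) z)
    (formBilin (pullbackForm (pushMap τ ψ) Ω (τ (ε, z))))
    (mfderiv (𝓡 (2 * n + 1)) (𝓡 (2 * n + 2)) (fun z' => τ (ε, z')) z).toLinearMap r
    (mfderiv 𝓘(ℝ, ℝ) (𝓡 (2 * n + 2)) (fun t => τ (t, z)) ε (1 : ℝ)) u v
  have h4 := (symplVol_pullbackForm (pushMap τ ψ) Ω (τ (ε, z))
    (Fin.cons (mfderiv 𝓘(ℝ, ℝ) (𝓡 (2 * n + 2)) (fun t => τ (t, z)) ε (1 : ℝ))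
      fun i => mfderiv (𝓡 (2 * n + 1)) (𝓡 (2 * n + 2)) (fun z' => τ (ε, z')) z (v i))).trans
    (symplVol_congr_point Ω (pushMap_apply hτ ε z)
      (w' := Fin.cons (deriv ψ ε • N') L') (by
        funext i
        refine Fin.cases ?_ (fun i => ?_) i
        · exact mfderiv_pushMap_normal hτ hψ hψR ε z
        · exact mfderiv_pushMap_slice hτ hψ hψR ε z (v i)))
  have h5 := symplVol_cons_smul (formBilin (Ω (τ (ψ ε, z)))) (deriv ψ ε) N' L'
  refine lt_of_lt_of_eq ?_ (h3.trans (congrArg (fun x => r * x) (h4.trans h5))).symm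
  exact mul_pos_of_neg_of_neg hr (mul_neg_of_pos_of_neg hψ1 h2)

end PushMap

end Filling

/-! ### Weak fillings -/

section WeakFilling

variable {n : ℕ}
  {Z : Type*} [TopologicalSpace Z] [ChartedSpace (Euc (2 * n + 1)) Z]
  [IsManifold (𝓡 (2 * n + 1)) ∞ Z]
  {X : Type*} [TopologicalSpace X] [ChartedSpace (Euc (2 * n + 2)) X]
  [IsManifold (𝓡 (2 * n + 2)) ∞ X] [T2Space X] [CompactSpace X]
  {ι : Z → X} {τ : ℝ × Z → X}
  {Ω : DForm (2 * n + 2) X 2} {α : DForm (2 * n + 1) Z 1}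

/-- If the collar is pushed so that the boundary goes to a slice satisfying the conditions for the
boundary of a weak filling, then the pulled back form makes the domain a weak filling. -/
theorem IsCollarDomain.isWeakFilling [CompactSpace Z] [Nonempty (ℝ × Z)] {W : Set X} {ε R : ℝ}
    {ψ : ℝ → ℝ} (hW : IsCollarDomain τ ε W) (hWc : IsConnected W) (hτ : IsTubularMap n ι τ)
    (hΩ : IsSymplecticOn Ω (Set.range ι)ᶜ) (hψ : ContDiff ℝ ∞ ψ) (hψR : ∀ t, R ≤ |t| → ψ t = t)
    (hψ0 : ∀ t, ε ≤ t → 0 < ψ t) (hψ1 : ∀ t, ε ≤ t → 0 < deriv ψ t)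
    (hs : ∀ z, IsWeakSlice Ω α τ (ψ ε) z) :
    IsWeakFilling W (pullbackForm (pushMap τ ψ) Ω) (fun z => τ (ε, z)) α where
  isCompact := hW.isClosed.isCompact
  isConnected := hWc
  isSmoothDomain := hW.isSmoothDomain hτ
  symplectic := hW.isSymplecticOn hτ hψ hψR hΩ hψ0 hψ1
  embedding := hτ.isSmoothEmbedding_slice ε
  range_eq := (hW.frontier_eq hτ).symm
  orientation := fun z _ _ hν hv =>
    hW.symplVol_pos hτ hψ hψR (hψ0 ε le_rfl) (hψ1 ε le_rfl) (hs z) hν hv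
  symplectic_on_contact := fun z => by
    have h := (hs z).nondeg 0 le_rfl
    simp only [zero_mul, add_zero] at h
    simp only [pullback_pushMap_slice hτ hψ hψR]
    exact h
  weak := fun f _ hf z => by
    have h := (hs z).nondeg (f z) (hf z).le
    simp only [pullback_pushMap_slice hτ hψ hψR]
    exact h

omit [T2Space X] [CompactSpace X] in
/-- All slices sufficiently close to the hypersurface satisfy the conditions for the boundary of a
weak filling. -/
theorem exists_forall_isWeakSlice [CompactSpace Z] (hα : IsContactForm α)
    (hΩ : IsScatteringFilling ι Ω α) (hτ : IsTubularMap n ι τ) {ε : ℝ} (hε : 0 < ε) :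
    ∃ δ, 0 < δ ∧ δ ≤ ε ∧ ∀ z, IsWeakSlice Ω α τ δ z := by
  have h1 : ∀ᶠ t in 𝓝 (0 : ℝ), ∀ z ∈ (Set.univ : Set Z), t ≠ 0 → IsWeakSlice Ω α τ t z :=
    isCompact_univ.eventually_forall_of_forall_eventually fun z _ =>
      eventually_isWeakSlice hα hΩ hτ z
  have h2 : ∀ᶠ t : ℝ in 𝓝[>] 0, t ∈ Set.Ioc 0 ε := Ioc_mem_nhdsGT hε
  obtain ⟨δ, hδ, hδ'⟩ := ((h1.filter_mono nhdsWithin_le_nhds).and h2).exists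
  exact ⟨δ, hδ'.1, hδ'.2, fun z => hδ z trivial hδ'.1.ne'⟩

omit [IsManifold (𝓡 (2 * n + 1)) ∞ Z] [IsManifold (𝓡 (2 * n + 2)) ∞ X] [T2Space X]
  [CompactSpace X] in
/-- The collar with its two sides exchanged. -/
theorem IsTubularMap.reverse (hτ : IsTubularMap n ι τ) :
    IsTubularMap n ι fun p => τ (-p.1, p.2) := by
  let σ : Diffeomorph (𝓘(ℝ, ℝ).prod (𝓡 (2 * n + 1))) (𝓘(ℝ, ℝ).prod (𝓡 (2 * n + 1)))
      (ℝ × Z) (ℝ × Z) ∞ :=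
    { toFun := fun p => (-p.1, p.2)
      invFun := fun p => (-p.1, p.2)
      left_inv := fun p => by simp
      right_inv := fun p => by simp
      contMDiff_toFun := contMDiff_fst.neg.prodMk contMDiff_snd
      contMDiff_invFun := contMDiff_fst.neg.prodMk contMDiff_snd }
  refine ⟨hτ.injective.comp σ.injective, fun p => ?_, fun z => ?_⟩
  · exact (σ.isLocalDiffeomorph p).comp (g := τ) (𝓡 (2 * n + 2)) X (hτ.isLocalDiffeomorph (σ p))
  · change τ (-0, z) = ι z
    rw [neg_zero, hτ.zero_section]

/-- A component of the complement of the collar neighbourhood that meets the positive end of the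
collar is a weak filling. -/
theorem exists_isWeakFilling_of_pos [CompactSpace Z] [ConnectedSpace Z]
    (hX : Orientable (2 * n + 2) X) (hα : IsContactForm α)
    (hΩ : IsScatteringFilling ι Ω α) (hτ : IsTubularMap n ι τ) {ε : ℝ} (hε : 0 < ε) {x : X}
    (hx : x ∉ τ '' (Set.Ioo (-ε) ε ×ˢ Set.univ)) {t : ℝ} {z : Z} (ht : 0 < t)
    (h : τ (t, z) ∈ connectedComponentIn (τ '' (Set.Ioo (-ε) ε ×ˢ Set.univ))ᶜ x) :
    ∃ Ω', IsWeakFilling (connectedComponentIn (τ '' (Set.Ioo (-ε) ε ×ˢ Set.univ))ᶜ x) Ω'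
      (fun z => τ (ε, z)) α := by
  obtain ⟨δ, hδ, hδε, hs⟩ := exists_forall_isWeakSlice hα hΩ hτ hε
  have : Nonempty (ℝ × Z) := ⟨(0, z)⟩
  refine ⟨_, (isCollarDomain_connectedComponentIn hX hα hΩ hτ hε ht h).isWeakFilling
    (isConnected_connectedComponentIn_iff.2 hx) hτ hΩ.scattering.symplectic
    (contDiff_pushFun ε δ) (fun t => pushFun_of_le_abs hε)
    (fun t ht => hδ.trans_le (le_pushFun hε hδε ht)) (fun t => deriv_pushFun_pos hε hδε) ?_⟩
  rwa [pushFun_self hε]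

end WeakFilling

end ScatteringFilling

end

theorem mainTheorem3 (n : ℕ)
    {Z : Type*} [TopologicalSpace Z] [ChartedSpace (ScatteringFilling.Euc (2 * n + 1)) Z]
    [IsManifold (𝓡 (2 * n + 1)) ∞ Z] [ConnectedSpace Z]
    {X : Type*} [TopologicalSpace X] [ChartedSpace (ScatteringFilling.Euc (2 * n + 2)) X]
    [IsManifold (𝓡 (2 * n + 2)) ∞ X] [T2Space X] [CompactSpace X]
    (hX : ScatteringFilling.Orientable (2 * n + 2) X)
    (α : ScatteringFilling.DForm (2 * n + 1) Z 1) (hα : ScatteringFilling.IsContactForm α)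
    (ι : Z → X) (Ω : ScatteringFilling.DForm (2 * n + 2) X 2)
    (hΩ : ScatteringFilling.IsScatteringFilling ι Ω α)
    (τ : ℝ × Z → X) (hτ : ScatteringFilling.IsTubularMap n ι τ)
    (ε : ℝ) (hε : 0 < ε) (U : Set X) (hU : U = τ '' (Set.Ioo (-ε) ε ×ˢ Set.univ))
    (x : X) (hx : x ∉ U) (hxZ : ∃ z, ι z ∈ connectedComponent x)
    (W : Set X) (hW : W = connectedComponentIn Uᶜ x) :
    ∃ (s : ℝ) (Ω' : ScatteringFilling.DForm (2 * n + 2) X 2), (s = ε ∨ s = -ε) ∧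
      ScatteringFilling.IsWeakFilling W Ω' (fun z => τ (s, z)) α := by
  subst hU hW
  have hZ : CompactSpace Z :=
    (Topology.IsClosedEmbedding.mk hΩ.embedding.isEmbedding hΩ.isClosed_range).compactSpace
  obtain ⟨t, z, h⟩ := ScatteringFilling.exists_collar_mem hτ hx hxZ
  rcases lt_trichotomy t 0 with ht | rfl | ht
  · have hrev : τ '' (Set.Ioo (-ε) ε ×ˢ Set.univ) =
        (fun p : ℝ × Z => τ (-p.1, p.2)) '' (Set.Ioo (-ε) ε ×ˢ Set.univ) := by
      ext p
      constructor
      · rintro ⟨⟨s, z⟩, ⟨hs, -⟩, rfl⟩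
        exact ⟨(-s, z), ⟨⟨by linarith [hs.2], by linarith [hs.1]⟩, trivial⟩, by simp⟩
      · rintro ⟨⟨s, z⟩, ⟨hs, -⟩, rfl⟩
        exact ⟨(-s, z), ⟨⟨by linarith [hs.2], by linarith [hs.1]⟩, trivial⟩, rfl⟩
    rw [hrev] at h hx ⊢
    obtain ⟨Ω', hΩ'⟩ := ScatteringFilling.exists_isWeakFilling_of_pos hX hα hΩ hτ.reverse hε hx
      (t := -t) (z := z) (neg_pos.2 ht) (by simpa using h)
    exact ⟨-ε, Ω', Or.inr rfl, hΩ'⟩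
  · refine absurd ⟨(0, z), ⟨⟨by linarith, hε⟩, trivial⟩, rfl⟩ (connectedComponentIn_subset _ _ h)
  · obtain ⟨Ω', hΩ'⟩ := ScatteringFilling.exists_isWeakFilling_of_pos hX hα hΩ hτ hε hx ht h
    exact ⟨ε, Ω', Or.inl rfl, hΩ'⟩
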